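/- Let $\xi,\xi_0,\xi_1,\xi_2,\dots$ be i.i.d. complex random variables with $\mathbb E[\xi]=0$, $\sigma_1^2:=\mathbb E[(\Re\xi)^2]<\infty$, $\sigma_2^2:=\mathbb E[(\Im\xi)^2]<\infty$, $\sigma^2:=\sigma_1^2+\sigma_2^2>0$ and $\mathrm{Cov}[\Re\xi,\Im\xi]=0$. Let $b:[0,\infty)\to\mathbb R$ be measurable with $b(x)=x^{\alpha}\ell(x)$ for $x>0$, where $\alpha>-\tfrac12$ and $\ell$ is slowly varying at $+\infty$, that is, $\ell$ is measurable, eventually positive and $\ell(\lambda x)/\ell(x)\to1$ as $x\to+\infty$ for every $\lambda>0$. Put $P_n(z)=\sum_{k=0}^n b(k)\xi_kz^k$. Let $\mathcal A(\mathbb C)$ be the space of entire functions with the topology of locally uniform convergence, and $M_p(\mathbb C)$ the space of locally finite integer-valued measures on $\mathbb C$ with the vague topology. Then for every fixed $\psi\in[0,2\pi)$ there is a centred Gaussian analytic function $G_\psi$ (a random element of $\mathcal A(\mathbb C)$ with centred complex Gaussian, not necessarily circularly symmetric, finite-dimensional distributions) such that, for all $u_1,u_2\in\mathbb C$, $$\mathbb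 E[G_\psi(u_1)\overline{G_\psi(u_2)}]=\sigma^2\int_0^1x^{2\alpha}e^{x(u_1+\overline{u_2})}\,dx,$$ $$\mathbb E[G_\psi(u_1)G_\psi(u_2)]=\begin{cases}(\sigma_1^2-\sigma_2^2)\displaystyle\int_0^1x^{2\alpha}e^{x(u_1+u_2)}\,dx,&\psi\in\{0,\pi\},\\0,&\psi\in(0,\pi)\cup(\pi,2\pi),\end{cases}$$ and for every such $G_\psi$, as $n\to\infty$, $$\left(\frac{P_n(e^{i\psi+u/n})}{b(n)\sqrt n}\right)_{u\in\mathbb C}\Longrightarrow(G_\psi(u))_{u\in\mathbb C}\quad\text{in distribution on }\mathcal A(\mathbb C).$$ Moreover $G_\psi\not\equiv0$ almost surely, and the point process of zeros (counted with multiplicity) of $u\mapsto P_n(e^{i\psi+u/n})$ converges in distribution on $M_p(\mathbb C)$ to the point process of zeros of $G_\psi$. (The null function is assigned the zero measure.) -/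

import Mathlib

open MeasureTheory ProbabilityTheory Filter Topology Set
open scoped ComplexConjugate ENNReal CompactlySupported

noncomputable section

/-! ### Regular variation -/

/-- A measurable, eventually positive function `ℓ` with `ℓ (c x) / ℓ x → 1` as `x → +∞`
for every `c > 0`. Only the values on `(0, +∞)` matter. -/
structure SlowlyVarying (ℓ : ℝ → ℝ) : Prop where
  measurable : Measurable ℓ
  eventually_pos : ∀ᶠ x in atTop, 0 < ℓ x
  tendsto_ratio : ∀ c : ℝ, 0 < c → Tendsto (fun x => ℓ (c * x) / ℓ x) atTop (𝓝 1)

/-- `b` varies regularly at `+∞` with index `α`: it is measurable and `b x = x ^ α * ℓ x` for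
`x > 0` with `ℓ` slowly varying. A function on `[0, +∞)` is represented by any measurable
extension to `ℝ`; the values at negative arguments are never used. -/
structure RegularlyVarying (b : ℝ → ℝ) (α : ℝ) : Prop where
  measurable : Measurable b
  exists_slowlyVarying : ∃ ℓ : ℝ → ℝ, SlowlyVarying ℓ ∧ ∀ x : ℝ, 0 < x → b x = x ^ α * ℓ x

/-! ### The space of entire functions -/

/-- The entire functions, as a subspace of the continuous functions `ℂ → ℂ`. -/
def entireSubmodule : Submodule ℂ C(ℂ, ℂ) where
  carrier := {f | Differentiable ℂ f}
  add_mem' hf hg := Differentiable.add hf hg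
  zero_mem' := differentiable_const (0 : ℂ)
  smul_mem' c _ hf := Differentiable.const_smul hf c

/-- The space `𝒜(ℂ)` of entire functions. Its topology is the subspace topology of the
compact-open topology on `C(ℂ, ℂ)`, that is, the topology of locally uniform convergence. -/
abbrev EntireFunction : Type := entireSubmodule

instance : MeasurableSpace EntireFunction := borel EntireFunction

instance : BorelSpace EntireFunction := ⟨rfl⟩

/-! ### Point measures and zeros -/

/-- `M_p(ℂ)`: the locally finite Borel measures on `ℂ` that take integer values on bounded
Borel sets. -/
def PointMeasure : Type :=
  {μ : Measure ℂ // IsLocallyFiniteMeasure μ ∧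
    ∀ B : Set ℂ, MeasurableSet B → Bornology.IsBounded B → ∃ m : ℕ, μ B = m}

namespace PointMeasure

/-- The vague topology: the coarsest topology for which `μ ↦ ∫ φ dμ` is continuous for every
continuous compactly supported `φ : ℂ → ℝ`. -/
instance : TopologicalSpace PointMeasure :=
  TopologicalSpace.induced (fun (μ : PointMeasure) (φ : C_c(ℂ, ℝ)) => ∫ z, φ z ∂μ.1)
    Pi.topologicalSpace

instance : MeasurableSpace PointMeasure := borel PointMeasure

instance : BorelSpace PointMeasure := ⟨rfl⟩

end PointMeasure

/-- The zero counting measure of an entire function: a unit mass at every zero, repeated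
according to multiplicity. (The order of vanishing of the null function, which is infinite, is
read as `0` by `analyticOrderNatAt`, so the null function gets the zero measure.) -/
def zeroMeasure (f : EntireFunction) : Measure ℂ :=
  Measure.sum fun z : ℂ => (analyticOrderNatAt (f.1 : ℂ → ℂ) z : ℝ≥0∞) • Measure.dirac z

theorem analyticOrderNatAt_support_finite (f : EntireFunction) {B : Set ℂ}
    (hB : Bornology.IsBounded B) :
    {z | z ∈ B ∧ analyticOrderNatAt (f.1 : ℂ → ℂ) z ≠ 0}.Finite := by
  have hf : AnalyticOnNhd ℂ (f.1 : ℂ → ℂ) univ := fun z _ =>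
    Differentiable.analyticAt (f := (f.1 : ℂ → ℂ)) f.2 z
  by_contra hinf
  obtain ⟨x, -, hx⟩ := Set.Infinite.exists_accPt_of_subset_isCompact hinf
    hB.isCompact_closure (fun z hz => subset_closure hz.1)
  have hfr : ∃ᶠ z in 𝓝[≠] x, (f.1 : ℂ → ℂ) z = (fun _ => (0 : ℂ)) z := by
    refine (accPt_iff_frequently_nhdsNE.mp hx).mono fun z hz => ?_
    by_contra hne
    exact hz.2 (by simp [analyticOrderNatAt, analyticOrderAt_eq_zero.mpr (Or.inr hne)])
  have h0 := hf.eq_of_frequently_eq (fun z _ => analyticAt_const) hfr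
  apply hinf
  convert Set.finite_empty
  ext z
  have : analyticOrderAt (f.1 : ℂ → ℂ) z = ⊤ :=
    analyticOrderAt_eq_top.mpr (Eventually.of_forall fun w => congrFun h0 w)
  simp [analyticOrderNatAt, this]

theorem zeroMeasure_bounded (f : EntireFunction) (B : Set ℂ) (hB : MeasurableSet B)
    (hb : Bornology.IsBounded B) : ∃ m : ℕ, zeroMeasure f B = m := by
  have hfin := analyticOrderNatAt_support_finite f hb
  refine ⟨∑ z ∈ hfin.toFinset, analyticOrderNatAt (f.1 : ℂ → ℂ) z, ?_⟩
  rw [zeroMeasure, Measure.sum_apply _ hB, tsum_eq_sum (s := hfin.toFinset)]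
  · push_cast
    refine Finset.sum_congr rfl fun z hz => ?_
    have hz' : z ∈ B := ((Set.Finite.mem_toFinset hfin).mp hz).1
    simp [Measure.dirac_apply' z hB, hz']
  · intro z hz
    by_cases hzB : z ∈ B
    · have : analyticOrderNatAt (f.1 : ℂ → ℂ) z = 0 := by
        by_contra hne
        exact hz ((Set.Finite.mem_toFinset hfin).mpr ⟨hzB, hne⟩)
      simp [this]
    · simp [Measure.dirac_apply' z hB, hzB]

/-- The map `Zeros` from entire functions to `M_p(ℂ)`. On functions that are not identically
zero it gives the point measure of zeros with multiplicities; the value at the null function is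
the zero measure, by convention. -/
def zeros (f : EntireFunction) : PointMeasure :=
  ⟨zeroMeasure f, ⟨fun x => by
    obtain ⟨m, hm⟩ := zeroMeasure_bounded f (Metric.ball x 1) measurableSet_ball
      Metric.isBounded_ball
    exact ⟨Metric.ball x 1, Metric.ball_mem_nhds x one_pos, by
      rw [hm]; exact ENNReal.natCast_lt_top m⟩⟩, zeroMeasure_bounded f⟩

/-! ### The random polynomials -/

/-- The polynomial `P_n(z) = ∑_{k=0}^n b(k) x_k z^k`. -/
def regPoly (b : ℝ → ℝ) (x : ℕ → ℂ) (n : ℕ) : Polynomial ℂ :=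
  ∑ k ∈ Finset.range (n + 1), Polynomial.monomial k ((b k : ℂ) * x k)

/-- The entire function `u ↦ P_n(exp(iψ + u/n))`. -/
def localPoly (b : ℝ → ℝ) (x : ℕ → ℂ) (ψ : ℝ) (n : ℕ) : EntireFunction :=
  ⟨⟨fun u : ℂ => (regPoly b x n).eval (Complex.exp (Complex.I * ψ + u / n)), by fun_prop⟩, by
    change Differentiable ℂ fun u : ℂ =>
      (regPoly b x n).eval (Complex.exp (Complex.I * ψ + u / n))
    exact (regPoly b x n).differentiable.comp (by fun_prop)⟩

/-- The entire function `u ↦ P_n(exp(iψ + u/n)) / (b(n) √n)`. -/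
def normalizedLocalPoly (b : ℝ → ℝ) (x : ℕ → ℂ) (ψ : ℝ) (n : ℕ) : EntireFunction :=
  ((b n * √n : ℝ) : ℂ)⁻¹ • localPoly b x ψ n

/-! ### The limiting Gaussian analytic function -/

/-- `Φ_β(w) = ∫₀¹ x^β e^{x w} dx`. -/
def expMoment (β : ℝ) (w : ℂ) : ℂ :=
  ∫ x in (0 : ℝ)..1, ((x ^ β : ℝ) : ℂ) * Complex.exp (x * w)

/-- `G` is a centred Gaussian analytic function on `ℂ`: a random element of `𝒜(ℂ)` whose
finite-dimensional distributions are centred complex Gaussian. As usual, a vector in `ℂ^m` is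
complex Gaussian if it is Gaussian as a vector in `ℝ^{2m}`; circular symmetry is not required. -/
structure IsCentredGAF {Ω : Type*} [MeasurableSpace Ω] (G : Ω → EntireFunction)
    (P : Measure Ω) : Prop where
  aemeasurable : AEMeasurable G P
  isGaussianProcess : IsGaussianProcess (fun (u : ℂ) ω => (G ω).1 u) P
  centred : ∀ u : ℂ, ∫ ω, (G ω).1 u ∂P = 0

/-- `G` is a version of the centred Gaussian analytic function `G_ψ`, with the covariance and
pseudo-covariance belonging to `α`, `ψ`, `σ₁²` and `σ₂²`. -/
structure IsLiquidGAF (α ψ σ₁ σ₂ : ℝ) {Ω : Type*} [MeasurableSpace Ω]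
    (G : Ω → EntireFunction) (P : Measure Ω) : Prop extends IsCentredGAF G P where
  covariance : ∀ u₁ u₂ : ℂ, ∫ ω, (G ω).1 u₁ * conj ((G ω).1 u₂) ∂P =
    ((σ₁ ^ 2 + σ₂ ^ 2 : ℝ) : ℂ) * expMoment (2 * α) (u₁ + conj u₂)
  pseudoCovariance : ∀ u₁ u₂ : ℂ, ∫ ω, (G ω).1 u₁ * (G ω).1 u₂ ∂P =
    if ψ = 0 ∨ ψ = Real.pi then
      ((σ₁ ^ 2 - σ₂ ^ 2 : ℝ) : ℂ) * expMoment (2 * α) (u₁ + u₂)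
    else 0

end

/-!
# Local scaling limit of random polynomials with regularly varying coefficients

Near `e^{iψ}` the normalized polynomial is the random exponential sum
`∑_{j ≤ n} ξ_j w_{n,j} e^{u j / n}` with deterministic weights `w_{n,j} = localWeight b ψ n j`,
where `|w_{n,j}|² = b(j)² / (n b(n)²)`. By regular variation `b(j)² / b(n)²` behaves like
`(j / n)^{2α}`, so `∑ |w_{n,j}|² f(j / n)` is a Riemann sum for `∫₀¹ x^{2α} f(x) dx`
(`IsRegularWeight.tendsto_sum`); the uniform convergence theorem and Potter's bounds for slowly
varying functions supply the convergence and the integrable majorant at the singularity `x = 0`.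
The squares `w_{n,j}²` carry in addition the phase `e^{2iψj}`. It equals `1` if `ψ ∈ {0, π}`;
otherwise `e^{2iψ} ≠ 1`, the partial sums of the phases are bounded, and summation by parts makes
the sum vanish in the limit (`IsRegularWeight.tendsto_sum_mul_pow`). This is the source of the case
distinction in the pseudo-covariance.

*Finite-dimensional distributions.* No weight dominates, so a central limit theorem for weighted
sums of i.i.d. vectors (`tendsto_integral_exp_sum_inner`) applies to every real linear functional of
finitely many values, and the two Riemann sums identify the limiting variance.

*From values to functions.* Instead of proving tightness, an entire function is compared with its
interpolation polynomial at the `m`-th roots of unity, which depends continuously on finitely many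
values. The error is bounded by the tail of the power series (aliasing), which is small uniformly in
`n` because the Taylor coefficients of `e^{u j / n}` are at most `1 / k!`. The approximation theorem
`tendstoInDistribution_of_approx` then gives convergence in distribution of the random functions.

*Existence of the limit.* The limit is the random power series `∑ g_k u^k`, where the Gaussian
coefficients `g_k` have covariance and pseudo-covariance proportional to the Gram matrix of the
functions `x^k / k!` in `L²(x^{2α} dx)`. Gram-Schmidt writes each `g_k` as a finite linear
combination of independent Gaussians (`exists_gaussian_sequence_of_gram`), and the factor `1 / k!`
makes the series converge almost surely and in `L²` (`exists_gaf`).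

*Zeros.* The zero measure is continuous at every `f ≠ 0` (`EntireFunction.continuousAt_zeros`): by
Jensen's formula, the number of zeros in a disc is an increment of circle averages of `log |f|`, and
these depend continuously on `f` as long as `f` has no zeros on the circles. As the value `G 0` is a
nondegenerate Gaussian, the limit is almost surely not the null function, and the mapping theorem
applies.
-/

/-! ### Topology of the space of entire functions -/

namespace EntireFunction

theorem isInducing_val : IsInducing (Subtype.val : EntireFunction → C(ℂ, ℂ)) := ⟨rfl⟩

instance : SecondCountableTopology EntireFunction := isInducing_val.secondCountableTopology

instance : TopologicalSpace.PseudoMetrizableSpace EntireFunction :=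
  isInducing_val.pseudoMetrizableSpace

instance : (uniformity EntireFunction).IsCountablyGenerated := by
  change (comap _ (uniformity C(ℂ, ℂ))).IsCountablyGenerated
  infer_instance

instance : ContinuousAdd EntireFunction :=
  (inferInstance : IsTopologicalAddGroup EntireFunction).toContinuousAdd

theorem ext_apply {f g : EntireFunction} (h : ∀ z, f.1 z = g.1 z) : f = g :=
  Subtype.ext (ContinuousMap.ext h)

theorem continuous_eval (z : ℂ) : Continuous fun f : EntireFunction => f.1 z :=
  (ContinuousEvalConst.continuous_eval_const z).comp continuous_subtype_val

theorem measurable_eval (z : ℂ) : Measurable fun f : EntireFunction => f.1 z :=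
  (continuous_eval z).measurable

theorem tendsto_iff_closedBall {ι : Type*} {l : Filter ι} {F : ι → EntireFunction}
    {f : EntireFunction} : Tendsto F l (𝓝 f) ↔
      ∀ R : ℝ, TendstoUniformlyOn (fun i z => (F i).1 z) (fun z => f.1 z) l
        (Metric.closedBall 0 R) := by
  rw [isInducing_val.tendsto_nhds_iff,
    ContinuousMap.tendsto_iff_forall_isCompact_tendstoUniformlyOn]
  constructor
  · exact fun h R => h _ (isCompact_closedBall 0 R)
  · intro h K hK
    obtain ⟨R, hR⟩ := hK.isBounded.subset_closedBall 0
    exact (h R).mono hR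

/-- The entourages of locally uniform convergence contain the sets of pairs that are `ε`-close on
a large disc. -/
theorem exists_closedBall_of_mem_uniformity {V : Set (EntireFunction × EntireFunction)}
    (hV : V ∈ uniformity EntireFunction) :
    ∃ R : ℝ, 1 ≤ R ∧ ∃ ε > 0, ∀ f g : EntireFunction,
      (∀ z, ‖z‖ ≤ R → ‖f.1 z - g.1 z‖ < ε) → (f, g) ∈ V := by
  have hV' : V ∈ comap (fun q : EntireFunction × EntireFunction => (q.1.1, q.2.1))
      (uniformity C(ℂ, ℂ)) := hV
  obtain ⟨W, hW, hWV⟩ := mem_comap.mp hV'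
  obtain ⟨⟨K, U⟩, ⟨hK, hU⟩, hKU⟩ :=
    ContinuousMap.hasBasis_compactConvergenceUniformity.mem_iff.mp hW
  obtain ⟨ε, hε, hεU⟩ := Metric.mem_uniformity_dist.mp hU
  obtain ⟨R, hR⟩ := hK.isBounded.subset_closedBall 0
  refine ⟨max R 1, le_max_right _ _, ε, hε, fun f g h => hWV (hKU fun x hx => hεU ?_)⟩
  rw [dist_eq_norm]
  refine h x (le_trans ?_ (le_max_left _ _))
  simpa using hR hx

/-- The entire function `z ↦ c * z ^ k`. -/
noncomputable def monomial (k : ℕ) (c : ℂ) : EntireFunction :=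
  ⟨⟨fun z => c * z ^ k, by fun_prop⟩, by
    change Differentiable ℂ fun z : ℂ => c * z ^ k
    fun_prop⟩

theorem monomial_apply (k : ℕ) (c z : ℂ) : (monomial k c).1 z = c * z ^ k := rfl

theorem sum_apply {ι : Type*} (s : Finset ι) (F : ι → EntireFunction) (z : ℂ) :
    (∑ i ∈ s, F i).1 z = ∑ i ∈ s, (F i).1 z := by
  simp [ContinuousMap.sum_apply]

theorem continuous_monomial (k : ℕ) : Continuous (monomial k) := by
  have : monomial k = fun c => c • monomial k 1 := by
    funext c
    refine ext_apply fun z => ?_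
    simp [monomial]
  rw [this]
  exact (continuous_id.smul continuous_const)

end EntireFunction

/-! ### Convergence in distribution by approximation -/

/-- Convergence in distribution is inherited by a limit of approximations: if `Y m n → Z m`
in distribution for every `m`, if `Z m → Z` almost surely, and if `X n` is close to `Y m n` with
high probability, uniformly in `n` once `m` is large, then `X n → Z` in distribution. -/
theorem tendstoInDistribution_of_approx {E Ω Ω' : Type*} [UniformSpace E]
    [(uniformity E).IsCountablyGenerated] [MeasurableSpace E] [BorelSpace E]
    [SecondCountableTopology E]
    [MeasurableSpace Ω] [MeasurableSpace Ω'] {P : Measure Ω} [IsProbabilityMeasure P]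
    {P' : Measure Ω'} [IsProbabilityMeasure P'] {X : ℕ → Ω → E} {Y : ℕ → ℕ → Ω → E}
    {Z : Ω' → E} {Zm : ℕ → Ω' → E} (hX : ∀ n, AEMeasurable (X n) P) (hZ : AEMeasurable Z P')
    (hY : ∀ m, TendstoInDistribution (Y m) atTop (Zm m) (fun _ => P) P')
    (hZm : ∀ᵐ ω ∂P', Tendsto (fun m => Zm m ω) atTop (𝓝 (Z ω)))
    (hXY : ∀ V ∈ uniformity E, ∀ δ > 0, ∀ᶠ m in atTop, ∀ᶠ n in atTop,
      P.real {ω | (X n ω, Y m n ω) ∉ V} ≤ δ) :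
    TendstoInDistribution X atTop Z (fun _ => P) P' := by
  let _ : PseudoMetricSpace E := UniformSpace.pseudoMetricSpace E
  have hZd := tendstoInDistribution_of_ae_tendsto (fun m => (hY m).aemeasurable_limit) hZ hZm
  refine ⟨hX, hZ, ?_⟩
  refine tendsto_iff_forall_lipschitz_integral_tendsto.mpr ?_
  rintro F ⟨M, hM⟩ ⟨L, hL⟩
  have hFc : Continuous F := hL.continuous
  have h1 := fun m => (tendsto_iff_forall_lipschitz_integral_tendsto.mp (hY m).tendsto) F
    ⟨M, hM⟩ ⟨L, hL⟩
  have h2 := (tendsto_iff_forall_lipschitz_integral_tendsto.mp hZd.tendsto) F ⟨M, hM⟩ ⟨L, hL⟩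
  simp only [ProbabilityMeasure.coe_mk] at h1 h2 ⊢
  have hYm : ∀ m n, AEMeasurable (Y m n) P := fun m n => (hY m).forall_aemeasurable n
  have i1 : ∀ U : Ω → E, AEMeasurable U P → ∫ e, F e ∂(P.map U) = ∫ ω, F (U ω) ∂P :=
    fun U hU => integral_map hU hFc.aestronglyMeasurable
  have hM0 : 0 ≤ M := by
    rcases isEmpty_or_nonempty E with h | ⟨⟨e⟩⟩
    · have : IsEmpty Ω := ⟨fun ω => h.elim (X 0 ω)⟩
      exact absurd (measure_univ (μ := P)) (by simp [Measure.eq_zero_of_isEmpty])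
    · exact le_trans dist_nonneg (hM e e)
  have hint : ∀ U : Ω → E, AEMeasurable U P → Integrable (fun ω => F (U ω)) P := by
    intro U hU
    rcases isEmpty_or_nonempty E with h | ⟨⟨e⟩⟩
    · have : IsEmpty Ω := ⟨fun ω => h.elim (X 0 ω)⟩
      exact absurd (measure_univ (μ := P)) (by simp [Measure.eq_zero_of_isEmpty])
    · refine Integrable.of_bound (hFc.measurable.comp_aemeasurable hU).aestronglyMeasurable
        (‖F e‖ + M) (ae_of_all _ fun ω => ?_)
      have := hM (U ω) e
      rw [dist_eq_norm] at this
      linarith [norm_le_insert' (F (U ω)) (F e)]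
  rw [Metric.tendsto_atTop']
  intro ε hε
  have hη : 0 < ε / (8 * (L + 1)) := by positivity
  have hδ : 0 < ε / (8 * (M + 1)) := by positivity
  have e1 := hXY {p | dist p.1 p.2 < ε / (8 * (L + 1))} (Metric.dist_mem_uniformity hη) _ hδ
  have e2 := Metric.tendsto_nhds.mp h2 (ε / 4) (by positivity)
  obtain ⟨m, hm1, hm2⟩ := (e1.and e2).exists
  have e3 := Metric.tendsto_nhds.mp (h1 m) (ε / 4) (by positivity)
  have key : ∀ᶠ n in atTop, dist (∫ e, F e ∂(P.map (X n))) (∫ e, F e ∂(P'.map Z)) < ε := by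
    filter_upwards [hm1, e3] with n hn1 hn3
    have hd : dist (∫ e, F e ∂(P.map (X n))) (∫ e, F e ∂(P.map (Y m n))) ≤ ε / 4 := by
      rw [i1 _ (hX n), i1 _ (hYm m n), dist_eq_norm, ← integral_sub (hint _ (hX n))
        (hint _ (hYm m n))]
      set S : Set Ω := {ω | (X n ω, Y m n ω) ∉ {p : E × E | dist p.1 p.2 < ε / (8 * (L + 1))}}
      have hS : NullMeasurableSet S P := by
        have : AEMeasurable (fun ω => dist (X n ω) (Y m n ω)) P := (hX n).dist (hYm m n)
        have h3 := this.nullMeasurable (measurableSet_Ici (a := ε / (8 * (L + 1))))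
        convert h3 using 1
        ext ω
        simp [S]
      have hb : ∀ ω, ‖F (X n ω) - F (Y m n ω)‖ ≤ ε / 8 + S.indicator (fun _ => M) ω := by
        intro ω
        by_cases hω : ω ∈ S
        · rw [indicator_of_mem hω, ← dist_eq_norm]
          linarith [hM (X n ω) (Y m n ω)]
        · rw [indicator_of_notMem hω, ← dist_eq_norm, add_zero]
          have h4 : dist (X n ω) (Y m n ω) < ε / (8 * (L + 1)) := by
            by_contra hcon
            exact hω hcon
          refine (hL.dist_le_mul _ _).trans ?_
          calc (L : ℝ) * dist (X n ω) (Y m n ω) ≤ (L + 1) * (ε / (8 * (L + 1))) := by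
                gcongr; linarith
            _ = ε / 8 := by field_simp
      have hSi : Integrable (S.indicator fun _ => M) P := (integrable_const M).indicator₀ hS
      calc ‖∫ ω, F (X n ω) - F (Y m n ω) ∂P‖ ≤ ∫ ω, ‖F (X n ω) - F (Y m n ω)‖ ∂P :=
            norm_integral_le_integral_norm _
        _ ≤ ∫ ω, (ε / 8 + S.indicator (fun _ => M) ω) ∂P :=
            integral_mono ((hint _ (hX n)).sub (hint _ (hYm m n))).norm
              ((integrable_const _).add hSi) hb
        _ = ε / 8 + P.real S * M := by
            rw [integral_add (integrable_const _) hSi, integral_indicator₀ hS]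
            simp
        _ ≤ ε / 8 + ε / (8 * (M + 1)) * M := by gcongr; exact hn1
        _ ≤ ε / 8 + ε / (8 * (M + 1)) * (M + 1) := by gcongr; linarith
        _ = ε / 4 := by field_simp; ring
    calc _ ≤ dist (∫ e, F e ∂(P.map (X n))) (∫ e, F e ∂(P.map (Y m n)))
          + dist (∫ e, F e ∂(P.map (Y m n))) (∫ e, F e ∂(P'.map (Zm m)))
          + dist (∫ e, F e ∂(P'.map (Zm m))) (∫ e, F e ∂(P'.map Z)) := dist_triangle4 _ _ _ _
      _ < ε := by linarith
  obtain ⟨N, hN⟩ := eventually_atTop.mp key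
  exact ⟨N, fun n hn => hN n hn.le⟩

/-- The mapping theorem for a map that is continuous off a null set. -/
theorem MeasureTheory.TendstoInDistribution.comp_of_ae_continuousAt {E F Ω Ω' : Type*}
    [TopologicalSpace E] [HasOuterApproxClosed E] [MeasurableSpace E] [BorelSpace E]
    [TopologicalSpace F] [MeasurableSpace F] [BorelSpace F] [MeasurableSpace Ω]
    [MeasurableSpace Ω'] {P : Measure Ω}
    [IsProbabilityMeasure P] {P' : Measure Ω'} [IsProbabilityMeasure P'] {X : ℕ → Ω → E}
    {Z : Ω' → E} (h : TendstoInDistribution X atTop Z (fun _ => P) P') {g : E → F}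
    (hg : Measurable g) {N : Set E} (hgN : ∀ x ∉ N, ContinuousAt g x)
    (hZ : ∀ᵐ ω ∂P', Z ω ∉ N) :
    TendstoInDistribution (fun n ω => g (X n ω)) atTop (fun ω => g (Z ω)) (fun _ => P) P' := by
  refine ⟨fun n => hg.comp_aemeasurable (h.forall_aemeasurable n),
    hg.comp_aemeasurable h.aemeasurable_limit, ?_⟩
  refine tendsto_of_forall_isClosed_limsup_le' fun C hC => ?_
  have hX := h.forall_aemeasurable
  have hgX : ∀ n, AEMeasurable (fun ω => g (X n ω)) P := fun n => hg.comp_aemeasurable (hX n)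
  have hgZ : AEMeasurable (fun ω => g (Z ω)) P' := hg.comp_aemeasurable h.aemeasurable_limit
  have hcl := ProbabilityMeasure.limsup_measure_closed_le_of_tendsto h.tendsto
    (isClosed_closure (s := g ⁻¹' C))
  simp only [ProbabilityMeasure.coe_mk] at hcl ⊢
  have hsub : closure (g ⁻¹' C) ⊆ g ⁻¹' C ∪ N := by
    intro x hx
    by_cases hxN : x ∈ N
    · exact Or.inr hxN
    · refine Or.inl ?_
      have := (hgN x hxN).continuousWithinAt (s := g ⁻¹' C) |>.mem_closure hx
        (mapsTo_preimage g C)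
      rwa [hC.closure_eq] at this
  calc limsup (fun n => (P.map fun ω => g (X n ω)) C) atTop
      ≤ limsup (fun n => (P.map (X n)) (closure (g ⁻¹' C))) atTop := by
        refine limsup_le_limsup (Eventually.of_forall fun n => ?_)
        change (P.map fun ω => g (X n ω)) C ≤ (P.map (X n)) (closure (g ⁻¹' C))
        rw [Measure.map_apply_of_aemeasurable (hgX n) hC.measurableSet,
          Measure.map_apply_of_aemeasurable (hX n) isClosed_closure.measurableSet]
        exact measure_mono fun ω hω => subset_closure hω
    _ ≤ (P'.map Z) (closure (g ⁻¹' C)) := hcl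
    _ ≤ (P'.map fun ω => g (Z ω)) C := by
        rw [Measure.map_apply_of_aemeasurable hgZ hC.measurableSet,
          Measure.map_apply_of_aemeasurable h.aemeasurable_limit
          isClosed_closure.measurableSet]
        refine measure_mono_ae ?_
        filter_upwards [hZ] with ω hω hω'
        exact (hsub hω').resolve_right hω

theorem MeasureTheory.TendstoInDistribution.congr_of_eventually_eq {E Ω Ω' : Type*}
    [TopologicalSpace E]
    [MeasurableSpace E] [OpensMeasurableSpace E] [MeasurableSpace Ω] [MeasurableSpace Ω']
    {P : Measure Ω} [IsProbabilityMeasure P] {P' : Measure Ω'} [IsProbabilityMeasure P']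
    {X Y : ℕ → Ω → E} {Z : Ω' → E} (h : TendstoInDistribution X atTop Z (fun _ => P) P')
    (hY : ∀ n, AEMeasurable (Y n) P) (hXY : ∀ᶠ n in atTop, X n = Y n) :
    TendstoInDistribution Y atTop Z (fun _ => P) P' := by
  refine ⟨hY, h.aemeasurable_limit, h.tendsto.congr' ?_⟩
  filter_upwards [hXY] with n hn
  refine Subtype.ext ?_
  change P.map (X n) = P.map (Y n)
  rw [hn]

/-! ### Regular variation -/

theorem SlowlyVarying.tendsto_log_sub {ℓ : ℝ → ℝ} (h : SlowlyVarying ℓ) (v : ℝ) :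
    Tendsto (fun y => Real.log (ℓ (Real.exp (y + v))) - Real.log (ℓ (Real.exp y))) atTop
      (𝓝 0) := by
  have h1 : Tendsto (fun x => Real.log (ℓ (Real.exp v * x) / ℓ x)) atTop (𝓝 0) := by
    have := (h.tendsto_ratio _ (Real.exp_pos v)).log one_ne_zero
    rwa [Real.log_one] at this
  refine (h1.comp Real.tendsto_exp_atTop).congr' ?_
  have h2 : ∀ᶠ y in atTop, 0 < ℓ (Real.exp y) :=
    Real.tendsto_exp_atTop.eventually h.eventually_pos
  have h3 : ∀ᶠ y : ℝ in atTop, 0 < ℓ (Real.exp (y + v)) :=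
    (tendsto_atTop_add_const_right atTop v tendsto_id).eventually h2
  filter_upwards [h2, h3] with y hy hy'
  have : Real.exp v * Real.exp y = Real.exp (y + v) := by rw [Real.exp_add, mul_comm]
  simp only [Function.comp_apply, this]
  rw [Real.log_div hy'.ne' hy.ne']

/-- The uniform convergence theorem for slowly varying functions, in logarithmic coordinates and
along sequences. Both increments `λ ↦ h (xₙ + λ) - h xₙ` and `λ ↦ h (xₙ + uₙ + λ) - h (xₙ + uₙ)`
tend to `0` in measure on a bounded interval, so some common endpoint makes both of them small. -/
theorem SlowlyVarying.tendsto_log_sub_of_mem_Icc {ℓ : ℝ → ℝ} (hℓ : SlowlyVarying ℓ) {x u : ℕ → ℝ}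
    (hx : Tendsto x atTop atTop) (hu : ∀ n, u n ∈ Icc (0 : ℝ) 1) :
    Tendsto (fun n => Real.log (ℓ (Real.exp (x n + u n))) - Real.log (ℓ (Real.exp (x n)))) atTop
      (𝓝 0) := by
  set h : ℝ → ℝ := fun y => Real.log (ℓ (Real.exp y)) with hh
  have hmeas : Measurable h := Real.measurable_log.comp (hℓ.measurable.comp Real.measurable_exp)
  have hT : ∀ y : ℕ → ℝ, Tendsto y atTop atTop → ∀ ε > 0, ∀ᶠ n in atTop,
      volume ({v | ε ≤ |h (y n + v) - h (y n)|} ∩ Icc 0 3) < 1 := by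
    intro y hy ε hε
    have : TendstoInMeasure (volume.restrict (Icc (0 : ℝ) 3))
        (fun n v => h (y n + v) - h (y n)) atTop (fun _ => (0 : ℝ)) := by
      refine tendstoInMeasure_of_tendsto_ae (fun n => ?_) (ae_of_all _ fun v => ?_)
      · exact ((hmeas.comp (measurable_const_add _)).sub_const _).aestronglyMeasurable
      · exact (hℓ.tendsto_log_sub v).comp hy
    have h1 := tendstoInMeasure_iff_norm.mp this ε hε
    filter_upwards [h1.eventually_lt_const one_pos] with n hn
    rw [Measure.restrict_apply] at hn
    · simpa using hn
    · refine measurableSet_le measurable_const ?_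
      exact (((hmeas.comp (measurable_const_add _)).sub_const _).sub_const _).norm
  rw [Metric.tendsto_atTop']
  intro ε hε
  have hxu : Tendsto (fun n => x n + u n) atTop atTop :=
    tendsto_atTop_mono (fun n => le_add_of_nonneg_right (hu n).1) hx
  have key : ∀ᶠ n in atTop, dist (h (x n + u n) - h (x n)) 0 < ε := by
    filter_upwards [hT x hx (ε / 2) (half_pos hε), hT _ hxu (ε / 2) (half_pos hε)] with n hA hB
    set A := {v | ε / 2 ≤ |h (x n + v) - h (x n)|} ∩ Icc 0 3
    set B := {v | ε / 2 ≤ |h (x n + u n + v) - h (x n + u n)|} ∩ Icc 0 3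
    obtain ⟨v, hv, hvn⟩ : ∃ v ∈ Icc (1 : ℝ) 3, v ∉ A ∪ (fun v => v - u n) ⁻¹' B := by
      by_contra hcon
      push Not at hcon
      have h2 : volume (Icc (1 : ℝ) 3) ≤ volume A + volume B := by
        refine (measure_mono hcon).trans ((measure_union_le _ _).trans ?_)
        simp only [sub_eq_add_neg, measure_preimage_add_right, le_refl]
      have h3 : volume A + volume B < 1 + 1 := ENNReal.add_lt_add hA hB
      rw [Real.volume_Icc] at h2
      have h4 := h2.trans_lt h3
      norm_num at h4
    rw [mem_union, not_or] at hvn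
    have hv1 : |h (x n + v) - h (x n)| < ε / 2 := by
      by_contra hcon
      exact hvn.1 ⟨not_lt.mp hcon, by linarith [hv.1], hv.2⟩
    have hv2 : |h (x n + u n + (v - u n)) - h (x n + u n)| < ε / 2 := by
      by_contra hcon
      exact hvn.2 ⟨not_lt.mp hcon, by linarith [hv.1, (hu n).2], by linarith [hv.2, (hu n).1]⟩
    rw [show x n + u n + (v - u n) = x n + v by ring] at hv2
    rw [dist_zero_right, Real.norm_eq_abs]
    rw [abs_lt] at hv1 hv2 ⊢
    constructor <;> linarith
  obtain ⟨N, hN⟩ := eventually_atTop.mp key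
  exact ⟨N, fun n hn => hN n hn.le⟩

/-- Potter's bound: `log ℓ` grows slower than `ε log x`. -/
theorem SlowlyVarying.exists_abs_log_sub_le {ℓ : ℝ → ℝ} (hℓ : SlowlyVarying ℓ) {ε : ℝ}
    (hε : 0 < ε) : ∃ N : ℝ, 0 < N ∧ ∀ y x : ℝ, N ≤ y → y ≤ x →
      0 < ℓ y ∧ |Real.log (ℓ x) - Real.log (ℓ y)| ≤ ε * (Real.log (x / y) + 1) := by
  set h : ℝ → ℝ := fun y => Real.log (ℓ (Real.exp y)) with hh
  obtain ⟨X, hX⟩ : ∃ X : ℝ, ∀ x ≥ X, ∀ u ∈ Icc (0 : ℝ) 1, |h (x + u) - h x| ≤ ε := by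
    by_contra hcon
    push Not at hcon
    choose x hx u hu hxu using fun n : ℕ => hcon n
    have hT := hℓ.tendsto_log_sub_of_mem_Icc
      (tendsto_atTop_mono hx tendsto_natCast_atTop_atTop) hu
    obtain ⟨n, hn⟩ := (hT.abs.eventually_lt_const (by simpa using hε)).exists
    exact absurd (hxu n) (not_lt.mpr hn.le)
  have hstep : ∀ k : ℕ, ∀ x ≥ X, ∀ u ∈ Icc (0 : ℝ) 1, |h (x + k + u) - h x| ≤ ε * (k + 1) := by
    intro k
    induction k with
    | zero => intro x hx u hu; simpa using hX x hx u hu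
    | succ k ih =>
      intro x hx u hu
      have h1 := hX x hx 1 (by simp)
      have h2 := ih (x + 1) (by linarith) u hu
      rw [show x + 1 + k + u = x + (k + 1 : ℕ) + u by push_cast; ring] at h2
      push_cast at h2 ⊢
      rw [abs_le] at h1 h2 ⊢
      constructor <;> linarith
  obtain ⟨N0, hN0⟩ := eventually_atTop.mp hℓ.eventually_pos
  refine ⟨max N0 (Real.exp X), lt_max_of_lt_right (Real.exp_pos X), fun y x hy hyx => ?_⟩
  have hy0 : 0 < y := (Real.exp_pos X).trans_le ((le_max_right _ _).trans hy)
  have hx0 : 0 < x := hy0.trans_le hyx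
  refine ⟨hN0 y ((le_max_left _ _).trans hy), ?_⟩
  have hv : 0 ≤ Real.log (x / y) := Real.log_nonneg ((one_le_div hy0).mpr hyx)
  have h3 := hstep ⌊Real.log (x / y)⌋₊ (Real.log y)
    ((Real.le_log_iff_exp_le hy0).mpr ((le_max_right _ _).trans hy))
    (Real.log (x / y) - ⌊Real.log (x / y)⌋₊)
    ⟨sub_nonneg.mpr (Nat.floor_le hv), by linarith [Nat.lt_floor_add_one (Real.log (x / y))]⟩
  rw [show Real.log y + (⌊Real.log (x / y)⌋₊ : ℝ) + (Real.log (x / y) - ⌊Real.log (x / y)⌋₊) =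
    Real.log x by rw [Real.log_div hx0.ne' hy0.ne']; ring] at h3
  simp only [hh, Real.exp_log hy0, Real.exp_log hx0] at h3
  refine h3.trans ?_
  gcongr
  exact Nat.floor_le hv

/-- The consequences of regular variation with index `β > -1` for a sequence of weights `c` that
are used to pass from sums to integrals: pointwise convergence of the ratios, and an integrable
majorant. -/
structure IsRegularWeight (c : ℕ → ℝ) (β : ℝ) : Prop where
  tendsto_ratio : ∀ (k : ℕ → ℕ) (x : ℝ), 0 < x → (∀ n, k n ≤ n) →
    Tendsto (fun n => (k n : ℝ) / n) atTop (𝓝 x) →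
    Tendsto (fun n => c (k n) / c n) atTop (𝓝 (x ^ β))
  exists_bound : ∃ ρ : ℝ, -1 < ρ ∧ ρ ≤ 0 ∧ ∃ C : ℝ, 0 < C ∧ ∃ N : ℕ, 0 < N ∧ ∀ n ≥ N, 0 < c n ∧
    ∀ j ≤ n, |c j / c n| ≤ C * (max (j : ℝ) 1 / n) ^ ρ

theorem RegularlyVarying.sq_ratio {b : ℝ → ℝ} {α : ℝ} {ℓ : ℝ → ℝ}
    (hb : ∀ x : ℝ, 0 < x → b x = x ^ α * ℓ x) {y x : ℝ} (hy : 0 < y) (hx : 0 < x)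
    (hly : 0 < ℓ y) (hlx : 0 < ℓ x) :
    b y ^ 2 / b x ^ 2 =
      (y / x) ^ (2 * α) * Real.exp (-(2 * (Real.log (ℓ x) - Real.log (ℓ y)))) := by
  have h1 : Real.exp (-(2 * (Real.log (ℓ x) - Real.log (ℓ y)))) = ℓ y ^ 2 / ℓ x ^ 2 := by
    rw [show -(2 * (Real.log (ℓ x) - Real.log (ℓ y))) =
      (Real.log (ℓ y) + Real.log (ℓ y)) - (Real.log (ℓ x) + Real.log (ℓ x)) by ring,
      Real.exp_sub, Real.exp_add, Real.exp_add, Real.exp_log hly, Real.exp_log hlx]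
    ring
  rw [h1, hb y hy, hb x hx, Real.div_rpow hy.le hx.le, two_mul, Real.rpow_add hy,
    Real.rpow_add hx]
  have := (Real.rpow_pos_of_pos hx α).ne'
  field_simp

/-- Potter's bound for `ℓ` gives `c j / c n ≤ C (j / n) ^ ρ` with `ρ > -1` once `j` is large, at the
cost of an arbitrarily small loss in the exponent; the finitely many small indices are compared with
a fixed large one. -/
theorem RegularlyVarying.isRegularWeight {b : ℝ → ℝ} {α : ℝ} (hb : RegularlyVarying b α)
    (hα : -1 / 2 < α) : IsRegularWeight (fun k => b k ^ 2) (2 * α) := by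
  obtain ⟨ℓ, hℓ, hbℓ⟩ := hb.exists_slowlyVarying
  refine ⟨fun k x hx hkn hk => ?_, ?_⟩
  · have hkT : Tendsto (fun n => (k n : ℝ)) atTop atTop := by
      have h1 := hk.pos_mul_atTop hx tendsto_natCast_atTop_atTop
      refine h1.congr' ?_
      filter_upwards [eventually_gt_atTop 0] with n hn
      have : (n : ℝ) ≠ 0 := by positivity
      field_simp
    have hlog : Tendsto (fun n : ℕ => Real.log ((n : ℝ) / k n)) atTop (𝓝 (Real.log x⁻¹)) := by
      have := (hk.inv₀ hx.ne').log (inv_ne_zero hx.ne')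
      simpa using this
    have hdiff : Tendsto (fun n : ℕ => Real.log (ℓ n) - Real.log (ℓ (k n))) atTop (𝓝 0) := by
      rw [Metric.tendsto_atTop']
      intro ε hε
      set D := |Real.log x⁻¹| + 1
      have hD : 0 < D := by positivity
      obtain ⟨N, hN, hN'⟩ := hℓ.exists_abs_log_sub_le (ε := ε / (2 * (D + 1))) (by positivity)
      have h2 : ∀ᶠ n : ℕ in atTop, Real.log ((n : ℝ) / k n) < D := by
        refine hlog.eventually_lt_const ?_
        simp only [D]
        linarith [le_abs_self (Real.log x⁻¹)]
      have : ∀ᶠ n : ℕ in atTop, dist (Real.log (ℓ n) - Real.log (ℓ (k n))) 0 < ε := by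
        filter_upwards [h2, hkT.eventually_ge_atTop N] with n hn hn'
        rw [dist_zero_right, Real.norm_eq_abs]
        refine (hN' (k n) n hn' (by exact_mod_cast hkn n)).2.trans_lt ?_
        calc _ ≤ ε / (2 * (D + 1)) * (D + 1) := by gcongr
          _ = ε / 2 := by field_simp
          _ < ε := by linarith
      obtain ⟨M, hM⟩ := eventually_atTop.mp this
      exact ⟨M, fun n hn => hM n hn.le⟩
    have h3 : Tendsto (fun n : ℕ => ((k n : ℝ) / n) ^ (2 * α) *
        Real.exp (-(2 * (Real.log (ℓ n) - Real.log (ℓ (k n)))))) atTop (𝓝 (x ^ (2 * α) * 1)) := by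
      refine (hk.rpow_const (Or.inl hx.ne')).mul ?_
      have := (hdiff.const_mul 2).neg.rexp
      simpa using this
    rw [mul_one] at h3
    refine h3.congr' ?_
    filter_upwards [hkT.eventually hℓ.eventually_pos, hkT.eventually_gt_atTop 0,
      tendsto_natCast_atTop_atTop.eventually hℓ.eventually_pos, eventually_gt_atTop 0]
      with n h1 h2 h3 h4
    exact (RegularlyVarying.sq_ratio hbℓ h2 (by positivity) h1 h3).symm
  · set ε := (2 * α + 1) / 4 with hεdef
    have hε : 0 < ε := by simp only [hεdef]; linarith
    obtain ⟨N0, hN0, hN0'⟩ := hℓ.exists_abs_log_sub_le hε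
    set N : ℕ := ⌈N0⌉₊ with hN
    have hNpos : 0 < N := Nat.ceil_pos.mpr hN0
    have hNle : ∀ n : ℕ, N ≤ n → N0 ≤ n := fun n hn => Nat.ceil_le.mp hn
    have hpos : ∀ n : ℕ, N ≤ n → 0 < b n ^ 2 := by
      intro n hn
      have hn0 : (0 : ℝ) < n := hN0.trans_le (hNle n hn)
      have h1 := (hN0' n n (hNle n hn) le_rfl).1
      rw [hbℓ _ hn0]
      positivity
    set ρ := min (2 * α - 2 * ε) 0 with hρ
    have hρ1 : -1 < ρ := by
      rw [hρ, lt_min_iff]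
      constructor
      · simp only [hεdef]; linarith
      · norm_num
    have hρ0 : ρ ≤ 0 := min_le_right _ _
    have hbound : ∀ j n : ℕ, N ≤ j → j ≤ n →
        b j ^ 2 / b n ^ 2 ≤ Real.exp (2 * ε) * ((j : ℝ) / n) ^ ρ := by
      intro j n hj hjn
      have hj0 : (0 : ℝ) < j := hN0.trans_le (hNle j hj)
      have hn0 : (0 : ℝ) < n := hN0.trans_le (hNle n (hj.trans hjn))
      have hjn' : (j : ℝ) ≤ n := by exact_mod_cast hjn
      have h1 := hN0' j n (hNle j hj) hjn'
      have h2 := (hN0' n n (hNle n (hj.trans hjn)) le_rfl).1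
      rw [RegularlyVarying.sq_ratio hbℓ hj0 hn0 h1.1 h2]
      have hr0 : 0 < (j : ℝ) / n := div_pos hj0 hn0
      have hr1 : (j : ℝ) / n ≤ 1 := (div_le_one hn0).mpr hjn'
      have h3 : Real.exp (-(2 * (Real.log (ℓ n) - Real.log (ℓ j)))) ≤
          Real.exp (2 * ε) * ((j : ℝ) / n) ^ (-(2 * ε)) := by
        rw [Real.rpow_def_of_pos hr0, ← Real.exp_add]
        refine Real.exp_le_exp.mpr ?_
        have h4 : Real.log ((j : ℝ) / n) = -Real.log ((n : ℝ) / j) := by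
          rw [← Real.log_inv, inv_div]
        rw [h4]
        have := (abs_le.mp h1.2).1
        nlinarith
      calc ((j : ℝ) / n) ^ (2 * α) * Real.exp (-(2 * (Real.log (ℓ n) - Real.log (ℓ j))))
          ≤ ((j : ℝ) / n) ^ (2 * α) * (Real.exp (2 * ε) * ((j : ℝ) / n) ^ (-(2 * ε))) := by gcongr
        _ = Real.exp (2 * ε) * ((j : ℝ) / n) ^ (2 * α - 2 * ε) := by
            rw [sub_eq_add_neg, Real.rpow_add hr0]; ring
        _ ≤ _ := by
            gcongr 1
            exact Real.rpow_le_rpow_of_exponent_ge hr0 hr1 (min_le_left _ _)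
    -- The finitely many indices below `N` are compared with `N` itself.
    set M : ℝ := ∑ j ∈ Finset.range N, b j ^ 2 with hM
    have hM0 : 0 ≤ M := Finset.sum_nonneg fun _ _ => sq_nonneg _
    have hbN := hpos N le_rfl
    refine ⟨ρ, hρ1, hρ0, Real.exp (2 * ε) * (1 + M / b N ^ 2), by positivity, N, hNpos,
      fun n hn => ⟨hpos n hn, fun j hjn => ?_⟩⟩
    have hn0 : (0 : ℝ) < n := hN0.trans_le (hNle n hn)
    have hmx : (0 : ℝ) < max (j : ℝ) 1 := lt_max_of_lt_right one_pos
    have hrp : 0 < (max (j : ℝ) 1 / n) ^ ρ := Real.rpow_pos_of_pos (div_pos hmx hn0) _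
    rw [abs_of_nonneg (by positivity)]
    rcases le_or_gt N j with hj | hj
    · have hj1 : (1 : ℝ) ≤ j := by exact_mod_cast hNpos.trans_le hj
      refine (hbound j n hj hjn).trans ?_
      rw [max_eq_left hj1] at hrp ⊢
      have : 0 ≤ M / b N ^ 2 := by positivity
      have h5 : 0 < Real.exp (2 * ε) := Real.exp_pos _
      nlinarith [mul_nonneg (mul_nonneg h5.le this) hrp.le]
    · have hjM : b j ^ 2 ≤ M :=
        Finset.single_le_sum (f := fun j : ℕ => b j ^ 2) (fun _ _ => sq_nonneg _)
          (Finset.mem_range.mpr hj)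
      have hNn := hbound N n le_rfl hn
      have hmono : ((N : ℝ) / n) ^ ρ ≤ (max (j : ℝ) 1 / n) ^ ρ := by
        refine Real.rpow_le_rpow_of_nonpos (div_pos hmx hn0) ?_ hρ0
        gcongr
        refine max_le ?_ ?_
        · exact_mod_cast hj.le
        · exact_mod_cast hNpos
      have hbn := hpos n hn
      calc b j ^ 2 / b n ^ 2 ≤ M / b n ^ 2 := by gcongr
        _ = M / b N ^ 2 * (b N ^ 2 / b n ^ 2) := (div_mul_div_cancel₀ hbN.ne').symm
        _ ≤ M / b N ^ 2 * (Real.exp (2 * ε) * ((N : ℝ) / n) ^ ρ) := by gcongr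
        _ ≤ M / b N ^ 2 * (Real.exp (2 * ε) * (max (j : ℝ) 1 / n) ^ ρ) := by gcongr
        _ ≤ Real.exp (2 * ε) * (1 + M / b N ^ 2) * (max (j : ℝ) 1 / n) ^ ρ := by
            have h5 : 0 < Real.exp (2 * ε) := Real.exp_pos _
            nlinarith [mul_pos h5 hrp]

/-! ### Weighted Riemann sums -/

/-- A Riemann sum with nodes `j / n`, written as the integral of a step function, so that dominated
convergence applies to it. -/
theorem integral_natCeil_mul (a : ℕ → ℂ) {n : ℕ} (hn : 0 < n) :
    ∫ x in (0 : ℝ)..1, a ⌈(n : ℝ) * x⌉₊ = (n : ℂ)⁻¹ * ∑ j ∈ Finset.range n, a (j + 1) := by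
  have hn0 : (n : ℝ) ≠ 0 := by positivity
  have hcongr : ∀ k : ℕ, ∀ t ∈ Ioc (k : ℝ) (k + 1 : ℕ), a ⌈t⌉₊ = a (k + 1) := by
    intro k t ht
    rw [(Nat.ceil_eq_iff (by simp)).mpr ⟨by simpa using ht.1, ht.2⟩]
  have huIoc : ∀ k : ℕ, uIoc (k : ℝ) (k + 1 : ℕ) = Ioc (k : ℝ) (k + 1 : ℕ) := fun k =>
    uIoc_of_le (by push_cast; linarith)
  have hint : ∀ k < n, IntervalIntegrable (fun t : ℝ => a ⌈t⌉₊) volume (k : ℝ) (k + 1 : ℕ) := by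
    intro k _
    refine (intervalIntegrable_const (c := a (k + 1))).congr ?_
    rw [huIoc]
    exact fun t ht => (hcongr k t ht).symm
  rw [intervalIntegral.integral_comp_mul_left (fun t => a ⌈t⌉₊) hn0, mul_zero, mul_one]
  have hsum := intervalIntegral.sum_integral_adjacent_intervals (μ := volume)
    (f := fun t : ℝ => a ⌈t⌉₊) (a := fun k : ℕ => (k : ℝ)) hint
  rw [Nat.cast_zero] at hsum
  rw [← hsum, Complex.real_smul]
  push_cast
  congr 1
  refine Finset.sum_congr rfl fun k _ => ?_
  have : ∫ t in (k : ℝ)..((k : ℝ) + 1), a ⌈t⌉₊ = ∫ _ in (k : ℝ)..((k : ℝ) + 1), a (k + 1) := by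
    refine intervalIntegral.integral_congr_ae (ae_of_all _ fun t ht => ?_)
    have h1 := huIoc k
    push_cast at h1
    rw [h1] at ht
    exact hcongr k t (by push_cast; exact ht)
  rw [this]
  simp

theorem measurable_natCeil_mul_comp (a : ℕ → ℂ) (n : ℕ) :
    Measurable fun x : ℝ => a ⌈(n : ℝ) * x⌉₊ :=
  (measurable_of_countable a).comp (Nat.measurable_ceil.comp (measurable_const_mul _))

theorem tendsto_natCeil_mul_div {x : ℝ} (hx : 0 < x) :
    Tendsto (fun n : ℕ => ((⌈(n : ℝ) * x⌉₊ : ℕ) : ℝ) / n) atTop (𝓝 x) := by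
  refine ((tendsto_nat_ceil_mul_div_atTop (R := ℝ) hx.le).comp
    tendsto_natCast_atTop_atTop).congr fun n => ?_
  simp [mul_comm]

theorem tendsto_natCeil_mul_sub_one_div {x : ℝ} (hx : 0 < x) :
    Tendsto (fun n : ℕ => ((⌈(n : ℝ) * x⌉₊ - 1 : ℕ) : ℝ) / n) atTop (𝓝 x) := by
  have h1 := (tendsto_natCeil_mul_div hx).sub (tendsto_inv_atTop_nhds_zero_nat (𝕜 := ℝ))
  rw [sub_zero] at h1
  refine h1.congr' ?_
  filter_upwards [eventually_gt_atTop 0] with n hn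
  have : 1 ≤ ⌈(n : ℝ) * x⌉₊ := Nat.ceil_pos.mpr (by positivity)
  rw [Nat.cast_sub this, sub_div]
  simp

namespace IsRegularWeight

variable {c : ℕ → ℝ} {β : ℝ}

theorem eventually_pos (hc : IsRegularWeight c β) : ∀ᶠ n in atTop, 0 < c n := by
  obtain ⟨ρ, h1, h0, C, hC, N, hN, h⟩ := hc.exists_bound
  filter_upwards [eventually_ge_atTop N] with n hn using (h n hn).1

/-- The weights are asymptotically negligible, uniformly. -/
theorem eventually_abs_div_le (hc : IsRegularWeight c β) {δ : ℝ} (hδ : 0 < δ) :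
    ∀ᶠ n : ℕ in atTop, ∀ j ≤ n, |c j / c n| / n ≤ δ := by
  obtain ⟨ρ, h1, h0, C, hC, N, hN, h⟩ := hc.exists_bound
  have hT : Tendsto (fun n : ℕ => C * (n : ℝ) ^ (-(1 + ρ))) atTop (𝓝 (C * 0)) :=
    ((tendsto_rpow_neg_atTop (by linarith)).comp tendsto_natCast_atTop_atTop).const_mul C
  rw [mul_zero] at hT
  filter_upwards [hT.eventually_le_const hδ, eventually_ge_atTop N] with n hn hnN j hj
  have hn0 : (0 : ℝ) < n := by exact_mod_cast hN.trans_le hnN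
  refine le_trans ?_ hn
  rw [div_le_iff₀ hn0]
  refine ((h n hnN).2 j hj).trans ?_
  rw [mul_assoc]
  gcongr 1
  calc (max (j : ℝ) 1 / n) ^ ρ ≤ (1 / (n : ℝ)) ^ ρ :=
        Real.rpow_le_rpow_of_nonpos (by positivity) (by gcongr; exact le_max_right _ _) h0
    _ = (n : ℝ) ^ (-(1 + ρ)) * n := by
        rw [one_div, Real.inv_rpow hn0.le, ← Real.rpow_neg hn0.le, ← Real.rpow_add_one hn0.ne']
        ring_nf

/-- An integrable majorant for the step functions of the weighted Riemann sums. The bound at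
`⌈n x⌉ - 1` serves the increments that appear in summation by parts. -/
theorem exists_integrable_bound (hc : IsRegularWeight c β) {f : ℝ → ℂ} (hf : Continuous f) :
    ∃ g : ℝ → ℝ, IntervalIntegrable g volume 0 1 ∧ ∀ᶠ n : ℕ in atTop, ∀ x ∈ Ioc (0 : ℝ) 1,
      ‖((c ⌈(n : ℝ) * x⌉₊ / c n : ℝ) : ℂ) * f (⌈(n : ℝ) * x⌉₊ / n)‖ ≤ g x ∧
      ‖((c (⌈(n : ℝ) * x⌉₊ - 1) / c n : ℝ) : ℂ) * f ((⌈(n : ℝ) * x⌉₊ - 1 : ℕ) / n)‖ ≤ g x := by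
  obtain ⟨ρ, h1, h0, C, hC, N, hN, h⟩ := hc.exists_bound
  obtain ⟨M, hM⟩ := (isCompact_Icc (a := (0 : ℝ)) (b := 1)).exists_bound_of_continuousOn
    hf.continuousOn
  have hM0 : 0 ≤ M := (norm_nonneg _).trans (hM 0 (by simp))
  refine ⟨fun x => C * M * 2 ^ (-ρ) * x ^ ρ,
    (intervalIntegral.intervalIntegrable_rpow' h1).const_mul _, ?_⟩
  filter_upwards [eventually_ge_atTop N] with n hn x hx
  have hn0 : (0 : ℝ) < n := by exact_mod_cast hN.trans_le hn
  have hgen : ∀ j : ℕ, j ≤ n → x / 2 ≤ max (j : ℝ) 1 / n →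
      ‖((c j / c n : ℝ) : ℂ) * f (j / n)‖ ≤ C * M * 2 ^ (-ρ) * x ^ ρ := by
    intro j hj hxj
    rw [norm_mul, Complex.norm_real, Real.norm_eq_abs]
    have h3 : ‖f (j / n)‖ ≤ M := hM _ ⟨by positivity, by
      rw [div_le_one hn0]; exact_mod_cast hj⟩
    have h4 : (max (j : ℝ) 1 / n) ^ ρ ≤ (x / 2) ^ ρ :=
      Real.rpow_le_rpow_of_nonpos (by linarith [hx.1]) hxj h0
    calc |c j / c n| * ‖f (j / n)‖ ≤ (C * (max (j : ℝ) 1 / n) ^ ρ) * M := by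
          gcongr
          exact (h n hn).2 j hj
      _ ≤ (C * (x / 2) ^ ρ) * M := by gcongr
      _ = C * M * 2 ^ (-ρ) * x ^ ρ := by
          rw [Real.div_rpow hx.1.le zero_le_two, Real.rpow_neg zero_le_two]; ring
  have hle : ⌈(n : ℝ) * x⌉₊ ≤ n := Nat.ceil_le.mpr (by nlinarith [hx.2])
  have hceil := Nat.le_ceil ((n : ℝ) * x)
  constructor
  · refine hgen _ hle ?_
    rw [le_div_iff₀ hn0]
    refine le_trans ?_ (le_max_left _ _)
    nlinarith [hx.1]
  · refine hgen _ ((Nat.sub_le _ _).trans hle) ?_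
    rw [le_div_iff₀ hn0]
    have hpos : 1 ≤ ⌈(n : ℝ) * x⌉₊ := Nat.ceil_pos.mpr (mul_pos hn0 hx.1)
    rw [Nat.cast_sub hpos, Nat.cast_one]
    have h5 := le_max_left ((⌈(n : ℝ) * x⌉₊ : ℝ) - 1) 1
    have h6 := le_max_right ((⌈(n : ℝ) * x⌉₊ : ℝ) - 1) 1
    nlinarith

theorem tendsto_mul_comp (hc : IsRegularWeight c β) {f : ℝ → ℂ} (hf : Continuous f) {x : ℝ}
    (hx : 0 < x) {k : ℕ → ℕ} (hkn : ∀ n, k n ≤ n)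
    (hk : Tendsto (fun n => (k n : ℝ) / n) atTop (𝓝 x)) :
    Tendsto (fun n => ((c (k n) / c n : ℝ) : ℂ) * f (k n / n)) atTop
      (𝓝 (((x ^ β : ℝ) : ℂ) * f x)) := by
  have h1 := hc.tendsto_ratio k x hx hkn hk
  exact ((Complex.continuous_ofReal.tendsto _).comp h1).mul ((hf.tendsto x).comp hk)

theorem natCeil_mul_le {x : ℝ} (hx : x ≤ 1) (n : ℕ) : ⌈(n : ℝ) * x⌉₊ ≤ n :=
  Nat.ceil_le.mpr (by nlinarith [(Nat.cast_nonneg n : (0 : ℝ) ≤ n)])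

theorem tendsto_zero_term (hc : IsRegularWeight c β) {f : ℝ → ℂ} (hf : Continuous f)
    {k : ℕ → ℕ} (hkn : ∀ n, k n ≤ n) :
    Tendsto (fun n : ℕ => (n : ℂ)⁻¹ * (((c (k n) / c n : ℝ) : ℂ) * f (k n / n))) atTop (𝓝 0) := by
  obtain ⟨M, hM⟩ := (isCompact_Icc (a := (0 : ℝ)) (b := 1)).exists_bound_of_continuousOn
    hf.continuousOn
  have hM0 : 0 ≤ M := (norm_nonneg _).trans (hM 0 (by simp))
  rw [Metric.tendsto_atTop']
  intro ε hε
  have h1 := hc.eventually_abs_div_le (δ := ε / (2 * (M + 1))) (by positivity)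
  have : ∀ᶠ n : ℕ in atTop,
      dist ((n : ℂ)⁻¹ * (((c (k n) / c n : ℝ) : ℂ) * f (k n / n))) 0 < ε := by
    filter_upwards [h1, eventually_gt_atTop 0] with n hn hn0
    have hn0' : (0 : ℝ) < n := by exact_mod_cast hn0
    have h3 : ‖f (k n / n)‖ ≤ M := hM _ ⟨by positivity, by
      rw [div_le_one hn0']; exact_mod_cast hkn n⟩
    rw [dist_zero_right, norm_mul, norm_mul, norm_inv, Complex.norm_natCast, Complex.norm_real,
      Real.norm_eq_abs]
    calc (n : ℝ)⁻¹ * (|c (k n) / c n| * ‖f (k n / n)‖) = |c (k n) / c n| / n * ‖f (k n / n)‖ := by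
          ring
      _ ≤ ε / (2 * (M + 1)) * (M + 1) := by
          exact mul_le_mul (hn _ (hkn n)) (by linarith) (norm_nonneg _) (by positivity)
      _ = ε / 2 := by field_simp
      _ < ε := by linarith
  obtain ⟨N, hN⟩ := eventually_atTop.mp this
  exact ⟨N, fun n hn => hN n hn.le⟩

/-- Weighted Riemann sums converge to the integral against `x ^ β`. -/
theorem tendsto_sum (hc : IsRegularWeight c β) {f : ℝ → ℂ} (hf : Continuous f) :
    Tendsto (fun n : ℕ => (n : ℂ)⁻¹ * ∑ j ∈ Finset.range (n + 1),
      ((c j / c n : ℝ) : ℂ) * f (j / n)) atTop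
      (𝓝 (∫ x in (0 : ℝ)..1, ((x ^ β : ℝ) : ℂ) * f x)) := by
  obtain ⟨g, hg, hgb⟩ := hc.exists_integrable_bound hf
  have h1 : Tendsto (fun n : ℕ => ∫ x in (0 : ℝ)..1,
      ((c ⌈(n : ℝ) * x⌉₊ / c n : ℝ) : ℂ) * f (⌈(n : ℝ) * x⌉₊ / n)) atTop
      (𝓝 (∫ x in (0 : ℝ)..1, ((x ^ β : ℝ) : ℂ) * f x)) := by
    refine intervalIntegral.tendsto_integral_filter_of_dominated_convergence g ?_ ?_ hg ?_
    · exact Eventually.of_forall fun n =>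
        (measurable_natCeil_mul_comp (fun j => ((c j / c n : ℝ) : ℂ) * f (j / n)) n
          ).aestronglyMeasurable
    · filter_upwards [hgb] with n hn
      refine ae_of_all _ fun x hx => ?_
      rw [uIoc_of_le zero_le_one] at hx
      exact (hn x hx).1
    · refine ae_of_all _ fun x hx => ?_
      rw [uIoc_of_le zero_le_one] at hx
      exact hc.tendsto_mul_comp hf hx.1 (natCeil_mul_le hx.2) (tendsto_natCeil_mul_div hx.1)
  have h2 := hc.tendsto_zero_term hf (k := fun _ => 0) (fun n => Nat.zero_le n)
  have h3 := h1.add h2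
  rw [add_zero] at h3
  refine h3.congr' ?_
  filter_upwards [eventually_gt_atTop 0] with n hn
  rw [integral_natCeil_mul (fun j => ((c j / c n : ℝ) : ℂ) * f (j / n)) hn,
    Finset.sum_range_succ' _ n, mul_add]

/-- Summation by parts against a geometric sequence. -/
theorem one_sub_mul_sum (a : ℕ → ℂ) (q : ℂ) (n : ℕ) :
    (1 - q) * ∑ j ∈ Finset.range (n + 1), a j * q ^ j =
      a 0 - a n * q ^ (n + 1) + ∑ j ∈ Finset.range n, (a (j + 1) - a j) * q ^ (j + 1) := by
  induction n with
  | zero => simp; ring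
  | succ n ih =>
    rw [Finset.sum_range_succ, mul_add, ih, Finset.sum_range_succ _ n]
    ring

/-- Weighted Riemann sums with an oscillating factor tend to `0`: after summation by parts the sum
is controlled by the total variation of the weights, which is `o(1)`. -/
theorem tendsto_sum_mul_pow (hc : IsRegularWeight c β) {f : ℝ → ℂ} (hf : Continuous f) {q : ℂ}
    (hq : ‖q‖ = 1) (hq1 : q ≠ 1) :
    Tendsto (fun n : ℕ => (n : ℂ)⁻¹ * ∑ j ∈ Finset.range (n + 1),
      ((c j / c n : ℝ) : ℂ) * f (j / n) * q ^ j) atTop (𝓝 0) := by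
  obtain ⟨g, hg, hgb⟩ := hc.exists_integrable_bound hf
  set A : ℕ → ℕ → ℂ := fun n j => ((c j / c n : ℝ) : ℂ) * f (j / n) with hA
  have hTV : Tendsto (fun n : ℕ => ∫ x in (0 : ℝ)..1,
      ((‖A n ⌈(n : ℝ) * x⌉₊ - A n (⌈(n : ℝ) * x⌉₊ - 1)‖ : ℝ) : ℂ)) atTop
      (𝓝 (∫ _ in (0 : ℝ)..1, (0 : ℂ))) := by
    refine intervalIntegral.tendsto_integral_filter_of_dominated_convergence
      (fun x => g x + g x) ?_ ?_ (hg.add hg) ?_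
    · exact Eventually.of_forall fun n =>
        (measurable_natCeil_mul_comp (fun j => ((‖A n j - A n (j - 1)‖ : ℝ) : ℂ)) n
          ).aestronglyMeasurable
    · filter_upwards [hgb] with n hn
      refine ae_of_all _ fun x hx => ?_
      rw [uIoc_of_le zero_le_one] at hx
      rw [Complex.norm_real, norm_norm]
      exact (norm_sub_le _ _).trans (add_le_add (hn x hx).1 (hn x hx).2)
    · refine ae_of_all _ fun x hx => ?_
      rw [uIoc_of_le zero_le_one] at hx
      have h1 := hc.tendsto_mul_comp hf hx.1 (natCeil_mul_le hx.2) (tendsto_natCeil_mul_div hx.1)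
      have h2 := hc.tendsto_mul_comp hf hx.1
        (fun n => (Nat.sub_le _ _).trans (natCeil_mul_le hx.2 n))
        (tendsto_natCeil_mul_sub_one_div hx.1)
      have h3 := (Complex.continuous_ofReal.tendsto _).comp (h1.sub h2).norm
      simp only [sub_self, norm_zero, Complex.ofReal_zero] at h3
      exact h3
  have h0 := (hc.tendsto_zero_term hf (k := fun _ => 0) (fun n => Nat.zero_le n)).norm
  have hn' := (hc.tendsto_zero_term hf (k := fun n => n) (fun n => le_rfl)).norm
  have hsum := (h0.add hn').add hTV.norm
  rw [intervalIntegral.integral_zero, norm_zero, add_zero, add_zero] at hsum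
  have hlim := hsum.const_mul (‖1 - q‖⁻¹)
  rw [mul_zero] at hlim
  refine squeeze_zero_norm' ?_ hlim
  filter_upwards [eventually_gt_atTop 0] with n hn
  have hq' : 0 < ‖1 - q‖ := norm_pos_iff.mpr (sub_ne_zero.mpr hq1.symm)
  rw [integral_natCeil_mul (fun j => ((‖A n j - A n (j - 1)‖ : ℝ) : ℂ)) hn,
    le_inv_mul_iff₀ hq', ← norm_mul, mul_left_comm, one_sub_mul_sum (A n) q n, mul_add, mul_sub]
  refine (norm_add_le _ _).trans (add_le_add ((norm_sub_le _ _).trans (add_le_add ?_ ?_)) ?_)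
  · simp [hA]
  · rw [← mul_assoc, norm_mul, norm_pow, hq, one_pow, mul_one]
  · rw [norm_mul, norm_mul]
    gcongr
    have hreal : ∑ j ∈ Finset.range n, ((‖A n (j + 1) - A n (j + 1 - 1)‖ : ℝ) : ℂ) =
        ((∑ j ∈ Finset.range n, ‖A n (j + 1) - A n j‖ : ℝ) : ℂ) := by
      push_cast
      simp
    rw [hreal, Complex.norm_real, Real.norm_of_nonneg (Finset.sum_nonneg fun _ _ => norm_nonneg _)]
    refine (norm_sum_le _ _).trans (Finset.sum_le_sum fun j _ => ?_)
    rw [norm_mul, norm_pow, hq, one_pow, mul_one]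

end IsRegularWeight

/-! ### A central limit theorem for weighted sums -/

section CentralLimit

open scoped RealInnerProductSpace

/-- The factor `min 1 |y|` makes the remainder `o(y ^ 2)` while keeping it below a multiple of
`y ^ 2`, so that second moments suffice in the central limit theorem. -/
theorem norm_exp_I_sub_taylor_le (y : ℝ) :
    ‖Complex.exp (y * Complex.I) - (1 + y * Complex.I - y ^ 2 / 2)‖ ≤ 4 * y ^ 2 * min 1 |y| := by
  have hyI : ‖(y : ℂ) * Complex.I‖ = |y| := by simp
  rcases le_total |y| 1 with hy | hy
  · rw [min_eq_right hy]
    have h := Complex.exp_bound (x := y * Complex.I) (by rwa [hyI]) (n := 3) (by norm_num)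
    have h1 : ∑ m ∈ Finset.range 3, (y * Complex.I) ^ m / m.factorial =
        1 + y * Complex.I - y ^ 2 / 2 := by
      simp [Finset.sum_range_succ, Nat.factorial, mul_pow]
      ring
    rw [h1, hyI] at h
    refine h.trans ?_
    rw [← sq_abs y]
    have : 0 ≤ |y| ^ 3 := by positivity
    norm_num [Nat.factorial]
    calc |y| ^ 3 * (2 / 9) ≤ 4 * |y| ^ 3 := by linarith
      _ = 4 * |y| ^ 2 * |y| := by ring
      _ = 4 * y ^ 2 * |y| := by rw [sq_abs]
  · rw [min_eq_left hy, mul_one]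
    have h1 : ‖Complex.exp (y * Complex.I)‖ = 1 := Complex.norm_exp_ofReal_mul_I y
    have h2 : ‖(y : ℂ) ^ 2 / 2‖ = |y| ^ 2 / 2 := by simp
    calc _ ≤ ‖Complex.exp (y * Complex.I)‖ + (‖(1 : ℂ)‖ + ‖(y : ℂ) * Complex.I‖ +
          ‖(y : ℂ) ^ 2 / 2‖) := by
          refine (norm_sub_le _ _).trans (add_le_add le_rfl ?_)
          exact (norm_sub_le _ _).trans (add_le_add (norm_add_le _ _) le_rfl)
      _ = 1 + (1 + |y| + |y| ^ 2 / 2) := by rw [h1, h2, hyI, norm_one]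
      _ ≤ 4 * y ^ 2 := by
          rw [← sq_abs y]
          nlinarith

theorem norm_exp_neg_sub_le {x : ℝ} (hx : 0 ≤ x) (hx1 : x ≤ 1) :
    ‖Complex.exp (-(x : ℂ)) - (1 - x)‖ ≤ x ^ 2 := by
  have hn : ‖-(x : ℂ)‖ = x := by simp [abs_of_nonneg hx]
  have h := Complex.exp_bound (x := -(x : ℂ)) (by rwa [hn]) (n := 2) (by norm_num)
  have h1 : ∑ m ∈ Finset.range 2, (-(x : ℂ)) ^ m / m.factorial = 1 - x := by
    simp [Finset.sum_range_succ, Nat.factorial]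
    ring
  rw [h1, hn] at h
  refine h.trans ?_
  norm_num [Nat.factorial]
  nlinarith [sq_nonneg x]

theorem norm_prod_sub_prod_le_sum {ι : Type*} (s : Finset ι) (a b : ι → ℂ)
    (ha : ∀ i ∈ s, ‖a i‖ ≤ 1) (hb : ∀ i ∈ s, ‖b i‖ ≤ 1) :
    ‖∏ i ∈ s, a i - ∏ i ∈ s, b i‖ ≤ ∑ i ∈ s, ‖a i - b i‖ := by
  classical
  induction s using Finset.induction_on with
  | empty => simp
  | insert i s hi ih =>
    rw [Finset.prod_insert hi, Finset.prod_insert hi, Finset.sum_insert hi,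
      show a i * ∏ j ∈ s, a j - b i * ∏ j ∈ s, b j =
        (a i - b i) * ∏ j ∈ s, a j + b i * (∏ j ∈ s, a j - ∏ j ∈ s, b j) by ring]
    have h1 := ih (fun j hj => ha j (Finset.mem_insert_of_mem hj))
      (fun j hj => hb j (Finset.mem_insert_of_mem hj))
    have h2 : ‖∏ j ∈ s, a j‖ ≤ 1 := by
      rw [norm_prod]
      exact Finset.prod_le_one (fun _ _ => norm_nonneg _)
        fun j hj => ha j (Finset.mem_insert_of_mem hj)
    refine (norm_add_le _ _).trans (add_le_add ?_ ?_)
    · rw [norm_mul]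
      exact mul_le_of_le_one_right (norm_nonneg _) h2
    · rw [norm_mul]
      exact (mul_le_of_le_one_left (norm_nonneg _) (hb i (Finset.mem_insert_self i s))).trans h1

variable {E Ω : Type*} [NormedAddCommGroup E] [InnerProductSpace ℝ E] [CompleteSpace E]
  [MeasurableSpace Ω] {P : Measure Ω} [IsProbabilityMeasure P]

/-- The characteristic function of a centred square integrable vector agrees near `0`, up to
`o(‖t‖ ^ 2)`, with that of the Gaussian law of the same covariance. -/
theorem exists_norm_charFun_sub_le {X : Ω → E} (hX : MemLp X 2 P) (hmean : ∫ ω, X ω ∂P = 0)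
    {ε : ℝ} (hε : 0 < ε) : ∃ δ > 0, ∀ t : E, ‖t‖ ≤ δ →
      ‖∫ ω, Complex.exp (⟪X ω, t⟫ * Complex.I) ∂P -
        Complex.exp (-((∫ ω, ⟪X ω, t⟫ ^ 2 ∂P) / 2 : ℝ))‖ ≤ ε * ‖t‖ ^ 2 := by
  have hXae : AEStronglyMeasurable X P := hX.aestronglyMeasurable
  have hinner : ∀ t : E, MemLp (fun ω => ⟪X ω, t⟫) 2 P := fun t => hX.inner_const t
  have hsq : Integrable (fun ω => ‖X ω‖ ^ 2) P := hX.integrable_norm_pow (by norm_num)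
  set S := ∫ ω, ‖X ω‖ ^ 2 ∂P with hS
  have hS0 : 0 ≤ S := integral_nonneg fun _ => by positivity
  -- The truncated second moments tend to `0` by dominated convergence.
  have hT : Tendsto (fun r : ℝ => ∫ ω, 4 * ‖X ω‖ ^ 2 * min 1 (‖X ω‖ * r) ∂P) (𝓝[>] 0) (𝓝 0) := by
    rw [show 𝓝 (0 : ℝ) = 𝓝 (∫ _, (0 : ℝ) ∂P) by rw [integral_zero]]
    refine tendsto_integral_filter_of_dominated_convergence (fun ω => 4 * ‖X ω‖ ^ 2) ?_ ?_
      (hsq.const_mul 4) ?_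
    · refine Eventually.of_forall fun r => ?_
      exact ((hXae.norm.pow 2).const_mul 4).mul
        ((aestronglyMeasurable_const (b := (1 : ℝ))).inf (hXae.norm.mul_const r))
    · filter_upwards [self_mem_nhdsWithin] with r hr
      refine ae_of_all _ fun ω => ?_
      have hr' : (0 : ℝ) < r := hr
      rw [Real.norm_of_nonneg (by positivity)]
      exact mul_le_of_le_one_right (by positivity) (min_le_left _ _)
    · refine ae_of_all _ fun ω => ?_
      have : Tendsto (fun r : ℝ => 4 * ‖X ω‖ ^ 2 * min 1 (‖X ω‖ * r)) (𝓝 0)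
          (𝓝 (4 * ‖X ω‖ ^ 2 * min 1 (‖X ω‖ * 0))) :=
        Continuous.tendsto (by fun_prop) 0
      rw [mul_zero, min_eq_right zero_le_one, mul_zero] at this
      exact this.mono_left nhdsWithin_le_nhds
  have hev := hT.eventually_le_const (u := ε / 2) (by positivity)
  obtain ⟨δ₁, hδ₁, hδ₁'⟩ := mem_nhdsGT_iff_exists_Ioc_subset.mp hev
  have hδ₁0 : (0 : ℝ) < δ₁ := hδ₁
  set δ₂ := min 1 (ε / (S ^ 2 + S + 1)) with hδ₂
  have hδ₂0 : 0 < δ₂ := lt_min one_pos (by positivity)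
  have hδ₂1 : δ₂ ≤ 1 := min_le_left _ _
  have hδ₂S : δ₂ * (S ^ 2 + S + 1) ≤ ε := by
    rw [← le_div_iff₀ (by positivity)]
    exact min_le_right _ _
  obtain ⟨δ₃, hδ₃0, hδ₃⟩ : ∃ δ₃ > 0, δ₃ ^ 2 * (S + 1) ≤ 1 :=
    ⟨(S + 1)⁻¹, by positivity, by
      rw [sq, mul_assoc, inv_mul_cancel₀ (by positivity), mul_one]
      exact inv_le_one_of_one_le₀ (by linarith)⟩
  refine ⟨min δ₁ (min δ₂ δ₃), by positivity, fun t ht => ?_⟩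
  have ht1 : ‖t‖ ≤ δ₁ := ht.trans (min_le_left _ _)
  have ht2 : ‖t‖ ≤ δ₂ := ht.trans ((min_le_right _ _).trans (min_le_left _ _))
  have ht3 : ‖t‖ ≤ δ₃ := ht.trans ((min_le_right _ _).trans (min_le_right _ _))
  rcases eq_or_ne t 0 with rfl | ht0
  · simp
  have htpos : 0 < ‖t‖ := norm_pos_iff.mpr ht0
  set Q := ∫ ω, ⟪X ω, t⟫ ^ 2 ∂P with hQ
  have hQint : Integrable (fun ω => ⟪X ω, t⟫ ^ 2) P := (hinner t).integrable_sq
  have hQ0 : 0 ≤ Q := integral_nonneg fun _ => sq_nonneg _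
  have habs : ∀ ω, |⟪X ω, t⟫| ≤ ‖X ω‖ * ‖t‖ := fun ω => abs_real_inner_le_norm _ _
  have hsqle : ∀ ω, ⟪X ω, t⟫ ^ 2 ≤ ‖X ω‖ ^ 2 * ‖t‖ ^ 2 := fun ω => by
    rw [← sq_abs, ← mul_pow]
    exact pow_le_pow_left₀ (abs_nonneg _) (habs ω) 2
  have hQS : Q ≤ S * ‖t‖ ^ 2 := by
    rw [hS, ← integral_mul_const]
    exact integral_mono hQint (hsq.mul_const _) hsqle
  have hIint : Integrable (fun ω => ⟪X ω, t⟫) P := (hinner t).integrable (by norm_num)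
  have hI0 : ∫ ω, ⟪X ω, t⟫ ∂P = 0 := by
    have := integral_inner (𝕜 := ℝ) (hX.integrable (by norm_num)) t
    simp_rw [real_inner_comm]
    rw [this, hmean, inner_zero_right]
  have hexp : Integrable (fun ω => Complex.exp (⟪X ω, t⟫ * Complex.I)) P := by
    refine Integrable.of_bound ?_ 1 (ae_of_all _ fun ω => (Complex.norm_exp_ofReal_mul_I _).le)
    exact Complex.continuous_exp.comp_aestronglyMeasurable
      ((Complex.continuous_ofReal.comp_aestronglyMeasurable
        (hinner t).aestronglyMeasurable).mul_const _)
  have htay : Integrable (fun ω => (1 + ⟪X ω, t⟫ * Complex.I - (⟪X ω, t⟫ : ℂ) ^ 2 / 2 : ℂ)) P := by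
    refine ((integrable_const _).add (hIint.ofReal.mul_const _)).sub ?_
    have := hQint.ofReal (𝕜 := ℂ)
    simp only [Complex.coe_algebraMap, RCLike.ofReal_pow] at this
    exact this.div_const 2
  have htayI : ∫ ω, (1 + ⟪X ω, t⟫ * Complex.I - (⟪X ω, t⟫ : ℂ) ^ 2 / 2 : ℂ) ∂P =
      1 - (Q / 2 : ℝ) := by
    have hQc : Integrable (fun ω => ((⟪X ω, t⟫ ^ 2 : ℝ) : ℂ)) P := hQint.ofReal
    have e : ∀ ω, (1 + ⟪X ω, t⟫ * Complex.I - (⟪X ω, t⟫ : ℂ) ^ 2 / 2 : ℂ) =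
        (1 + (⟪X ω, t⟫ : ℂ) * Complex.I) - ((⟪X ω, t⟫ ^ 2 : ℝ) : ℂ) / 2 := by
      intro ω; push_cast; ring
    simp_rw [e]
    have hIc : Integrable (fun ω => ((⟪X ω, t⟫ : ℝ) : ℂ) * Complex.I) P := hIint.ofReal.mul_const _
    have hlin : Integrable (fun ω => 1 + (⟪X ω, t⟫ : ℂ) * Complex.I) P :=
      (integrable_const 1).add hIc
    rw [integral_sub hlin (hQc.div_const 2), integral_add (integrable_const _) hIc,
      integral_mul_const, integral_div,
      integral_complex_ofReal, integral_complex_ofReal, hI0, ← hQ]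
    simp
  have h1 : ‖∫ ω, Complex.exp (⟪X ω, t⟫ * Complex.I) ∂P - (1 - (Q / 2 : ℝ))‖ ≤
      ε / 2 * ‖t‖ ^ 2 := by
    rw [← htayI, ← integral_sub hexp htay]
    have hmem : ∫ ω, 4 * ‖X ω‖ ^ 2 * min 1 (‖X ω‖ * ‖t‖) ∂P ≤ ε / 2 := hδ₁' ⟨htpos, ht1⟩
    calc _ ≤ ∫ ω, 4 * ‖X ω‖ ^ 2 * min 1 (‖X ω‖ * ‖t‖) * ‖t‖ ^ 2 ∂P := by
          refine norm_integral_le_of_norm_le ?_ (ae_of_all _ fun ω => ?_)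
          · refine Integrable.mul_const ?_ _
            refine (hsq.const_mul 4).mono' (((hXae.norm.pow 2).const_mul 4).mul
              ((aestronglyMeasurable_const (b := (1 : ℝ))).inf (hXae.norm.mul_const _)))
              (ae_of_all _ fun ω => ?_)
            rw [Real.norm_of_nonneg (by positivity)]
            exact mul_le_of_le_one_right (by positivity) (min_le_left _ _)
          · refine (norm_exp_I_sub_taylor_le _).trans ?_
            calc 4 * ⟪X ω, t⟫ ^ 2 * min 1 |⟪X ω, t⟫|
                ≤ 4 * (‖X ω‖ ^ 2 * ‖t‖ ^ 2) * min 1 (‖X ω‖ * ‖t‖) := by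
                  gcongr
                  · exact hsqle ω
                  · exact habs ω
              _ = _ := by ring
      _ = (∫ ω, 4 * ‖X ω‖ ^ 2 * min 1 (‖X ω‖ * ‖t‖) ∂P) * ‖t‖ ^ 2 := integral_mul_const _ _
      _ ≤ ε / 2 * ‖t‖ ^ 2 := by gcongr
  have hQ1 : Q / 2 ≤ 1 := by
    have : S * ‖t‖ ^ 2 ≤ 1 := by
      calc S * ‖t‖ ^ 2 ≤ (S + 1) * δ₃ ^ 2 := by gcongr; linarith
        _ ≤ 1 := by linarith
    linarith
  have h2 : ‖Complex.exp (-((Q / 2 : ℝ) : ℂ)) - (1 - (Q / 2 : ℝ))‖ ≤ ε / 2 * ‖t‖ ^ 2 := by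
    refine (norm_exp_neg_sub_le (by positivity) hQ1).trans ?_
    have h3 : ‖t‖ ^ 2 ≤ δ₂ := by nlinarith
    calc (Q / 2) ^ 2 ≤ (S * ‖t‖ ^ 2 / 2) ^ 2 := by gcongr
      _ = S ^ 2 * ‖t‖ ^ 2 / 4 * ‖t‖ ^ 2 := by ring
      _ ≤ ε / 2 * ‖t‖ ^ 2 := by
          refine mul_le_mul_of_nonneg_right ?_ (by positivity)
          nlinarith [sq_nonneg S, mul_le_mul_of_nonneg_left h3 (sq_nonneg S),
            mul_nonneg hδ₂0.le hS0]
  calc _ = ‖(∫ ω, Complex.exp (⟪X ω, t⟫ * Complex.I) ∂P - (1 - (Q / 2 : ℝ))) -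
        (Complex.exp (-((Q / 2 : ℝ) : ℂ)) - (1 - (Q / 2 : ℝ)))‖ := by
        congr 1; ring
    _ ≤ ε / 2 * ‖t‖ ^ 2 + ε / 2 * ‖t‖ ^ 2 := (norm_sub_le _ _).trans (add_le_add h1 h2)
    _ = ε * ‖t‖ ^ 2 := by ring

/-- The Lindeberg central limit theorem for weighted sums of i.i.d. square integrable vectors, at
the level of characteristic functions: the weights are negligible, square summable uniformly in
`n`, and the variances converge. -/
theorem tendsto_integral_exp_sum_inner [MeasurableSpace E] [BorelSpace E]
    [SecondCountableTopology E] {X : ℕ → Ω → E} (hindep : iIndepFun X P)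
    (hident : ∀ k, IdentDistrib (X k) (X 0) P P) (hX : MemLp (X 0) 2 P)
    (hmean : ∫ ω, X 0 ω ∂P = 0) (d : ℕ → ℕ → E) {B V : ℝ}
    (hneg : ∀ δ > 0, ∀ᶠ n : ℕ in atTop, ∀ j ≤ n, ‖d n j‖ ≤ δ)
    (hbdd : ∀ᶠ n : ℕ in atTop, ∑ j ∈ Finset.range (n + 1), ‖d n j‖ ^ 2 ≤ B)
    (hvar : Tendsto (fun n => ∑ j ∈ Finset.range (n + 1), ∫ ω, ⟪X 0 ω, d n j⟫ ^ 2 ∂P) atTop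
      (𝓝 V)) :
    Tendsto (fun n => ∫ ω, Complex.exp
      ((∑ j ∈ Finset.range (n + 1), ⟪X j ω, d n j⟫ : ℝ) * Complex.I) ∂P) atTop
      (𝓝 (Complex.exp (-(V / 2 : ℝ)))) := by
  set φ : E → ℂ := fun t => ∫ ω, Complex.exp (⟪X 0 ω, t⟫ * Complex.I) ∂P with hφ
  have hcont : ∀ t : E, Continuous fun x : E => Complex.exp (⟪x, t⟫ * Complex.I) := fun t => by
    fun_prop
  have hφj : ∀ j t, ∫ ω, Complex.exp (⟪X j ω, t⟫ * Complex.I) ∂P = φ t := fun j t =>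
    ((hident j).comp (u := fun x : E => Complex.exp (⟪x, t⟫ * Complex.I))
      (hcont t).measurable).integral_eq
  have hprod : ∀ n, ∫ ω, Complex.exp
      ((∑ j ∈ Finset.range (n + 1), ⟪X j ω, d n j⟫ : ℝ) * Complex.I) ∂P =
      ∏ j ∈ Finset.range (n + 1), φ (d n j) := by
    intro n
    have hi : iIndepFun (fun j : Fin (n + 1) => X j) P := hindep.precomp Fin.val_injective
    have := iIndepFun.integral_fun_prod_comp (X := fun j : Fin (n + 1) => X j) hi
      (f := fun j x => Complex.exp (⟪x, d n j⟫ * Complex.I))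
      (fun j => (hident j).aemeasurable_fst) (fun j => (hcont _).aestronglyMeasurable)
    simp only [hφj] at this
    rw [Finset.prod_range, ← this]
    refine integral_congr_ae (ae_of_all _ fun ω => ?_)
    simp only
    rw [← Complex.exp_sum, Finset.sum_range]
    push_cast
    rw [Finset.sum_mul]
  simp_rw [hprod]
  set q : E → ℝ := fun t => ∫ ω, ⟪X 0 ω, t⟫ ^ 2 ∂P with hq
  have hq0 : ∀ t, 0 ≤ q t := fun t => integral_nonneg fun _ => sq_nonneg _
  have hgauss : Tendsto (fun n => ∏ j ∈ Finset.range (n + 1),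
      Complex.exp (-(q (d n j) / 2 : ℝ))) atTop (𝓝 (Complex.exp (-(V / 2 : ℝ)))) := by
    have h1 : Tendsto (fun n => Complex.exp (-((∑ j ∈ Finset.range (n + 1), q (d n j)) / 2 : ℝ)))
        atTop (𝓝 (Complex.exp (-(V / 2 : ℝ)))) := by
      have hc : Continuous fun v : ℝ => Complex.exp (-((v / 2 : ℝ) : ℂ)) := by fun_prop
      exact (hc.tendsto V).comp hvar
    refine h1.congr fun n => ?_
    rw [← Complex.exp_sum]
    congr 1
    push_cast
    rw [Finset.sum_div, ← Finset.sum_neg_distrib]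
  have hdiff : Tendsto (fun n => ∏ j ∈ Finset.range (n + 1), φ (d n j) -
      ∏ j ∈ Finset.range (n + 1), Complex.exp (-(q (d n j) / 2 : ℝ))) atTop (𝓝 0) := by
    rw [Metric.tendsto_atTop']
    intro ε hε
    obtain ⟨δ, hδ, hδ'⟩ := exists_norm_charFun_sub_le hX hmean (ε := ε / (2 * (|B| + 1)))
      (by positivity)
    have : ∀ᶠ n in atTop, dist (∏ j ∈ Finset.range (n + 1), φ (d n j) -
      ∏ j ∈ Finset.range (n + 1), Complex.exp (-(q (d n j) / 2 : ℝ))) 0 < ε := by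
      filter_upwards [hneg δ hδ, hbdd] with n hn hB
      rw [dist_zero_right]
      refine (norm_prod_sub_prod_le_sum _ _ _ ?_ ?_).trans_lt ?_
      · intro j _
        refine (norm_integral_le_of_norm_le (integrable_const (1 : ℝ)) (ae_of_all _ fun ω =>
          (Complex.norm_exp_ofReal_mul_I _).le)).trans ?_
        simp
      · intro j _
        rw [Complex.norm_exp]
        refine Real.exp_le_one_iff.mpr ?_
        rw [← Complex.ofReal_neg, Complex.ofReal_re]
        linarith [hq0 (d n j)]
      · calc _ ≤ ∑ j ∈ Finset.range (n + 1), ε / (2 * (|B| + 1)) * ‖d n j‖ ^ 2 :=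
              Finset.sum_le_sum fun j hj =>
                hδ' _ (hn j (Nat.lt_succ_iff.mp (Finset.mem_range.mp hj)))
          _ = ε / (2 * (|B| + 1)) * ∑ j ∈ Finset.range (n + 1), ‖d n j‖ ^ 2 := by
              rw [Finset.mul_sum]
          _ ≤ ε / (2 * (|B| + 1)) * (|B| + 1) := by
              gcongr
              linarith [le_abs_self B]
          _ = ε / 2 := by field_simp
          _ < ε := by linarith
    obtain ⟨N, hN⟩ := eventually_atTop.mp this
    exact ⟨N, fun n hn => hN n hn.le⟩
  have := hdiff.add hgauss
  simpa using this

end CentralLimit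

/-! ### Interpolation at roots of unity -/

namespace EntireFunction

/-- The primitive `m`-th root of unity `exp (2πi / m)`. -/
noncomputable def rootOfUnity (m : ℕ) : ℂ := Complex.exp (2 * Real.pi * Complex.I / m)

/-- The values of an entire function at the `m`-th roots of unity. -/
noncomputable def evalRoots (m : ℕ) (f : EntireFunction) : PiLp 2 fun _ : Fin m => ℂ :=
  WithLp.toLp 2 fun i => f.1 (rootOfUnity m ^ (i : ℕ))

/-- The polynomial of degree less than `m` with prescribed values at the `m`-th roots of unity,
given by the discrete Fourier transform. -/
noncomputable def interpolate (m : ℕ) (v : PiLp 2 fun _ : Fin m => ℂ) : EntireFunction :=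
  ∑ k ∈ Finset.range m,
    monomial k ((m : ℂ)⁻¹ * ∑ i : Fin m, v i * (rootOfUnity m ^ k)⁻¹ ^ (i : ℕ))

theorem continuous_evalRoots (m : ℕ) : Continuous (evalRoots m) :=
  (PiLp.continuous_toLp 2 _).comp (continuous_pi fun _ => continuous_eval _)

theorem continuous_interpolate (m : ℕ) : Continuous (interpolate m) := by
  refine continuous_finsetSum _ fun k _ => (continuous_monomial k).comp ?_
  fun_prop

/-- Orthogonality of the characters of `ℤ / m`. -/
theorem sum_rootOfUnity {m : ℕ} (hm : 0 < m) (l k : ℕ) (hk : k < m) :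
    (m : ℂ)⁻¹ * ∑ i : Fin m, (rootOfUnity m ^ (i : ℕ)) ^ l * (rootOfUnity m ^ k)⁻¹ ^ (i : ℕ) =
      if k = l % m then 1 else 0 := by
  have hprim : IsPrimitiveRoot (rootOfUnity m) m := Complex.isPrimitiveRoot_exp m hm.ne'
  have hm0 : (m : ℂ) ≠ 0 := by exact_mod_cast hm.ne'
  have hζ0 : rootOfUnity m ≠ 0 := hprim.ne_zero hm.ne'
  set r := rootOfUnity m ^ l * (rootOfUnity m ^ k)⁻¹ with hr
  have hsum : ∑ i : Fin m, (rootOfUnity m ^ (i : ℕ)) ^ l * (rootOfUnity m ^ k)⁻¹ ^ (i : ℕ) =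
      ∑ i ∈ Finset.range m, r ^ i := by
    rw [Finset.sum_range]
    refine Finset.sum_congr rfl fun i _ => ?_
    rw [hr, mul_pow, ← pow_mul, ← pow_mul, mul_comm (i : ℕ) l]
  rw [hsum]
  have hl : rootOfUnity m ^ l = rootOfUnity m ^ (l % m) := by
    conv_lhs => rw [← Nat.mod_add_div l m, pow_add, pow_mul, hprim.pow_eq_one, one_pow, mul_one]
  by_cases h : k = l % m
  · have : r = 1 := by
      rw [hr, hl, ← h]
      exact mul_inv_cancel₀ (pow_ne_zero _ hζ0)
    rw [if_pos h, this]
    simp [hm0]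
  · have hr1 : r ≠ 1 := by
      intro h1
      rw [hr, hl, mul_inv_eq_one₀ (pow_ne_zero _ hζ0)] at h1
      exact h (hprim.pow_inj (Nat.mod_lt _ hm) hk h1).symm
    have hrm : r ^ m = 1 := by
      rw [hr, mul_pow, inv_pow, ← pow_mul, ← pow_mul, mul_comm l, mul_comm k, pow_mul, pow_mul,
        hprim.pow_eq_one, one_pow, one_pow, inv_one, mul_one]
    rw [if_neg h, geom_sum_eq hr1, hrm, sub_self, zero_div, mul_zero]

/-- Interpolation at the `m`-th roots of unity folds the monomial `u ^ k` to `u ^ (k % m)`. -/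
theorem hasSum_interpolate {m : ℕ} (hm : 0 < m) {f : EntireFunction} {a : ℕ → ℂ}
    (hf : ∀ u, HasSum (fun k => a k * u ^ k) (f.1 u)) (u : ℂ) :
    HasSum (fun k => a k * u ^ (k % m)) ((interpolate m (evalRoots m f)).1 u) := by
  have h1 : (interpolate m (evalRoots m f)).1 u = ∑ i : Fin m, f.1 (rootOfUnity m ^ (i : ℕ)) *
      ∑ k ∈ Finset.range m, (m : ℂ)⁻¹ * (rootOfUnity m ^ k)⁻¹ ^ (i : ℕ) * u ^ k := by
    simp only [interpolate, evalRoots, sum_apply, monomial_apply, Finset.mul_sum, Finset.sum_mul]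
    rw [Finset.sum_comm]
    refine Finset.sum_congr rfl fun i _ => Finset.sum_congr rfl fun k _ => ?_
    ring
  rw [h1]
  have h2 := hasSum_sum (s := Finset.univ) fun (i : Fin m) _ =>
    (hf (rootOfUnity m ^ (i : ℕ))).mul_right
      (∑ k ∈ Finset.range m, (m : ℂ)⁻¹ * (rootOfUnity m ^ k)⁻¹ ^ (i : ℕ) * u ^ k)
  refine h2.congr_fun fun l => ?_
  symm
  calc ∑ i : Fin m, a l * (rootOfUnity m ^ (i : ℕ)) ^ l *
        ∑ k ∈ Finset.range m, (m : ℂ)⁻¹ * (rootOfUnity m ^ k)⁻¹ ^ (i : ℕ) * u ^ k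
      = a l * ∑ k ∈ Finset.range m, ((m : ℂ)⁻¹ * ∑ i : Fin m, (rootOfUnity m ^ (i : ℕ)) ^ l *
          (rootOfUnity m ^ k)⁻¹ ^ (i : ℕ)) * u ^ k := by
        simp only [Finset.mul_sum, Finset.sum_mul]
        rw [Finset.sum_comm]
        refine Finset.sum_congr rfl fun i _ => Finset.sum_congr rfl fun k _ => ?_
        ring
    _ = a l * ∑ k ∈ Finset.range m, (if k = l % m then 1 else 0) * u ^ k := by
        congr 1
        refine Finset.sum_congr rfl fun k hk => ?_
        rw [sum_rootOfUnity hm l k (Finset.mem_range.mp hk)]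
    _ = a l * u ^ (l % m) := by
        simp [ite_mul, Nat.mod_lt l hm]

/-- The aliasing error: interpolation sends `u ^ l` to `u ^ (l % m)`, so it is exact on the terms of
degree less than `m`. -/
theorem enorm_sub_interpolate_le {m : ℕ} (hm : 0 < m) {f : EntireFunction} {a : ℕ → ℂ}
    (hf : ∀ u, HasSum (fun k => a k * u ^ k) (f.1 u)) {R : ℝ} (hR : 1 ≤ R) {u : ℂ}
    (hu : ‖u‖ ≤ R) :
    ‖f.1 u - (interpolate m (evalRoots m f)).1 u‖ₑ ≤
      2 * ∑' k, ‖a (k + m)‖ₑ * ENNReal.ofReal (R ^ (k + m)) := by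
  have h1 := (hf u).sub (hasSum_interpolate hm hf u)
  rw [← h1.tsum_eq]
  refine (enorm_tsum_le_tsum_enorm (f := fun k => a k * u ^ k - a k * u ^ (k % m))).trans ?_
  have hsplit := Summable.sum_add_tsum_nat_add'
    (f := fun k => ‖a k * u ^ k - a k * u ^ (k % m)‖ₑ) (k := m) ENNReal.summable
  rw [← hsplit, Finset.sum_eq_zero, zero_add, ← ENNReal.tsum_mul_left]
  · refine ENNReal.tsum_le_tsum fun k => ?_
    rw [← mul_sub, enorm_mul, mul_left_comm]
    gcongr
    rw [← ofReal_norm]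
    have h2 : ‖u ^ (k + m) - u ^ ((k + m) % m)‖ ≤ 2 * R ^ (k + m) := by
      refine (norm_sub_le _ _).trans ?_
      rw [norm_pow, norm_pow, two_mul]
      refine add_le_add (pow_le_pow_left₀ (norm_nonneg _) hu _) ?_
      exact (pow_le_pow_left₀ (norm_nonneg _) hu _).trans
        (pow_le_pow_right₀ hR (Nat.mod_le _ _))
    refine (ENNReal.ofReal_le_ofReal h2).trans ?_
    rw [ENNReal.ofReal_mul zero_le_two, ENNReal.ofReal_ofNat]
  · intro k hk
    rw [Nat.mod_eq_of_lt (Finset.mem_range.mp hk), sub_self, enorm_zero]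

theorem exists_hasSum (f : EntireFunction) :
    ∃ a : ℕ → ℂ, ∀ u, HasSum (fun k => a k * u ^ k) (f.1 u) := by
  refine ⟨fun k => (k.factorial : ℂ)⁻¹ * iteratedDeriv k f.1 0, fun u => ?_⟩
  have := Complex.hasSum_taylorSeries_of_entire (f := f.1) f.2 0 u
  refine this.congr_fun fun k => ?_
  rw [sub_zero, smul_eq_mul, smul_eq_mul]
  ring

theorem tendsto_interpolate (f : EntireFunction) :
    Tendsto (fun m => interpolate m (evalRoots m f)) atTop (𝓝 f) := by
  obtain ⟨a, ha⟩ := f.exists_hasSum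
  rw [tendsto_iff_closedBall]
  intro R
  rw [Metric.tendstoUniformlyOn_iff]
  intro ε hε
  set R' := max R 1 with hR'
  have hR1 : 1 ≤ R' := le_max_right _ _
  have hsum : ∑' k, ‖a k‖ₑ * ENNReal.ofReal (R' ^ k) ≠ ∞ := by
    have h1 : Summable fun k => ‖a k * (R' : ℂ) ^ k‖ := (ha R').summable.norm
    have h2 : ∀ k, ‖a k‖ₑ * ENNReal.ofReal (R' ^ k) = ENNReal.ofReal ‖a k * (R' : ℂ) ^ k‖ := by
      intro k
      rw [norm_mul, ENNReal.ofReal_mul (norm_nonneg _), ofReal_norm, norm_pow,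
        Complex.norm_real, Real.norm_of_nonneg (by linarith)]
    simp_rw [h2]
    exact h1.tsum_ofReal_ne_top
  have hT := ENNReal.Tendsto.const_mul (a := 2) (ENNReal.tendsto_sum_nat_add _ hsum)
    (Or.inr (by simp))
  rw [mul_zero] at hT
  filter_upwards [hT.eventually_lt_const (ENNReal.ofReal_pos.mpr hε), eventually_gt_atTop 0]
    with m hm hm0 u hu
  rw [dist_eq_norm, ← ENNReal.ofReal_lt_ofReal_iff hε, ofReal_norm]
  have hu' : ‖u‖ ≤ R' := by
    refine le_trans ?_ (le_max_left _ _)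
    simpa using hu
  exact (enorm_sub_interpolate_le hm0 ha hR1 hu').trans_lt hm

end EntireFunction

/-! ### Moments of weighted sums of the coefficients -/

section Coefficients

open scoped RealInnerProductSpace

/-- The standing assumptions on the random coefficients: i.i.d., centred, square integrable, with
variances `σ₁ ^ 2`, `σ₂ ^ 2` of the real and imaginary parts, which are uncorrelated. -/
structure IsCoefficientSequence {Ω : Type*} [MeasurableSpace Ω] (P : Measure Ω)
    (ξ : ℕ → Ω → ℂ) (σ₁ σ₂ : ℝ) : Prop where
  iIndepFun : iIndepFun ξ P
  identDistrib : ∀ k, IdentDistrib (ξ k) (ξ 0) P P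
  memLp : MemLp (ξ 0) 2 P
  integral_eq_zero : ∫ ω, ξ 0 ω ∂P = 0
  integral_re_sq : ∫ ω, (ξ 0 ω).re ^ 2 ∂P = σ₁ ^ 2
  integral_im_sq : ∫ ω, (ξ 0 ω).im ^ 2 ∂P = σ₂ ^ 2
  integral_re_mul_im : ∫ ω, (ξ 0 ω).re * (ξ 0 ω).im ∂P = 0

namespace IsCoefficientSequence

variable {Ω : Type*} [MeasurableSpace Ω] {P : Measure Ω} {ξ : ℕ → Ω → ℂ} {σ₁ σ₂ : ℝ}

theorem aemeasurable (h : IsCoefficientSequence P ξ σ₁ σ₂) (j : ℕ) : AEMeasurable (ξ j) P :=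
  (h.identDistrib j).aemeasurable_fst

theorem memLp_apply (h : IsCoefficientSequence P ξ σ₁ σ₂) (j : ℕ) : MemLp (ξ j) 2 P :=
  (h.identDistrib j).memLp_iff.mpr h.memLp

theorem integral_inner_sq (h : IsCoefficientSequence P ξ σ₁ σ₂) (d : ℂ) :
    ∫ ω, ⟪ξ 0 ω, d⟫ ^ 2 ∂P = σ₁ ^ 2 * d.re ^ 2 + σ₂ ^ 2 * d.im ^ 2 := by
  have hre : MemLp (fun ω => (ξ 0 ω).re) 2 P := h.memLp.re
  have him : MemLp (fun ω => (ξ 0 ω).im) 2 P := h.memLp.im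
  have e : ∀ ω, ⟪ξ 0 ω, d⟫ ^ 2 = (ξ 0 ω).re ^ 2 * d.re ^ 2 + (ξ 0 ω).im ^ 2 * d.im ^ 2 +
      (ξ 0 ω).re * (ξ 0 ω).im * (2 * d.re * d.im) := by
    intro ω
    rw [Complex.inner]
    simp
    ring
  simp_rw [e]
  have i1 := hre.integrable_sq.mul_const (d.re ^ 2)
  have i2 := him.integrable_sq.mul_const (d.im ^ 2)
  have i3 : Integrable (fun ω => (ξ 0 ω).re * (ξ 0 ω).im * (2 * d.re * d.im)) P :=
    (hre.integrable_mul him).mul_const (2 * d.re * d.im)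
  have i12 : Integrable (fun ω => (ξ 0 ω).re ^ 2 * d.re ^ 2 + (ξ 0 ω).im ^ 2 * d.im ^ 2) P :=
    i1.add i2
  rw [integral_add i12 i3, integral_add i1 i2, integral_mul_const, integral_mul_const,
    integral_mul_const, h.integral_re_sq, h.integral_im_sq, h.integral_re_mul_im]
  ring

theorem integral_sum_inner_sq [IsProbabilityMeasure P] (h : IsCoefficientSequence P ξ σ₁ σ₂)
    (s : Finset ℕ) (v : ℕ → ℂ) :
    ∫ ω, (∑ j ∈ s, ⟪ξ j ω, v j⟫) ^ 2 ∂P =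
      ∑ j ∈ s, (σ₁ ^ 2 * (v j).re ^ 2 + σ₂ ^ 2 * (v j).im ^ 2) := by
  have hmem : ∀ j, MemLp (fun ω => ⟪ξ j ω, v j⟫) 2 P := fun j => (h.memLp_apply j).inner_const _
  have hc : ∀ d : ℂ, Measurable fun x : ℂ => ⟪x, d⟫ := fun d =>
    (by fun_prop : Continuous fun x : ℂ => ⟪x, d⟫).measurable
  have hid : ∀ j, IdentDistrib (fun ω => ⟪ξ j ω, v j⟫) (fun ω => ⟪ξ 0 ω, v j⟫) P P := fun j =>
    (h.identDistrib j).comp (hc (v j))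
  have hmean : ∀ j, ∫ ω, ⟪ξ j ω, v j⟫ ∂P = 0 := by
    intro j
    rw [(hid j).integral_eq]
    simp_rw [real_inner_comm (v j)]
    rw [integral_inner (𝕜 := ℝ) (h.memLp.integrable (by norm_num)) (v j), h.integral_eq_zero,
      inner_zero_right]
  have hvar := IndepFun.variance_sum (μ := P) (X := fun j ω => ⟪ξ j ω, v j⟫) (s := s)
    (fun j _ => hmem j) (fun i _ j _ hij => (h.iIndepFun.indepFun hij).comp (hc (v i)) (hc (v j)))
  rw [variance_of_integral_eq_zero] at hvar
  · simp only [Finset.sum_apply] at hvar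
    rw [hvar]
    refine Finset.sum_congr rfl fun j _ => ?_
    rw [(hid j).variance_eq, variance_of_integral_eq_zero, h.integral_inner_sq]
    · exact ((hid j).aemeasurable_snd)
    · rw [← (hid j).integral_eq]
      exact hmean j
  · exact Finset.aemeasurable_sum _ fun j _ => (hmem j).aestronglyMeasurable.aemeasurable
  · simp only [Finset.sum_apply]
    rw [integral_finsetSum _ fun j _ => (hmem j).integrable (by norm_num)]
    exact Finset.sum_eq_zero fun j _ => hmean j

theorem lintegral_enorm_sum_le [IsProbabilityMeasure P] (h : IsCoefficientSequence P ξ σ₁ σ₂)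
    (s : Finset ℕ) (z : ℕ → ℂ) :
    ∫⁻ ω, ‖∑ j ∈ s, ξ j ω * z j‖ₑ ∂P ≤
      ENNReal.ofReal (1 + (σ₁ ^ 2 + σ₂ ^ 2) * ∑ j ∈ s, ‖z j‖ ^ 2) := by
  have hre : ∀ ω, (∑ j ∈ s, ξ j ω * z j).re = ∑ j ∈ s, ⟪ξ j ω, conj (z j)⟫ := by
    intro ω
    rw [Complex.re_sum]
    refine Finset.sum_congr rfl fun j _ => ?_
    rw [Complex.inner]
    simp
    ring
  have him : ∀ ω, (∑ j ∈ s, ξ j ω * z j).im = ∑ j ∈ s, ⟪ξ j ω, Complex.I * conj (z j)⟫ := by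
    intro ω
    rw [Complex.im_sum]
    refine Finset.sum_congr rfl fun j _ => ?_
    rw [Complex.inner]
    simp
    ring
  have hmem : MemLp (fun ω => ∑ j ∈ s, ξ j ω * z j) 2 P :=
    memLp_finsetSum s fun j _ => (h.memLp_apply j).mul_const (z j)
  have hint : Integrable (fun ω => ‖∑ j ∈ s, ξ j ω * z j‖ ^ 2) P :=
    hmem.integrable_norm_pow (by norm_num)
  have i1 : Integrable (fun ω => (∑ j ∈ s, ⟪ξ j ω, conj (z j)⟫) ^ 2) P := by
    simp_rw [← hre]
    exact (MemLp.re hmem).integrable_sq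
  have i2 : Integrable (fun ω => (∑ j ∈ s, ⟪ξ j ω, Complex.I * conj (z j)⟫) ^ 2) P := by
    simp_rw [← him]
    exact (MemLp.im hmem).integrable_sq
  have hsq : ∫ ω, ‖∑ j ∈ s, ξ j ω * z j‖ ^ 2 ∂P = (σ₁ ^ 2 + σ₂ ^ 2) * ∑ j ∈ s, ‖z j‖ ^ 2 := by
    have e : ∀ ω, ‖∑ j ∈ s, ξ j ω * z j‖ ^ 2 = (∑ j ∈ s, ⟪ξ j ω, conj (z j)⟫) ^ 2 +
        (∑ j ∈ s, ⟪ξ j ω, Complex.I * conj (z j)⟫) ^ 2 := by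
      intro ω
      rw [← hre, ← him, ← Complex.normSq_eq_norm_sq, Complex.normSq_apply]
      ring
    simp_rw [e]
    rw [integral_add i1 i2, h.integral_sum_inner_sq, h.integral_sum_inner_sq,
      ← Finset.sum_add_distrib, Finset.mul_sum]
    refine Finset.sum_congr rfl fun j _ => ?_
    rw [← Complex.normSq_eq_norm_sq, Complex.normSq_apply]
    simp
    ring
  calc ∫⁻ ω, ‖∑ j ∈ s, ξ j ω * z j‖ₑ ∂P
      ≤ ∫⁻ ω, ENNReal.ofReal (1 + ‖∑ j ∈ s, ξ j ω * z j‖ ^ 2) ∂P := by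
        refine lintegral_mono fun ω => ?_
        rw [← ofReal_norm]
        refine ENNReal.ofReal_le_ofReal ?_
        nlinarith [sq_nonneg (‖∑ j ∈ s, ξ j ω * z j‖ - 1)]
    _ = ENNReal.ofReal (∫ ω, (1 + ‖∑ j ∈ s, ξ j ω * z j‖ ^ 2) ∂P) := by
        have hint' : Integrable (fun ω => 1 + ‖∑ j ∈ s, ξ j ω * z j‖ ^ 2) P :=
          (integrable_const 1).add hint
        rw [ofReal_integral_eq_lintegral_ofReal hint' (ae_of_all _ fun ω => by positivity)]
    _ = _ := by
        rw [integral_add (integrable_const _) hint, hsq]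
        simp

end IsCoefficientSequence

end Coefficients

/-! ### The localized polynomials -/

/-- The deterministic weight of `ξ_j` in the normalized polynomial `P_n`. -/
noncomputable def localWeight (b : ℝ → ℝ) (ψ : ℝ) (n j : ℕ) : ℂ :=
  ((b n * √n : ℝ) : ℂ)⁻¹ * b j * Complex.exp (Complex.I * ψ) ^ j

theorem norm_exp_I_mul (ψ : ℝ) : ‖Complex.exp (Complex.I * ψ)‖ = 1 := by
  rw [mul_comm]
  exact Complex.norm_exp_ofReal_mul_I ψ

theorem norm_localWeight_sq (b : ℝ → ℝ) (ψ : ℝ) (n j : ℕ) :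
    ‖localWeight b ψ n j‖ ^ 2 = (n : ℝ)⁻¹ * (b j ^ 2 / b n ^ 2) := by
  rw [localWeight, norm_mul, norm_mul, norm_pow, norm_exp_I_mul, one_pow, mul_one, norm_inv,
    Complex.norm_real, Complex.norm_real, Real.norm_eq_abs, Real.norm_eq_abs, mul_pow, inv_pow,
    sq_abs, sq_abs, mul_pow, Real.sq_sqrt (Nat.cast_nonneg n), mul_inv]
  ring

theorem localWeight_sq (b : ℝ → ℝ) (ψ : ℝ) (n j : ℕ) :
    localWeight b ψ n j ^ 2 =
      (n : ℂ)⁻¹ * ((b j ^ 2 / b n ^ 2 : ℝ) : ℂ) * Complex.exp (2 * Complex.I * ψ) ^ j := by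
  have h1 : ((√n : ℝ) : ℂ) ^ 2 = n := by
    rw [← Complex.ofReal_pow, Real.sq_sqrt (Nat.cast_nonneg n)]
    simp
  have h2 : Complex.exp (2 * Complex.I * ψ) = Complex.exp (Complex.I * ψ) ^ 2 := by
    rw [← Complex.exp_nat_mul]
    congr 1
    push_cast
    ring
  rw [localWeight, h2]
  push_cast
  rw [mul_pow, mul_pow, inv_pow, mul_pow, h1, mul_inv]
  ring

theorem normalizedLocalPoly_apply (b : ℝ → ℝ) (x : ℕ → ℂ) (ψ : ℝ) (n : ℕ) (u : ℂ) :
    (normalizedLocalPoly b x ψ n).1 u = ∑ j ∈ Finset.range (n + 1),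
      x j * (localWeight b ψ n j * Complex.exp (u * ((j / n : ℝ) : ℂ))) := by
  have h1 : (normalizedLocalPoly b x ψ n).1 u = ((b n * √n : ℝ) : ℂ)⁻¹ *
      (regPoly b x n).eval (Complex.exp (Complex.I * ψ + u / n)) := rfl
  rw [h1, regPoly, Polynomial.eval_finsetSum, Finset.mul_sum]
  refine Finset.sum_congr rfl fun j _ => ?_
  rw [Polynomial.eval_monomial, localWeight, Complex.exp_add, mul_pow,
    ← Complex.exp_nat_mul (u / n)]
  have : (j : ℂ) * (u / n) = u * ((j / n : ℝ) : ℂ) := by push_cast; ring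
  rw [this]
  ring

theorem hasSum_normalizedLocalPoly (b : ℝ → ℝ) (x : ℕ → ℂ) (ψ : ℝ) (n : ℕ) (u : ℂ) :
    HasSum (fun k : ℕ => (k.factorial : ℂ)⁻¹ * (∑ j ∈ Finset.range (n + 1),
      x j * (localWeight b ψ n j * ((j / n : ℝ) : ℂ) ^ k)) * u ^ k)
      ((normalizedLocalPoly b x ψ n).1 u) := by
  rw [normalizedLocalPoly_apply]
  have h1 : ∀ w : ℂ, HasSum (fun k : ℕ => (k.factorial : ℂ)⁻¹ * w ^ k) (Complex.exp w) := by
    intro w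
    have := NormedSpace.expSeries_div_hasSum_exp (𝔸 := ℂ) w
    rw [← Complex.exp_eq_exp_ℂ] at this
    refine this.congr_fun fun k => ?_
    rw [div_eq_inv_mul]
  have h2 := hasSum_sum (s := Finset.range (n + 1)) fun j _ =>
    (h1 (u * ((j / n : ℝ) : ℂ))).mul_left (x j * localWeight b ψ n j)
  simp_rw [mul_assoc (x _) (localWeight _ _ _ _)] at h2
  refine h2.congr_fun fun k => ?_
  rw [Finset.mul_sum, Finset.sum_mul]
  refine Finset.sum_congr rfl fun j _ => ?_
  rw [mul_pow]
  ring

theorem measurable_localPoly (b : ℝ → ℝ) (ψ : ℝ) (n : ℕ) :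
    Measurable fun x : ℕ → ℂ => localPoly b x ψ n := by
  let F : ℕ → EntireFunction := fun j =>
    ⟨⟨fun u => b j * Complex.exp (Complex.I * ψ + u / n) ^ j, by fun_prop⟩, by
      change Differentiable ℂ fun u : ℂ => (b j : ℂ) * Complex.exp (Complex.I * ψ + u / n) ^ j
      fun_prop⟩
  have h1 : (fun x : ℕ → ℂ => localPoly b x ψ n) =
      fun x => ∑ j ∈ Finset.range (n + 1), x j • F j := by
    funext x
    refine EntireFunction.ext_apply fun u => ?_
    rw [EntireFunction.sum_apply]
    change (regPoly b x n).eval (Complex.exp (Complex.I * ψ + u / n)) = _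
    rw [regPoly, Polynomial.eval_finsetSum]
    refine Finset.sum_congr rfl fun j _ => ?_
    change _ = x j * (b j * Complex.exp (Complex.I * ψ + u / n) ^ j)
    rw [Polynomial.eval_monomial]
    ring
  rw [h1]
  refine Finset.measurable_fun_sum _ fun j _ => ?_
  have : Continuous fun c : ℂ => c • F j := continuous_id.smul continuous_const
  exact this.measurable.comp (measurable_pi_apply j)

theorem measurable_normalizedLocalPoly (b : ℝ → ℝ) (ψ : ℝ) (n : ℕ) :
    Measurable fun x : ℕ → ℂ => normalizedLocalPoly b x ψ n := by
  have h : Continuous fun f : EntireFunction => ((b n * √n : ℝ) : ℂ)⁻¹ • f :=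
    continuous_const_smul _
  exact h.measurable.comp (measurable_localPoly b ψ n)

section Tightness

variable {Ω : Type*} [MeasurableSpace Ω] {P : Measure Ω} [IsProbabilityMeasure P]
  {ξ : ℕ → Ω → ℂ} {σ₁ σ₂ : ℝ} {b : ℝ → ℝ} {α : ℝ} (ψ : ℝ)

theorem IsRegularWeight.tendsto_sum_norm_localWeight_sq
    (hb : IsRegularWeight (fun k => b k ^ 2) (2 * α)) {f : ℝ → ℂ} (hf : Continuous f) :
    Tendsto (fun n : ℕ => ∑ j ∈ Finset.range (n + 1), ‖localWeight b ψ n j * f (j / n)‖ ^ 2) atTop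
      (𝓝 (∫ x in (0 : ℝ)..1, ((x ^ (2 * α) : ℝ) : ℂ) * (f x * conj (f x))).re) := by
  have hc : Continuous fun x => f x * conj (f x) := by fun_prop
  have h1 := (Complex.continuous_re.tendsto _).comp (hb.tendsto_sum hc)
  refine h1.congr fun n => ?_
  rw [Function.comp_apply]
  have h2 : (n : ℂ)⁻¹ * ∑ j ∈ Finset.range (n + 1), ((b j ^ 2 / b n ^ 2 : ℝ) : ℂ) *
      (f (j / n) * conj (f (j / n))) =
      ((∑ j ∈ Finset.range (n + 1), ‖localWeight b ψ n j * f (j / n)‖ ^ 2 : ℝ) : ℂ) := by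
    push_cast
    rw [Finset.mul_sum]
    refine Finset.sum_congr rfl fun j _ => ?_
    have h3 : ‖localWeight b ψ n j * f (j / n)‖ ^ 2 =
        (n : ℝ)⁻¹ * (b j ^ 2 / b n ^ 2) * ‖f (j / n)‖ ^ 2 := by
      rw [norm_mul, mul_pow, norm_localWeight_sq]
    have h4 := congrArg Complex.ofReal h3
    push_cast at h4
    rw [h4, Complex.mul_conj, Complex.normSq_eq_norm_sq]
    push_cast
    ring
  rw [h2, Complex.ofReal_re]

/-- The Taylor tails of the normalized polynomials are small in probability, uniformly in `n`: the
`k`-th Taylor coefficient has first absolute moment `O (1 / k!)`. -/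
theorem IsCoefficientSequence.eventually_measure_interpolate_le
    (hξ : IsCoefficientSequence P ξ σ₁ σ₂) (hb : IsRegularWeight (fun k => b k ^ 2) (2 * α))
    {V : Set (EntireFunction × EntireFunction)} (hV : V ∈ uniformity EntireFunction) {δ : ℝ}
    (hδ : 0 < δ) : ∀ᶠ m in atTop, ∀ᶠ n in atTop,
      P.real {ω | (normalizedLocalPoly b (fun k => ξ k ω) ψ n, EntireFunction.interpolate m
        (EntireFunction.evalRoots m (normalizedLocalPoly b (fun k => ξ k ω) ψ n))) ∉ V} ≤ δ := by
  obtain ⟨R, hR, ε, hε, hVR⟩ := EntireFunction.exists_closedBall_of_mem_uniformity hV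
  have h1 := hb.tendsto_sum_norm_localWeight_sq ψ (f := fun _ => 1) continuous_const
  obtain ⟨B, hB⟩ : ∃ B : ℝ, ∀ᶠ n : ℕ in atTop,
      ∑ j ∈ Finset.range (n + 1), ‖localWeight b ψ n j‖ ^ 2 ≤ B := by
    have h2 := h1.eventually_le_const (lt_add_one _)
    simp only [mul_one] at h2
    exact ⟨_, h2⟩
  set K := 1 + (σ₁ ^ 2 + σ₂ ^ 2) * B with hK
  have hS : ∑' k : ℕ, ENNReal.ofReal (K * (R ^ k / k.factorial)) ≠ ∞ :=
    ((Real.summable_pow_div_factorial R).mul_left K).tsum_ofReal_ne_top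
  have hT := ENNReal.Tendsto.const_mul (a := 2) (ENNReal.tendsto_sum_nat_add _ hS)
    (Or.inr (by simp))
  rw [mul_zero] at hT
  filter_upwards [hT.eventually_le_const (u := ENNReal.ofReal (δ * ε))
    (ENNReal.ofReal_pos.mpr (by positivity)), eventually_gt_atTop 0] with m hm hm0
  filter_upwards [hB] with n hn
  set a : ℕ → Ω → ℂ := fun k ω => (k.factorial : ℂ)⁻¹ * (∑ j ∈ Finset.range (n + 1),
    ξ j ω * (localWeight b ψ n j * ((j / n : ℝ) : ℂ) ^ k)) with ha
  have hameas : ∀ k, AEMeasurable (a k) P := by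
    intro k
    have hsum : AEMeasurable (fun ω => ∑ j ∈ Finset.range (n + 1),
        ξ j ω * (localWeight b ψ n j * ((j / n : ℝ) : ℂ) ^ k)) P :=
      Finset.aemeasurable_fun_sum _ fun j _ => (hξ.aemeasurable j).mul_const _
    exact hsum.const_mul _
  have hmom : ∀ k, ∫⁻ ω, ‖a k ω‖ₑ * ENNReal.ofReal (R ^ k) ∂P ≤
      ENNReal.ofReal (K * (R ^ k / k.factorial)) := by
    intro k
    have hb1 := hξ.lintegral_enorm_sum_le (Finset.range (n + 1))
      fun j => localWeight b ψ n j * ((j / n : ℝ) : ℂ) ^ k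
    have hb2 : 1 + (σ₁ ^ 2 + σ₂ ^ 2) * ∑ j ∈ Finset.range (n + 1),
        ‖localWeight b ψ n j * ((j / n : ℝ) : ℂ) ^ k‖ ^ 2 ≤ K := by
      rw [hK]
      gcongr
      refine le_trans (Finset.sum_le_sum fun j hj => ?_) hn
      rw [norm_mul, norm_pow, Complex.norm_real, Real.norm_of_nonneg (by positivity)]
      gcongr
      refine mul_le_of_le_one_right (norm_nonneg _) (pow_le_one₀ (by positivity) ?_)
      refine div_le_one_of_le₀ ?_ (Nat.cast_nonneg n)
      exact_mod_cast Nat.lt_succ_iff.mp (Finset.mem_range.mp hj)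
    have hb3 := hb1.trans (ENNReal.ofReal_le_ofReal hb2)
    rw [lintegral_mul_const' _ _ ENNReal.ofReal_ne_top]
    simp_rw [ha, enorm_mul]
    rw [lintegral_const_mul' _ _ enorm_ne_top]
    have hfac : ‖(k.factorial : ℂ)⁻¹‖ₑ = ENNReal.ofReal ((k.factorial : ℝ)⁻¹) := by
      rw [← ofReal_norm, norm_inv, Complex.norm_natCast]
    rw [hfac]
    calc _ ≤ ENNReal.ofReal ((k.factorial : ℝ)⁻¹) * ENNReal.ofReal K * ENNReal.ofReal (R ^ k) := by
          gcongr
      _ = ENNReal.ofReal ((k.factorial : ℝ)⁻¹ * K * R ^ k) := by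
          rw [ENNReal.ofReal_mul' (by positivity), ENNReal.ofReal_mul (by positivity)]
      _ = _ := by congr 1; ring
  set T : Ω → ℝ≥0∞ := fun ω => 2 * ∑' k, ‖a (k + m) ω‖ₑ * ENNReal.ofReal (R ^ (k + m)) with hTdef
  have hTmeas : AEMeasurable T P :=
    (AEMeasurable.tsum fun k => (hameas _).enorm.mul_const _).const_mul _
  have hTint : ∫⁻ ω, T ω ∂P ≤ ENNReal.ofReal (δ * ε) := by
    refine le_trans ?_ hm
    rw [hTdef, lintegral_const_mul' _ _ (by simp), lintegral_tsum fun k =>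
      (hameas _).enorm.mul_const _]
    gcongr with k
    exact hmom (k + m)
  have hsub : {ω | (normalizedLocalPoly b (fun k => ξ k ω) ψ n, EntireFunction.interpolate m
        (EntireFunction.evalRoots m (normalizedLocalPoly b (fun k => ξ k ω) ψ n))) ∉ V} ⊆
      {ω | ENNReal.ofReal ε ≤ T ω} := by
    intro ω hω
    by_contra hcon
    refine hω (hVR _ _ fun z hz => ?_)
    rw [← ENNReal.ofReal_lt_ofReal_iff hε, ofReal_norm]
    refine (EntireFunction.enorm_sub_interpolate_le hm0
      (hasSum_normalizedLocalPoly b (fun k => ξ k ω) ψ n) hR hz).trans_lt ?_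
    exact not_le.mp hcon
  have hmarkov := mul_meas_ge_le_lintegral₀ hTmeas (ENNReal.ofReal ε)
  rw [Measure.real]
  refine ENNReal.toReal_le_of_le_ofReal hδ.le ?_
  refine (measure_mono hsub).trans ?_
  have h5 := hmarkov.trans hTint
  rw [mul_comm δ ε, ENNReal.ofReal_mul hε.le] at h5
  exact (ENNReal.mul_le_mul_iff_right (ENNReal.ofReal_pos.mpr hε).ne' ENNReal.ofReal_ne_top).mp h5

end Tightness

/-! ### Finite-dimensional distributions of the limit -/

section GAF

theorem intervalIntegrable_rpow_mul {β : ℝ} (hβ : -1 < β) {f : ℝ → ℂ} (hf : Continuous f) :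
    IntervalIntegrable (fun x : ℝ => ((x ^ β : ℝ) : ℂ) * f x) volume 0 1 :=
  have h : IntervalIntegrable (fun x : ℝ => x ^ β) volume 0 1 :=
    intervalIntegral.intervalIntegrable_rpow' hβ
  have h' : IntervalIntegrable (fun x : ℝ => ((x ^ β : ℝ) : ℂ)) volume 0 1 :=
    ⟨h.1.ofReal, h.2.ofReal⟩
  h'.mul_continuousOn hf.continuousOn

theorem sum_mul_expMoment {ι : Type*} {β : ℝ} (hβ : -1 < β) (s : Finset ι) (c w : ι → ℂ) :
    ∑ i ∈ s, c i * expMoment β (w i) =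
      ∫ x in (0 : ℝ)..1, ((x ^ β : ℝ) : ℂ) * ∑ i ∈ s, c i * Complex.exp (x * w i) := by
  simp only [expMoment, Finset.mul_sum]
  rw [intervalIntegral.integral_finsetSum]
  · refine Finset.sum_congr rfl fun i _ => ?_
    rw [← intervalIntegral.integral_const_mul]
    congr 1
    funext x
    ring
  · intro i _
    exact intervalIntegrable_rpow_mul hβ (by fun_prop)

namespace IsLiquidGAF

variable {α ψ σ₁ σ₂ : ℝ} {Ω : Type*} [MeasurableSpace Ω] {P : Measure Ω}
  {G : Ω → EntireFunction} {ι : Type*} [Fintype ι]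

theorem memLp_eval (hG : IsLiquidGAF α ψ σ₁ σ₂ G P) (u : ℂ) :
    MemLp (fun ω => (G ω).1 u) 2 P :=
  (hG.isGaussianProcess.hasGaussianLaw_eval u).memLp_two

theorem integral_sum_mul_conj (h : IsLiquidGAF α ψ σ₁ σ₂ G P) (hα : -1 / 2 < α)
    (u c : ι → ℂ) :
    ∫ ω, (∑ i, c i * (G ω).1 (u i)) * conj (∑ i, c i * (G ω).1 (u i)) ∂P =
      ((σ₁ ^ 2 + σ₂ ^ 2 : ℝ) : ℂ) * ∫ x in (0 : ℝ)..1, ((x ^ (2 * α) : ℝ) : ℂ) *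
        ((∑ i, c i * Complex.exp (x * u i)) * conj (∑ i, c i * Complex.exp (x * u i))) := by
  have hint : ∀ i j, Integrable (fun ω => (G ω).1 (u i) * conj ((G ω).1 (u j))) P := fun i j =>
    (h.memLp_eval (u i)).integrable_mul (h.memLp_eval (u j)).star
  have e : ∀ ω, (∑ i, c i * (G ω).1 (u i)) * conj (∑ i, c i * (G ω).1 (u i)) =
      ∑ p : ι × ι, c p.1 * conj (c p.2) * ((G ω).1 (u p.1) * conj ((G ω).1 (u p.2))) := by
    intro ω
    rw [map_sum, Finset.sum_mul_sum, ← Finset.univ_product_univ, Finset.sum_product]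
    refine Finset.sum_congr rfl fun i _ => Finset.sum_congr rfl fun j _ => ?_
    rw [map_mul]
    ring
  simp_rw [e]
  rw [integral_finsetSum _ fun p _ => (hint p.1 p.2).const_mul _]
  simp_rw [integral_const_mul, h.covariance]
  have e2 : ∀ p : ι × ι, c p.1 * conj (c p.2) * (((σ₁ ^ 2 + σ₂ ^ 2 : ℝ) : ℂ) *
      expMoment (2 * α) (u p.1 + conj (u p.2))) = ((σ₁ ^ 2 + σ₂ ^ 2 : ℝ) : ℂ) *
      (c p.1 * conj (c p.2) * expMoment (2 * α) (u p.1 + conj (u p.2))) := fun p => by ring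
  simp_rw [e2]
  rw [← Finset.mul_sum, sum_mul_expMoment (by linarith)]
  congr 2
  funext x
  congr 1
  rw [map_sum, Finset.sum_mul_sum, ← Finset.univ_product_univ, Finset.sum_product]
  refine Finset.sum_congr rfl fun i _ => Finset.sum_congr rfl fun j _ => ?_
  rw [mul_add, Complex.exp_add, map_mul, ← Complex.exp_conj, map_mul, Complex.conj_ofReal]
  ring

theorem integral_sum_sq (h : IsLiquidGAF α ψ σ₁ σ₂ G P) (hα : -1 / 2 < α) (u c : ι → ℂ) :
    ∫ ω, (∑ i, c i * (G ω).1 (u i)) ^ 2 ∂P = if ψ = 0 ∨ ψ = Real.pi then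
      ((σ₁ ^ 2 - σ₂ ^ 2 : ℝ) : ℂ) * ∫ x in (0 : ℝ)..1, ((x ^ (2 * α) : ℝ) : ℂ) *
        (∑ i, c i * Complex.exp (x * u i)) ^ 2 else 0 := by
  have hint : ∀ i j, Integrable (fun ω => (G ω).1 (u i) * (G ω).1 (u j)) P := fun i j =>
    (h.memLp_eval (u i)).integrable_mul (h.memLp_eval (u j))
  have e : ∀ ω, (∑ i, c i * (G ω).1 (u i)) ^ 2 =
      ∑ p : ι × ι, c p.1 * c p.2 * ((G ω).1 (u p.1) * (G ω).1 (u p.2)) := by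
    intro ω
    rw [sq, Finset.sum_mul_sum, ← Finset.univ_product_univ, Finset.sum_product]
    refine Finset.sum_congr rfl fun i _ => Finset.sum_congr rfl fun j _ => ?_
    ring
  simp_rw [e]
  rw [integral_finsetSum _ fun p _ => (hint p.1 p.2).const_mul _]
  simp_rw [integral_const_mul, h.pseudoCovariance]
  split_ifs with hψ
  · have e2 : ∀ p : ι × ι, c p.1 * c p.2 * (((σ₁ ^ 2 - σ₂ ^ 2 : ℝ) : ℂ) *
        expMoment (2 * α) (u p.1 + u p.2)) = ((σ₁ ^ 2 - σ₂ ^ 2 : ℝ) : ℂ) *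
        (c p.1 * c p.2 * expMoment (2 * α) (u p.1 + u p.2)) := fun p => by ring
    simp_rw [e2]
    rw [← Finset.mul_sum, sum_mul_expMoment (by linarith)]
    congr 2
    funext x
    congr 1
    rw [sq, Finset.sum_mul_sum, ← Finset.univ_product_univ, Finset.sum_product]
    refine Finset.sum_congr rfl fun i _ => Finset.sum_congr rfl fun j _ => ?_
    rw [mul_add, Complex.exp_add]
    ring
  · simp

/-- The variance of `Re ∑ i, c i * G (u i)`, expressed through `F x = ∑ i, c i * exp (x * u i)`. -/
noncomputable def gafVariance (α ψ σ₁ σ₂ : ℝ) (F : ℝ → ℂ) : ℝ :=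
  (((σ₁ ^ 2 + σ₂ ^ 2) * (∫ x in (0 : ℝ)..1, ((x ^ (2 * α) : ℝ) : ℂ) * (F x * conj (F x))).re) +
    (σ₁ ^ 2 - σ₂ ^ 2) * (if ψ = 0 ∨ ψ = Real.pi then
      ∫ x in (0 : ℝ)..1, ((x ^ (2 * α) : ℝ) : ℂ) * F x ^ 2 else 0).re) / 2

theorem hasGaussianLaw_re_sum (hG : IsLiquidGAF α ψ σ₁ σ₂ G P) (u c : ι → ℂ) :
    HasGaussianLaw (fun ω => (∑ i, c i * (G ω).1 (u i)).re) P := by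
  classical
  let I : Finset ℂ := Finset.univ.image u
  have hu : ∀ i, u i ∈ I := fun i => Finset.mem_image_of_mem u (Finset.mem_univ i)
  let L : (I → ℂ) →L[ℝ] ℝ := ∑ i, Complex.reCLM.comp
    ((ContinuousLinearMap.mul ℝ ℂ (c i)).comp (ContinuousLinearMap.proj ⟨u i, hu i⟩))
  have := (hG.isGaussianProcess.hasGaussianLaw I).map_fun L
  have e : (fun ω => (∑ i, c i * (G ω).1 (u i)).re) =
      fun ω => L (I.restrict fun x => (G ω).1 x) := by
    funext ω
    rw [Complex.re_sum]
    simp [L, Finset.restrict_def]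
  rw [e]
  exact this

theorem integral_exp_re_sum [IsProbabilityMeasure P] (h : IsLiquidGAF α ψ σ₁ σ₂ G P)
    (hα : -1 / 2 < α) (u c : ι → ℂ) :
    ∫ ω, Complex.exp (((∑ i, c i * (G ω).1 (u i)).re : ℝ) * Complex.I) ∂P =
      Complex.exp
        (-(gafVariance α ψ σ₁ σ₂ (fun x => ∑ i, c i * Complex.exp (x * u i)) / 2 : ℝ)) := by
  have hg := h.hasGaussianLaw_re_sum u c
  set Z : Ω → ℂ := fun ω => ∑ i, c i * (G ω).1 (u i) with hZ
  have hZmem : MemLp Z 2 P := memLp_finsetSum _ fun i _ => (h.memLp_eval (u i)).const_mul (c i)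
  have hZint : Integrable Z P := hZmem.integrable (by norm_num)
  have hmean : ∫ ω, (Z ω).re ∂P = 0 := by
    have h1 : ∫ ω, Z ω ∂P = 0 := by
      rw [hZ, integral_finsetSum _ fun i _ =>
        ((h.memLp_eval (u i)).integrable (by norm_num)).const_mul _]
      simp [integral_const_mul, h.centred]
    have h2 := integral_re hZint
    simp only [RCLike.re_eq_complex_re] at h2
    rw [h2, h1, Complex.zero_re]
  have hvar : ∫ ω, (Z ω).re ^ 2 ∂P =
      gafVariance α ψ σ₁ σ₂ (fun x => ∑ i, c i * Complex.exp (x * u i)) := by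
    have i1 : Integrable (fun ω => Z ω * conj (Z ω)) P := hZmem.integrable_mul hZmem.star
    have i2 : Integrable (fun ω => Z ω ^ 2) P := by
      simp_rw [sq]
      exact hZmem.integrable_mul hZmem
    have e : ∀ ω, (Z ω).re ^ 2 = (Z ω * conj (Z ω) + Z ω ^ 2).re / 2 := by
      intro ω
      simp [sq, Complex.mul_re]
    have h2 := integral_re (i1.add i2)
    simp only [RCLike.re_eq_complex_re, Pi.add_apply] at h2
    simp_rw [e]
    rw [integral_div, h2, integral_add i1 i2, h.integral_sum_mul_conj hα,
      h.integral_sum_sq hα, gafVariance, Complex.add_re, Complex.re_ofReal_mul]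
    split_ifs with hψ
    · rw [Complex.re_ofReal_mul]
    · simp
  have hX := hg.charFun_map_eq 1
  rw [charFun_apply_real, integral_map hg.aemeasurable (by fun_prop)] at hX
  simp only [Complex.ofReal_one, one_mul] at hX
  rw [hX]
  have h1 : ∀ x : ℝ, inner ℝ 1 x = x := fun x => by simp
  simp only [h1]
  rw [variance_of_integral_eq_zero hg.aemeasurable hmean, hmean, hvar]
  simp

end IsLiquidGAF

end GAF

/-! ### Convergence in distribution to the Gaussian analytic function -/

theorem exp_two_I_mul_eq_one_iff {ψ : ℝ} (hψ : ψ ∈ Ico 0 (2 * Real.pi)) :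
    Complex.exp (2 * Complex.I * ψ) = 1 ↔ ψ = 0 ∨ ψ = Real.pi := by
  rw [Complex.exp_eq_one_iff]
  constructor
  · rintro ⟨n, hn⟩
    have h1 : ψ = n * Real.pi := by
      have h2 : (2 * Complex.I) * (ψ : ℂ) = (2 * Complex.I) * ((n * Real.pi : ℝ) : ℂ) := by
        rw [hn]; push_cast; ring
      exact_mod_cast mul_left_cancel₀ (by simp) h2
    have hn0 : (0 : ℝ) ≤ n := by
      by_contra hcon
      nlinarith [hψ.1, Real.pi_pos]
    have hn2 : (n : ℝ) < 2 := by
      by_contra hcon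
      nlinarith [hψ.2, Real.pi_pos]
    have h3 : 0 ≤ n := by exact_mod_cast hn0
    have h4 : n < 2 := by exact_mod_cast hn2
    interval_cases n
    · left; simpa using h1
    · right; simpa using h1
  · rintro (rfl | rfl)
    · exact ⟨0, by simp⟩
    · exact ⟨1, by push_cast; ring⟩

section FunctionalLimit

open scoped RealInnerProductSpace

variable {Ω : Type*} [MeasurableSpace Ω] {P : Measure Ω}
  {ξ : ℕ → Ω → ℂ} {σ₁ σ₂ : ℝ} {b : ℝ → ℝ} {α ψ : ℝ}

theorem IsCoefficientSequence.aemeasurable_normalizedLocalPoly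
    (hξ : IsCoefficientSequence P ξ σ₁ σ₂) (n : ℕ) :
    AEMeasurable (fun ω => normalizedLocalPoly b (fun k => ξ k ω) ψ n) P :=
  (measurable_normalizedLocalPoly b ψ n).comp_aemeasurable
    (aemeasurable_pi_lambda _ fun k => hξ.aemeasurable k)

/-- The weights `localWeight b ψ n j ^ 2` carry the phase `exp (2iψ) ^ j`, which equals `1` exactly
if `ψ ∈ {0, π}` and makes the sum cancel otherwise. -/
theorem IsRegularWeight.tendsto_sum_localWeight_sq
    (hb : IsRegularWeight (fun k => b k ^ 2) (2 * α)) (hψ : ψ ∈ Ico 0 (2 * Real.pi))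
    {f : ℝ → ℂ} (hf : Continuous f) :
    Tendsto (fun n : ℕ => ∑ j ∈ Finset.range (n + 1), (localWeight b ψ n j * f (j / n)) ^ 2) atTop
      (𝓝 (if ψ = 0 ∨ ψ = Real.pi then
        ∫ x in (0 : ℝ)..1, ((x ^ (2 * α) : ℝ) : ℂ) * f x ^ 2 else 0)) := by
  have hf2 : Continuous fun x => f x ^ 2 := hf.pow 2
  have hterm : ∀ n j : ℕ, (localWeight b ψ n j * f (j / n)) ^ 2 = (n : ℂ)⁻¹ *
      (((b j ^ 2 / b n ^ 2 : ℝ) : ℂ) * f (j / n) ^ 2 * Complex.exp (2 * Complex.I * ψ) ^ j) := by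
    intro n j
    rw [mul_pow, localWeight_sq]
    ring
  simp_rw [hterm, ← Finset.mul_sum]
  split_ifs with h
  · rw [(exp_two_I_mul_eq_one_iff hψ).mpr h]
    simp only [one_pow, mul_one]
    have h2 := hb.tendsto_sum hf2
    exact h2.congr fun n => by simp only
  · refine hb.tendsto_sum_mul_pow hf2 ?_ (mt (exp_two_I_mul_eq_one_iff hψ).mp h)
    rw [show (2 : ℂ) * Complex.I * ψ = Complex.I * ((2 * ψ : ℝ) : ℂ) by push_cast; ring]
    exact norm_exp_I_mul _

theorem IsRegularWeight.eventually_norm_localWeight_mul_le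
    (hb : IsRegularWeight (fun k => b k ^ 2) (2 * α)) {f : ℝ → ℂ} (hf : Continuous f) {δ : ℝ}
    (hδ : 0 < δ) : ∀ᶠ n : ℕ in atTop, ∀ j ≤ n, ‖localWeight b ψ n j * f (j / n)‖ ≤ δ := by
  obtain ⟨M, hM⟩ := (isCompact_Icc (a := (0 : ℝ)) (b := 1)).exists_bound_of_continuousOn
    hf.continuousOn
  have hM0 : 0 ≤ M := (norm_nonneg _).trans (hM 0 (by simp))
  have h1 := hb.eventually_abs_div_le (δ := (δ / (M + 1)) ^ 2) (by positivity)
  filter_upwards [h1, eventually_gt_atTop 0] with n hn hn0 j hj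
  have hn0' : (0 : ℝ) < n := by exact_mod_cast hn0
  have h2 : ‖localWeight b ψ n j‖ ^ 2 ≤ (δ / (M + 1)) ^ 2 := by
    rw [norm_localWeight_sq, ← div_eq_inv_mul]
    exact (div_le_div_of_nonneg_right (le_abs_self _) hn0'.le).trans (hn j hj)
  have h3 : ‖localWeight b ψ n j‖ ≤ δ / (M + 1) := le_of_sq_le_sq h2 (by positivity)
  have h4 : ‖f (j / n)‖ ≤ M := hM _ ⟨by positivity, by
    rw [div_le_one hn0']; exact_mod_cast hj⟩
  rw [norm_mul]
  calc _ ≤ δ / (M + 1) * (M + 1) := by gcongr; linarith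
    _ = δ := by field_simp

variable [IsProbabilityMeasure P]

/-- The finite-dimensional distributions converge, in terms of characteristic functions. -/
theorem IsCoefficientSequence.tendsto_integral_exp_re_sum {ι : Type*} [Fintype ι]
    (hξ : IsCoefficientSequence P ξ σ₁ σ₂) (hb : IsRegularWeight (fun k => b k ^ 2) (2 * α))
    (hψ : ψ ∈ Ico 0 (2 * Real.pi)) (u c : ι → ℂ) :
    Tendsto (fun n => ∫ ω, Complex.exp
      (((∑ i, c i * (normalizedLocalPoly b (fun k => ξ k ω) ψ n).1 (u i)).re : ℝ) * Complex.I) ∂P)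
      atTop (𝓝 (Complex.exp (-(IsLiquidGAF.gafVariance α ψ σ₁ σ₂
        (fun x => ∑ i, c i * Complex.exp (x * u i)) / 2 : ℝ)))) := by
  set F : ℝ → ℂ := fun x => ∑ i, c i * Complex.exp (x * u i) with hF
  have hFc : Continuous F := by fun_prop
  have hre : ∀ n ω, (∑ i, c i * (normalizedLocalPoly b (fun k => ξ k ω) ψ n).1 (u i)).re =
      ∑ j ∈ Finset.range (n + 1), ⟪ξ j ω, conj (localWeight b ψ n j * F (j / n))⟫ := by
    intro n ω
    have h1 : ∑ i, c i * (normalizedLocalPoly b (fun k => ξ k ω) ψ n).1 (u i) =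
        ∑ j ∈ Finset.range (n + 1), ξ j ω * (localWeight b ψ n j * F (j / n)) := by
      simp only [normalizedLocalPoly_apply, hF, Finset.mul_sum]
      rw [Finset.sum_comm]
      refine Finset.sum_congr rfl fun j _ => Finset.sum_congr rfl fun i _ => ?_
      rw [mul_comm (u i)]
      ring
    rw [h1, Complex.re_sum]
    refine Finset.sum_congr rfl fun j _ => ?_
    rw [Complex.inner, ← map_mul, Complex.conj_re, mul_comm]
  simp_rw [hre]
  have hsum := hb.tendsto_sum_norm_localWeight_sq ψ hFc
  refine tendsto_integral_exp_sum_inner (X := ξ) hξ.iIndepFun hξ.identDistrib hξ.memLp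
    hξ.integral_eq_zero (fun n j => conj (localWeight b ψ n j * F (j / n))) ?_ ?_ ?_
    (B := (∫ x in (0 : ℝ)..1, ((x ^ (2 * α) : ℝ) : ℂ) * (F x * conj (F x))).re + 1)
  · intro δ hδ
    simp only [RCLike.norm_conj]
    exact hb.eventually_norm_localWeight_mul_le hFc hδ
  · simp only [RCLike.norm_conj]
    exact hsum.eventually_le_const (lt_add_one _)
  · have h2 := (Complex.continuous_re.tendsto _).comp (hb.tendsto_sum_localWeight_sq hψ hFc)
    have h3 := ((hsum.const_mul (σ₁ ^ 2 + σ₂ ^ 2)).add (h2.const_mul (σ₁ ^ 2 - σ₂ ^ 2))).div_const 2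
    refine h3.congr fun n => ?_
    simp only [hξ.integral_inner_sq, Function.comp_apply, Complex.re_sum]
    rw [Finset.mul_sum, Finset.mul_sum, ← Finset.sum_add_distrib, Finset.sum_div]
    refine Finset.sum_congr rfl fun j _ => ?_
    generalize localWeight b ψ n j * F (j / n) = z
    rw [← Complex.normSq_eq_norm_sq, Complex.normSq_apply, sq z, Complex.mul_re, Complex.conj_re,
      Complex.conj_im]
    ring

variable {Ω' : Type*} [MeasurableSpace Ω'] {P' : Measure Ω'} [IsProbabilityMeasure P']
  {G : Ω' → EntireFunction}

open EntireFunction in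
theorem IsCoefficientSequence.tendstoInDistribution_evalRoots
    (hξ : IsCoefficientSequence P ξ σ₁ σ₂) (hb : IsRegularWeight (fun k => b k ^ 2) (2 * α))
    (hα : -1 / 2 < α) (hψ : ψ ∈ Ico 0 (2 * Real.pi)) (hG : IsLiquidGAF α ψ σ₁ σ₂ G P') (m : ℕ) :
    TendstoInDistribution
      (fun n ω => evalRoots m (normalizedLocalPoly b (fun k => ξ k ω) ψ n)) atTop
      (fun ω => evalRoots m (G ω)) (fun _ => P) P' := by
  have hX : ∀ n, AEMeasurable
      (fun ω => evalRoots m (normalizedLocalPoly b (fun k => ξ k ω) ψ n)) P := fun n =>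
    (continuous_evalRoots m).measurable.comp_aemeasurable (hξ.aemeasurable_normalizedLocalPoly n)
  have hZ : AEMeasurable (fun ω => evalRoots m (G ω)) P' :=
    (continuous_evalRoots m).measurable.comp_aemeasurable hG.aemeasurable
  refine ⟨hX, hZ, ProbabilityMeasure.tendsto_of_tendsto_charFun fun t => ?_⟩
  have hinner : ∀ f : EntireFunction, ⟪evalRoots m f, t⟫ =
      (∑ i : Fin m, conj (t i) * f.1 (rootOfUnity m ^ (i : ℕ))).re := by
    intro f
    rw [PiLp.inner_apply, Complex.re_sum]
    refine Finset.sum_congr rfl fun i _ => ?_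
    rw [Complex.inner]
    simp only [evalRoots, Complex.mul_re, Complex.conj_re, Complex.conj_im]
    ring
  have hc : Continuous fun x : PiLp 2 (fun _ : Fin m => ℂ) =>
      Complex.exp (⟪x, t⟫ * Complex.I) := by fun_prop
  have h1 := hξ.tendsto_integral_exp_re_sum hb hψ (fun i : Fin m => rootOfUnity m ^ (i : ℕ))
    fun i => conj (t i)
  rw [← hG.integral_exp_re_sum hα] at h1
  simp only [ProbabilityMeasure.coe_mk, charFun_apply]
  rw [integral_map hZ hc.aestronglyMeasurable]
  simp_rw [hinner]
  refine h1.congr fun n => ?_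
  rw [integral_map (hX n) hc.aestronglyMeasurable]
  simp_rw [hinner]

/-- The functional limit theorem for the localized polynomials. -/
theorem IsCoefficientSequence.tendstoInDistribution_normalizedLocalPoly
    (hξ : IsCoefficientSequence P ξ σ₁ σ₂) (hb : IsRegularWeight (fun k => b k ^ 2) (2 * α))
    (hα : -1 / 2 < α) (hψ : ψ ∈ Ico 0 (2 * Real.pi)) (hG : IsLiquidGAF α ψ σ₁ σ₂ G P') :
    TendstoInDistribution (fun n ω => normalizedLocalPoly b (fun k => ξ k ω) ψ n) atTop G
      (fun _ => P) P' := by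
  refine tendstoInDistribution_of_approx (fun n => hξ.aemeasurable_normalizedLocalPoly n)
    hG.aemeasurable (fun m => (hξ.tendstoInDistribution_evalRoots hb hα hψ hG m).continuous_comp
      (EntireFunction.continuous_interpolate m))
    (ae_of_all _ fun ω => EntireFunction.tendsto_interpolate (G ω))
    fun V hV δ hδ => hξ.eventually_measure_interpolate_le ψ hb hV hδ

/-- The value `G 0` is a nondegenerate Gaussian variable, since `E |G 0| ^ 2 > 0`. -/
theorem IsLiquidGAF.ae_ne_zero (hG : IsLiquidGAF α ψ σ₁ σ₂ G P') (hα : -1 / 2 < α)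
    (hσ : 0 < σ₁ ^ 2 + σ₂ ^ 2) : ∀ᵐ ω ∂P', G ω ≠ 0 := by
  -- A one-dimensional projection of `G 0` that is not almost surely zero has no atoms.
  have key : ∀ c : ℂ, ∫ ω, (c * (G ω).1 0).re ^ 2 ∂P' ≠ 0 → ∀ᵐ ω ∂P', G ω ≠ 0 := by
    intro c hc
    have hg : HasGaussianLaw (fun ω => (c * (G ω).1 0).re) P' := by
      simpa using hG.hasGaussianLaw_re_sum (ι := Unit) (fun _ => 0) fun _ => c
    have hvar : Var[fun ω => (c * (G ω).1 0).re; P'].toNNReal ≠ 0 := by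
      intro h0
      have hmean : ∫ ω, (c * (G ω).1 0).re ∂P' = 0 := by
        have h2 := integral_re (((hG.memLp_eval 0).integrable (by norm_num)).const_mul c)
        simp only [RCLike.re_eq_complex_re] at h2
        rw [h2, integral_const_mul, hG.centred, mul_zero, Complex.zero_re]
      rw [Real.toNNReal_eq_zero, variance_of_integral_eq_zero hg.aemeasurable hmean] at h0
      exact hc (le_antisymm h0 (integral_nonneg fun _ => sq_nonneg _))
    have hlaw := hg.map_eq_gaussianReal
    have : NullSingletonClass (P'.map fun ω => (c * (G ω).1 0).re) := by
      rw [hlaw]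
      exact nullSingletonClass_gaussianReal hvar
    have h0 : (P'.map fun ω => (c * (G ω).1 0).re) {0} = 0 := measure_singleton 0
    rw [Measure.map_apply_of_aemeasurable hg.aemeasurable (measurableSet_singleton 0)] at h0
    have h0' : ∀ᵐ ω ∂P', ω ∉ (fun ω => (c * (G ω).1 0).re) ⁻¹' {0} :=
      measure_eq_zero_iff_ae_notMem.mp h0
    filter_upwards [h0'] with ω hω hGω
    refine hω ?_
    simp [hGω]
  by_contra hcon
  have h1 : ∫ ω, (1 * (G ω).1 0).re ^ 2 ∂P' = 0 := by
    by_contra h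
    exact hcon (key 1 h)
  have h2 : ∫ ω, (Complex.I * (G ω).1 0).re ^ 2 ∂P' = 0 := by
    by_contra h
    exact hcon (key Complex.I h)
  have hcov := hG.covariance 0 0
  have i1 : Integrable (fun ω => (1 * (G ω).1 0).re ^ 2) P' :=
    (MemLp.re ((hG.memLp_eval 0).const_mul 1)).integrable_sq
  have i2 : Integrable (fun ω => (Complex.I * (G ω).1 0).re ^ 2) P' :=
    (MemLp.re ((hG.memLp_eval 0).const_mul Complex.I)).integrable_sq
  have e : ∀ ω, (G ω).1 0 * conj ((G ω).1 0) =
      (((1 * (G ω).1 0).re ^ 2 + (Complex.I * (G ω).1 0).re ^ 2 : ℝ) : ℂ) := by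
    intro ω
    rw [Complex.mul_conj, Complex.normSq_apply]
    simp
    ring
  simp_rw [e] at hcov
  rw [integral_complex_ofReal, integral_add i1 i2, h1, h2] at hcov
  have hm : expMoment (2 * α) (0 + conj 0) = (((2 * α + 1)⁻¹ : ℝ) : ℂ) := by
    have h3 : expMoment (2 * α) (0 + conj 0) = ∫ x in (0 : ℝ)..1, ((x ^ (2 * α) : ℝ) : ℂ) := by
      simp [expMoment]
    rw [h3, intervalIntegral.integral_ofReal, integral_rpow (Or.inl (by linarith)),
      Real.one_rpow, Real.zero_rpow (by linarith), sub_zero, one_div]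
  rw [hm, ← Complex.ofReal_mul, add_zero] at hcov
  have h4 : (0 : ℝ) = (σ₁ ^ 2 + σ₂ ^ 2) * (2 * α + 1)⁻¹ := by exact_mod_cast hcov
  have h5 : 0 < (2 * α + 1)⁻¹ := inv_pos.mpr (by linarith)
  nlinarith [mul_pos hσ h5]

end FunctionalLimit

/-! ### Construction of the Gaussian analytic function -/

section Gram

open scoped RealInnerProductSpace

/-- The Gram matrix of a sequence of vectors factors as `a aᵀ` with `a` lower triangular. -/
theorem exists_lowerTriangular_inner_eq {E : Type*} [NormedAddCommGroup E]
    [InnerProductSpace ℝ E] (f : ℕ → E) :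
    ∃ a : ℕ → ℕ → ℝ, (∀ k i, k < i → a k i = 0) ∧ ∀ N k l, k < N → l < N →
      ⟪f k, f l⟫ = ∑ i ∈ Finset.range N, a k i * a l i := by
  set e := InnerProductSpace.gramSchmidt ℝ f with he
  set c : ℕ → ℕ → ℝ := fun k i => if i < k then ⟪e i, f k⟫ / ‖e i‖ ^ 2 else
    if i = k then 1 else 0 with hc
  have hf : ∀ N k, k < N → f k = ∑ i ∈ Finset.range N, c k i • e i := by
    intro N k hk
    have h1 := InnerProductSpace.gramSchmidt_def'' ℝ f k
    have h2 : ∑ i ∈ Finset.range N, c k i • e i = ∑ i ∈ Finset.range (k + 1), c k i • e i := by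
      refine (Finset.sum_subset (Finset.range_subset_range.mpr (Nat.succ_le_of_lt hk))
        fun i _ hi => ?_).symm
      have hki : k < i := by rw [Finset.mem_range] at hi; omega
      simp [hc, hki.not_gt, hki.ne']
    rw [h2, Finset.sum_range_succ, h1, add_comm]
    congr 1
    · rw [Nat.Iio_eq_range]
      refine Finset.sum_congr rfl fun i hi => ?_
      simp [hc, Finset.mem_range.mp hi, he]
    · simp [hc, he]
  refine ⟨fun k i => c k i * ‖e i‖, fun k i hki => by simp [hc, hki.not_gt, hki.ne'],
    fun N k l hk hl => ?_⟩
  rw [hf N k hk, hf N l hl, sum_inner]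
  refine Finset.sum_congr rfl fun i hi => ?_
  rw [inner_sum, Finset.sum_eq_single i]
  · rw [real_inner_smul_left, real_inner_smul_right, real_inner_self_eq_norm_sq]
    ring
  · intro j _ hj
    rw [real_inner_smul_left, real_inner_smul_right,
      InnerProductSpace.gramSchmidt_orthogonal ℝ f hj.symm]
    ring
  · exact fun h => absurd hi h

end Gram

/-- An almost sure limit of centred Gaussian variables, dominated in `L²`, is Gaussian. -/
theorem hasGaussianLaw_of_tendsto_ae {Ω : Type*} [MeasurableSpace Ω] {P : Measure Ω}
    [IsProbabilityMeasure P] {X : ℕ → Ω → ℝ} {Y : Ω → ℝ} {B : Ω → ℝ}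
    (hX : ∀ n, HasGaussianLaw (X n) P) (hmean : ∀ n, ∫ ω, X n ω ∂P = 0)
    (hB : Integrable B P) (hXB : ∀ n, ∀ᵐ ω ∂P, X n ω ^ 2 ≤ B ω)
    (hlim : ∀ᵐ ω ∂P, Tendsto (fun n => X n ω) atTop (𝓝 (Y ω))) : HasGaussianLaw Y P := by
  have hY : AEMeasurable Y P := aemeasurable_of_tendsto_metrizable_ae atTop
    (fun n => (hX n).aemeasurable) hlim
  have hv : Tendsto (fun n => ∫ ω, X n ω ^ 2 ∂P) atTop (𝓝 (∫ ω, Y ω ^ 2 ∂P)) := by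
    refine tendsto_integral_of_dominated_convergence B
      (fun n => ((hX n).aemeasurable.pow_const 2).aestronglyMeasurable) hB (fun n => ?_) ?_
    · filter_upwards [hXB n] with ω h
      rwa [Real.norm_of_nonneg (sq_nonneg _)]
    · filter_upwards [hlim] with ω h
      exact h.pow 2
  have : IsProbabilityMeasure (P.map Y) := Measure.isProbabilityMeasure_map hY
  have hlaw : P.map Y = gaussianReal 0 (∫ ω, Y ω ^ 2 ∂P).toNNReal := by
    refine Measure.ext_of_charFun (funext fun t => ?_)
    have h1 : Tendsto (fun n => charFun (P.map (X n)) t) atTop (𝓝 (charFun (P.map Y) t)) := by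
      simp_rw [charFun_apply_real]
      rw [integral_map hY (by fun_prop)]
      have e : ∀ n, ∫ x, Complex.exp (t * x * Complex.I) ∂(P.map (X n)) =
          ∫ ω, Complex.exp (t * X n ω * Complex.I) ∂P := fun n =>
        integral_map (hX n).aemeasurable (by fun_prop)
      simp_rw [e]
      refine tendsto_integral_of_dominated_convergence (fun _ => 1) (fun n => ?_)
        (integrable_const _) (fun n => ae_of_all _ fun ω => ?_) ?_
      · exact (by fun_prop : Measurable fun x : ℝ =>
          Complex.exp (t * x * Complex.I)).comp_aemeasurable
          (hX n).aemeasurable |>.aestronglyMeasurable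
      · rw [← Complex.ofReal_mul, Complex.norm_exp_ofReal_mul_I]
      · filter_upwards [hlim] with ω h
        exact ((by fun_prop : Continuous fun x : ℝ =>
          Complex.exp (t * x * Complex.I)).tendsto _).comp h
    refine tendsto_nhds_unique h1 ?_
    have e : ∀ n, charFun (P.map (X n)) t =
        Complex.exp (-(((∫ ω, X n ω ^ 2 ∂P : ℝ) : ℂ) * t ^ 2 / 2)) := by
      intro n
      have hvar := variance_of_integral_eq_zero (hX n).aemeasurable (hmean n)
      have hnn : 0 ≤ ∫ ω, X n ω ^ 2 ∂P := integral_nonneg fun _ => sq_nonneg _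
      rw [(hX n).map_eq_gaussianReal, charFun_gaussianReal, hmean n, hvar,
        Real.coe_toNNReal _ hnn]
      simp
    simp_rw [e]
    rw [charFun_gaussianReal, Real.coe_toNNReal _ (integral_nonneg fun _ => sq_nonneg _)]
    have hc : Continuous fun v : ℝ => Complex.exp (-((v : ℂ) * t ^ 2 / 2)) := by fun_prop
    have := (hc.tendsto _).comp hv
    simpa [Function.comp_def] using this
  exact ⟨by rw [hlaw]; infer_instance⟩

theorem EntireFunction.exists_tendsto_sum_monomial {a : ℕ → ℂ}
    (ha : ∀ R : ℝ, Summable fun k => ‖a k‖ * R ^ k) :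
    ∃ f : EntireFunction,
      Tendsto (fun N => ∑ k ∈ Finset.range N, monomial k (a k)) atTop (𝓝 f) := by
  have hbound : ∀ R : ℝ, ∀ k z, z ∈ Metric.closedBall (0 : ℂ) R →
      ‖a k * z ^ k‖ ≤ ‖a k‖ * R ^ k := by
    intro R k z hz
    rw [norm_mul, norm_pow]
    gcongr
    simpa using hz
  have hdiff : Differentiable ℂ fun z => ∑' k, a k * z ^ k := by
    intro z
    have := Complex.differentiableOn_tsum_of_summable_norm (u := fun k => ‖a k‖ * (‖z‖ + 1) ^ k)
      (F := fun k z => a k * z ^ k) (U := Metric.ball 0 (‖z‖ + 1)) (ha _)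
      (fun k => by fun_prop) Metric.isOpen_ball
      fun k w hw => hbound _ k w (Metric.ball_subset_closedBall hw)
    exact this.differentiableAt (Metric.isOpen_ball.mem_nhds (by simp))
  refine ⟨⟨⟨_, hdiff.continuous⟩, hdiff⟩, ?_⟩
  rw [tendsto_iff_closedBall]
  intro R
  have := tendstoUniformlyOn_tsum_nat (ha R) (hbound R)
  refine this.congr (Eventually.of_forall fun N z _ => ?_)
  simp only [sum_apply, monomial_apply]

section Coefficients

/-- Pseudo-covariances of the coefficients. -/
theorem IsCoefficientSequence.integral_mul {Ω : Type*} [MeasurableSpace Ω] {P : Measure Ω}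
    {ξ : ℕ → Ω → ℂ} {σ₁ σ₂ : ℝ} (h : IsCoefficientSequence P ξ σ₁ σ₂) (i j : ℕ) :
    ∫ ω, ξ i ω * ξ j ω ∂P = if i = j then ((σ₁ ^ 2 - σ₂ ^ 2 : ℝ) : ℂ) else 0 := by
  have hmean : ∀ i, ∫ ω, ξ i ω ∂P = 0 := fun i => by
    rw [(h.identDistrib i).integral_eq, h.integral_eq_zero]
  split_ifs with hij
  · subst hij
    have h1 := ((h.identDistrib i).comp (u := fun z : ℂ => z * z) (by fun_prop)).integral_eq
    simp only [Function.comp_apply] at h1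
    rw [h1]
    have hre : MemLp (fun ω => (ξ 0 ω).re) 2 P := h.memLp.re
    have him : MemLp (fun ω => (ξ 0 ω).im) 2 P := h.memLp.im
    have e : ∀ ω, ξ 0 ω * ξ 0 ω = (((ξ 0 ω).re ^ 2 - (ξ 0 ω).im ^ 2 : ℝ) : ℂ) +
        ((2 * ((ξ 0 ω).re * (ξ 0 ω).im) : ℝ) : ℂ) * Complex.I := by
      intro ω
      apply Complex.ext <;> simp [sq, two_mul, mul_comm]
    simp_rw [e]
    have i1 : Integrable (fun ω => (((ξ 0 ω).re ^ 2 - (ξ 0 ω).im ^ 2 : ℝ) : ℂ)) P :=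
      (hre.integrable_sq.sub him.integrable_sq).ofReal
    have i2 : Integrable (fun ω =>
        ((2 * ((ξ 0 ω).re * (ξ 0 ω).im) : ℝ) : ℂ) * Complex.I) P :=
      (((hre.integrable_mul him).const_mul 2).ofReal).mul_const _
    rw [integral_add i1 i2, integral_mul_const, integral_complex_ofReal, integral_complex_ofReal,
      integral_sub hre.integrable_sq him.integrable_sq, integral_const_mul, h.integral_re_sq,
      h.integral_im_sq, h.integral_re_mul_im]
    simp
  · rw [(h.iIndepFun.indepFun hij).integral_fun_mul_eq_mul_integral
      (h.aemeasurable i).aestronglyMeasurable (h.aemeasurable j).aestronglyMeasurable,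
      hmean, zero_mul]

theorem IsCoefficientSequence.integral_mul_conj {Ω : Type*} [MeasurableSpace Ω] {P : Measure Ω}
    {ξ : ℕ → Ω → ℂ} {σ₁ σ₂ : ℝ} (h : IsCoefficientSequence P ξ σ₁ σ₂) (i j : ℕ) :
    ∫ ω, ξ i ω * conj (ξ j ω) ∂P = if i = j then ((σ₁ ^ 2 + σ₂ ^ 2 : ℝ) : ℂ) else 0 := by
  have hmean : ∀ i, ∫ ω, ξ i ω ∂P = 0 := fun i => by
    rw [(h.identDistrib i).integral_eq, h.integral_eq_zero]
  split_ifs with hij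
  · subst hij
    have h1 := ((h.identDistrib i).comp (u := fun z : ℂ => z * conj z) (by fun_prop)).integral_eq
    simp only [Function.comp_apply] at h1
    rw [h1]
    have hre : MemLp (fun ω => (ξ 0 ω).re) 2 P := h.memLp.re
    have him : MemLp (fun ω => (ξ 0 ω).im) 2 P := h.memLp.im
    have e : ∀ ω, ξ 0 ω * conj (ξ 0 ω) = (((ξ 0 ω).re ^ 2 + (ξ 0 ω).im ^ 2 : ℝ) : ℂ) := by
      intro ω
      rw [Complex.mul_conj, Complex.normSq_apply, sq, sq]
    simp_rw [e]
    rw [integral_complex_ofReal, integral_add hre.integrable_sq him.integrable_sq,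
      h.integral_re_sq, h.integral_im_sq]
  · have hind := (h.iIndepFun.indepFun hij).comp (φ := id) (ψ := fun z : ℂ => conj z)
      measurable_id (by fun_prop)
    have := hind.integral_fun_mul_eq_mul_integral (h.aemeasurable i).aestronglyMeasurable
      (Complex.continuous_conj.measurable.comp_aemeasurable (h.aemeasurable j)).aestronglyMeasurable
    simp only [Function.comp_apply, id] at this
    rw [this, hmean, zero_mul]

theorem exists_gaussian_isCoefficientSequence (σ₁ σ₂ : ℝ) :
    ∃ (Ω : Type) (_ : MeasurableSpace Ω) (P : Measure Ω) (_ : IsProbabilityMeasure P)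
      (ζ : ℕ → Ω → ℂ), IsCoefficientSequence P ζ σ₁ σ₂ ∧ ∀ i, HasGaussianLaw (ζ i) P := by
  obtain ⟨v₁, hv₁⟩ : ∃ v : NNReal, (v : ℝ) = σ₁ ^ 2 := ⟨⟨σ₁ ^ 2, sq_nonneg _⟩, rfl⟩
  obtain ⟨v₂, hv₂⟩ : ∃ v : NNReal, (v : ℝ) = σ₂ ^ 2 := ⟨⟨σ₂ ^ 2, sq_nonneg _⟩, rfl⟩
  let m : Measure (ℝ × ℝ) := (gaussianReal 0 v₁).prod (gaussianReal 0 v₂)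
  let L : ℝ × ℝ →L[ℝ] ℂ := (Complex.equivRealProdCLM.symm : ℝ × ℝ →L[ℝ] ℂ)
  obtain ⟨Ω, mΩ, P, ζ, hmeas, hlaw, hind, hP⟩ := exists_iid ℕ (m.map L)
  have hg : ∀ i, HasGaussianLaw (ζ i) P := fun i => (hlaw i).hasGaussianLaw
  have hint : ∀ F : ℂ → ℝ, Continuous F →
      ∫ ω, F (ζ 0 ω) ∂P = ∫ p, F (L p) ∂m := by
    intro F hF
    have := (hlaw 0).integral_comp (f := F) hF.aestronglyMeasurable
    simp only [Function.comp_def] at this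
    rw [this, integral_map L.continuous.aemeasurable hF.aestronglyMeasurable]
  have hLre : ∀ p, (L p).re = p.1 := fun p => by simp [L]
  have hLim : ∀ p, (L p).im = p.2 := fun p => by simp [L]
  have hvar : ∀ v : NNReal, ∫ x, x ^ 2 ∂(gaussianReal 0 v) = v := by
    intro v
    have h1 := variance_of_integral_eq_zero (μ := gaussianReal 0 v) (X := id) aemeasurable_id
      (by simp)
    simpa using h1.symm
  have hre : ∫ ω, (ζ 0 ω).re ∂P = 0 := by
    rw [hint _ Complex.continuous_re]
    simp_rw [hLre]
    have := integral_prod_mul (μ := gaussianReal 0 v₁) (ν := gaussianReal 0 v₂)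
      (fun x : ℝ => x) (fun _ : ℝ => (1 : ℝ))
    simpa using this
  have him : ∫ ω, (ζ 0 ω).im ∂P = 0 := by
    rw [hint _ Complex.continuous_im]
    simp_rw [hLim]
    have := integral_prod_mul (μ := gaussianReal 0 v₁) (ν := gaussianReal 0 v₂)
      (fun _ : ℝ => (1 : ℝ)) (fun x : ℝ => x)
    simpa using this
  refine ⟨Ω, mΩ, P, hP, ζ, ⟨hind, fun k => ?_, (hg 0).memLp_two, ?_, ?_, ?_, ?_⟩, hg⟩
  · exact ⟨(hlaw k).aemeasurable, (hlaw 0).aemeasurable, by rw [(hlaw k).map_eq, (hlaw 0).map_eq]⟩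
  · have h1 := integral_re_add_im (𝕜 := ℂ) ((hg 0).integrable)
    simp only [RCLike.re_eq_complex_re, RCLike.im_eq_complex_im] at h1
    rw [← h1, hre, him]
    simp
  · rw [hint (fun z => z.re ^ 2) (by fun_prop)]
    simp_rw [hLre]
    have := integral_prod_mul (μ := gaussianReal 0 v₁) (ν := gaussianReal 0 v₂)
      (fun x : ℝ => x ^ 2) (fun _ : ℝ => (1 : ℝ))
    simp only [mul_one, hvar] at this
    simpa [m, hv₁] using this
  · rw [hint (fun z => z.im ^ 2) (by fun_prop)]
    simp_rw [hLim]
    have := integral_prod_mul (μ := gaussianReal 0 v₁) (ν := gaussianReal 0 v₂)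
      (fun _ : ℝ => (1 : ℝ)) (fun x : ℝ => x ^ 2)
    simp only [one_mul, hvar] at this
    simpa [m, hv₂] using this
  · rw [hint (fun z => z.re * z.im) (by fun_prop)]
    simp_rw [hLre, hLim]
    have := integral_prod_mul (μ := gaussianReal 0 v₁) (ν := gaussianReal 0 v₂)
      (fun x : ℝ => x) (fun x : ℝ => x)
    simpa using this

/-- Jointly Gaussian complex variables `g k` whose covariances and pseudo-covariances are
multiples of a given real Gram matrix. -/
theorem exists_gaussian_sequence_of_gram {E : Type*} [NormedAddCommGroup E]
    [InnerProductSpace ℝ E] (f : ℕ → E) (σ₁ σ₂ : ℝ) :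
    ∃ (Ω : Type) (_ : MeasurableSpace Ω) (P : Measure Ω) (_ : IsProbabilityMeasure P)
      (g : ℕ → Ω → ℂ), (∀ N, HasGaussianLaw (fun ω (k : Fin N) => g k ω) P) ∧
      (∀ k, ∫ ω, g k ω ∂P = 0) ∧
      (∀ k l, ∫ ω, g k ω * g l ω ∂P = ((σ₁ ^ 2 - σ₂ ^ 2 : ℝ) : ℂ) * (inner ℝ (f k) (f l) : ℝ)) ∧
      ∀ k l, ∫ ω, g k ω * conj (g l ω) ∂P =
        ((σ₁ ^ 2 + σ₂ ^ 2 : ℝ) : ℂ) * (inner ℝ (f k) (f l) : ℝ) := by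
  obtain ⟨a, ha0, ha⟩ := exists_lowerTriangular_inner_eq f
  obtain ⟨Ω, mΩ, P, hP, ζ, hζ, hg⟩ := exists_gaussian_isCoefficientSequence σ₁ σ₂
  have hsum : ∀ N k ω, k < N → ∑ i ∈ Finset.range (k + 1), (a k i : ℂ) * ζ i ω =
      ∑ i ∈ Finset.range N, (a k i : ℂ) * ζ i ω := by
    intro N k ω hk
    refine Finset.sum_subset (Finset.range_subset_range.mpr (Nat.succ_le_of_lt hk)) fun i _ hi => ?_
    have hki : k < i := by rw [Finset.mem_range] at hi; omega
    simp [ha0 k i hki]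
  refine ⟨Ω, mΩ, P, hP, fun k ω => ∑ i ∈ Finset.range (k + 1), (a k i : ℂ) * ζ i ω,
    fun N => ?_, fun k => ?_, fun k l => ?_, fun k l => ?_⟩
  · have hjoint : HasGaussianLaw (fun ω (i : Fin N) => ζ i ω) P :=
      iIndepFun.hasGaussianLaw (fun i : Fin N => hg i) (hζ.iIndepFun.precomp Fin.val_injective)
    let L : (Fin N → ℂ) →L[ℝ] (Fin N → ℂ) := ContinuousLinearMap.pi fun k =>
      ∑ i : Fin N, a k i • ContinuousLinearMap.proj i
    have e : (fun ω (k : Fin N) => ∑ i ∈ Finset.range (k + 1), (a k i : ℂ) * ζ i ω) =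
        fun ω => L fun i => ζ i ω := by
      funext ω k
      rw [hsum N k ω k.2, Finset.sum_range]
      simp [L]
    rw [e]
    exact hjoint.map_fun L
  · rw [integral_finsetSum _ fun i _ => ((hg i).integrable).const_mul _]
    simp [integral_const_mul, (hζ.identDistrib _).integral_eq, hζ.integral_eq_zero]
  · set N := max k l + 1 with hN
    simp_rw [hsum N k _ (by omega), hsum N l _ (by omega), Finset.sum_mul_sum]
    have hint : ∀ i j, Integrable (fun ω => (a k i : ℂ) * ζ i ω * ((a l j : ℂ) * ζ j ω)) P :=
      fun i j => ((hζ.memLp_apply i).const_mul _).integrable_mul ((hζ.memLp_apply j).const_mul _)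
    rw [integral_finsetSum _ fun i _ => integrable_finsetSum _ fun j _ => hint i j,
      ha N k l (by omega) (by omega), Complex.ofReal_sum, Finset.mul_sum]
    refine Finset.sum_congr rfl fun i hi => ?_
    rw [integral_finsetSum _ fun j _ => hint i j]
    have e : ∀ j, ∫ ω, (a k i : ℂ) * ζ i ω * ((a l j : ℂ) * ζ j ω) ∂P =
        if i = j then ((σ₁ ^ 2 - σ₂ ^ 2 : ℝ) : ℂ) * (a k i * a l j : ℝ) else 0 := by
      intro j
      have e1 : ∀ ω, (a k i : ℂ) * ζ i ω * ((a l j : ℂ) * ζ j ω) =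
          (a k i * a l j : ℝ) * (ζ i ω * ζ j ω) := fun ω => by push_cast; ring
      simp_rw [e1]
      rw [integral_const_mul, hζ.integral_mul]
      split_ifs
      · ring
      · simp
    simp_rw [e]
    rw [Finset.sum_ite_eq, if_pos hi]
  · set N := max k l + 1 with hN
    simp_rw [hsum N k _ (by omega), hsum N l _ (by omega), map_sum, Finset.sum_mul_sum]
    have hint : ∀ i j, Integrable (fun ω => (a k i : ℂ) * ζ i ω * conj ((a l j : ℂ) * ζ j ω)) P :=
      fun i j => ((hζ.memLp_apply i).const_mul _).integrable_mul
        ((hζ.memLp_apply j).const_mul _).star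
    rw [integral_finsetSum _ fun i _ => integrable_finsetSum _ fun j _ => hint i j,
      ha N k l (by omega) (by omega), Complex.ofReal_sum, Finset.mul_sum]
    refine Finset.sum_congr rfl fun i hi => ?_
    rw [integral_finsetSum _ fun j _ => hint i j]
    have e : ∀ j, ∫ ω, (a k i : ℂ) * ζ i ω * conj ((a l j : ℂ) * ζ j ω) ∂P =
        if i = j then ((σ₁ ^ 2 + σ₂ ^ 2 : ℝ) : ℂ) * (a k i * a l j : ℝ) else 0 := by
      intro j
      have e1 : ∀ ω, (a k i : ℂ) * ζ i ω * conj ((a l j : ℂ) * ζ j ω) =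
          (a k i * a l j : ℝ) * (ζ i ω * conj (ζ j ω)) := fun ω => by
        rw [map_mul, Complex.conj_ofReal]; push_cast; ring
      simp_rw [e1]
      rw [integral_const_mul, hζ.integral_mul_conj]
      split_ifs
      · ring
      · simp
    simp_rw [e]
    rw [Finset.sum_ite_eq, if_pos hi]

end Coefficients

section Moments

variable {β : ℝ}

/-- The Gram matrix of the functions `x ^ k / k!` in `L²((0, 1), x ^ β dx)`, that is, the
coefficients of the power series of `expMoment β (u + w)` in `u` and `w`. -/
noncomputable def expMomentCoeff (β : ℝ) (k l : ℕ) : ℝ :=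
  ∫ x in (0 : ℝ)..1, x ^ β * (x ^ k / k.factorial * (x ^ l / l.factorial))

theorem intervalIntegrable_rpow_mul_real (hβ : -1 < β) {f : ℝ → ℝ} (hf : Continuous f) :
    IntervalIntegrable (fun x : ℝ => x ^ β * f x) volume 0 1 := by
  have h : IntervalIntegrable (fun x : ℝ => x ^ β) volume 0 1 :=
    intervalIntegral.intervalIntegrable_rpow' hβ
  exact h.mul_continuousOn hf.continuousOn

/-- The functions are `x ^ (β / 2) * x ^ k / k!`. -/
theorem exists_inner_eq_expMomentCoeff (hβ : -1 < β) :
    ∃ f : ℕ → Lp ℝ 2 ((volume : Measure ℝ).restrict (Ioc 0 1)), ∀ k l,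
      inner ℝ (f k) (f l) = expMomentCoeff β k l := by
  set φ : ℕ → ℝ → ℝ := fun k x => x ^ (β / 2) * (x ^ k / k.factorial) with hφ
  have hmul : ∀ k l, ∀ x ∈ Ioc (0 : ℝ) 1, φ k x * φ l x =
      x ^ β * (x ^ k / k.factorial * (x ^ l / l.factorial)) := by
    intro k l x hx
    have : x ^ β = x ^ (β / 2) * x ^ (β / 2) := by
      rw [← Real.rpow_add hx.1, add_halves]
    rw [this]
    ring
  have hmem : ∀ k, MemLp (φ k) 2 ((volume : Measure ℝ).restrict (Ioc 0 1)) := by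
    intro k
    have hm : Measurable (φ k) := by fun_prop
    rw [memLp_two_iff_integrable_sq hm.aestronglyMeasurable]
    have h1 := (intervalIntegrable_iff_integrableOn_Ioc_of_le zero_le_one).mp
      (intervalIntegrable_rpow_mul_real hβ (f := fun x : ℝ =>
        x ^ k / k.factorial * (x ^ k / k.factorial)) (by fun_prop))
    refine h1.congr_fun (fun x hx => ?_) measurableSet_Ioc
    rw [sq, hmul k k x hx]
  refine ⟨fun k => (hmem k).toLp, fun k l => ?_⟩
  rw [L2.inner_def, expMomentCoeff, intervalIntegral.integral_of_le zero_le_one]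
  refine integral_congr_ae ?_
  filter_upwards [(hmem k).coeFn_toLp, (hmem l).coeFn_toLp,
    ae_restrict_mem measurableSet_Ioc] with x h1 h2 hx
  rw [h1, h2, ← hmul k l x hx]
  simp [mul_comm]

theorem expMomentCoeff_self_le (hβ : -1 < β) (k : ℕ) :
    expMomentCoeff β k k ≤ (β + 1)⁻¹ / (k.factorial : ℝ) ^ 2 := by
  have h1 : (∫ x in (0 : ℝ)..1, x ^ β) = (β + 1)⁻¹ := by
    rw [integral_rpow (Or.inl hβ), Real.one_rpow, Real.zero_rpow (by linarith), sub_zero, one_div]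
  rw [← h1, ← intervalIntegral.integral_div]
  refine intervalIntegral.integral_mono_on zero_le_one
    (intervalIntegrable_rpow_mul_real hβ (by fun_prop))
    ((intervalIntegral.intervalIntegrable_rpow' hβ).div_const _) fun x hx => ?_
  have h2 : x ^ k ≤ 1 := pow_le_one₀ hx.1 hx.2
  have h3 : 0 ≤ x ^ k := pow_nonneg hx.1 k
  have h4 : x ^ k / k.factorial * (x ^ k / k.factorial) ≤ 1 / (k.factorial : ℝ) ^ 2 := by
    rw [div_mul_div_comm, ← sq (k.factorial : ℝ)]
    gcongr
    exact mul_le_one₀ h2 h3 h2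
  calc _ ≤ x ^ β * (1 / (k.factorial : ℝ) ^ 2) := by
        gcongr
        exact Real.rpow_nonneg hx.1 _
    _ = _ := by ring

theorem tendsto_sum_expMomentCoeff (hβ : -1 < β) (u w : ℂ) :
    Tendsto (fun N => ∑ k ∈ Finset.range N, ∑ l ∈ Finset.range N,
      u ^ k * w ^ l * expMomentCoeff β k l) atTop (𝓝 (expMoment β (u + w))) := by
  set E : ℕ → ℂ → ℂ := fun N z => ∑ k ∈ Finset.range N, z ^ k / k.factorial with hE
  have hE1 : ∀ z, Tendsto (fun N => E N z) atTop (𝓝 (Complex.exp z)) := by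
    intro z
    have := NormedSpace.expSeries_div_hasSum_exp (𝔸 := ℂ) z
    rw [← Complex.exp_eq_exp_ℂ] at this
    exact this.tendsto_sum_nat
  have hE2 : ∀ N z, ‖E N z‖ ≤ Real.exp ‖z‖ := by
    intro N z
    refine (norm_sum_le _ _).trans ?_
    simp only [norm_div, norm_pow, Complex.norm_natCast]
    exact Real.sum_le_exp_of_nonneg (norm_nonneg z) N
  have hE3 : ∀ N z, ∀ x ∈ Ioc (0 : ℝ) 1, ‖E N (x * z)‖ ≤ Real.exp ‖z‖ := by
    intro N z x hx
    refine (hE2 N _).trans (Real.exp_le_exp.mpr ?_)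
    rw [norm_mul, Complex.norm_real, Real.norm_of_nonneg hx.1.le]
    exact mul_le_of_le_one_left (norm_nonneg z) hx.2
  have hsum : ∀ N, ∑ k ∈ Finset.range N, ∑ l ∈ Finset.range N,
      u ^ k * w ^ l * expMomentCoeff β k l =
      ∫ x in (0 : ℝ)..1, ((x ^ β : ℝ) : ℂ) * (E N (x * u) * E N (x * w)) := by
    intro N
    simp only [hE, Finset.sum_mul_sum]
    simp only [Finset.mul_sum]
    have hint : ∀ k l : ℕ, IntervalIntegrable (fun x : ℝ => ((x ^ β : ℝ) : ℂ) *
        ((x * u) ^ k / k.factorial * ((x * w) ^ l / l.factorial))) volume 0 1 := fun k l =>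
      intervalIntegrable_rpow_mul hβ (by fun_prop)
    rw [intervalIntegral.integral_finsetSum fun k _ => ?_]
    · refine Finset.sum_congr rfl fun k _ => ?_
      rw [intervalIntegral.integral_finsetSum fun l _ => hint k l]
      refine Finset.sum_congr rfl fun l _ => ?_
      rw [expMomentCoeff, ← intervalIntegral.integral_ofReal,
        ← intervalIntegral.integral_const_mul]
      congr 1
      funext x
      push_cast
      ring
    · have := IntervalIntegrable.sum (Finset.range N) fun l _ => hint k l
      simpa only [Finset.sum_fn] using this
  simp_rw [hsum]
  refine intervalIntegral.tendsto_integral_filter_of_dominated_convergence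
    (fun x => x ^ β * (Real.exp ‖u‖ * Real.exp ‖w‖)) ?_ ?_ ?_ ?_
  · refine Eventually.of_forall fun N => Measurable.aestronglyMeasurable ?_
    simp only [hE]
    fun_prop
  · refine Eventually.of_forall fun N => ae_of_all _ fun x hx => ?_
    rw [uIoc_of_le zero_le_one] at hx
    rw [norm_mul, Complex.norm_real, Real.norm_of_nonneg (Real.rpow_nonneg hx.1.le _), norm_mul]
    gcongr
    · exact Real.rpow_nonneg hx.1.le _
    · exact hE3 N u x hx
    · exact hE3 N w x hx
  · exact intervalIntegrable_rpow_mul_real hβ continuous_const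
  · refine ae_of_all _ fun x _ => ?_
    have := (((hE1 (x * u)).mul (hE1 (x * w))).const_mul ((x ^ β : ℝ) : ℂ))
    rwa [← Complex.exp_add, ← mul_add] at this

end Moments

section Existence

/-- Beppo Levi for series of nonnegative integrable functions. -/
theorem ae_summable_and_integrable_tsum {Ω : Type*} [MeasurableSpace Ω] {P : Measure Ω}
    {F : ℕ → Ω → ℝ} (hF : ∀ k, Integrable (F k) P) (hF0 : ∀ k ω, 0 ≤ F k ω)
    (hsum : Summable fun k => ∫ ω, F k ω ∂P) :
    (∀ᵐ ω ∂P, Summable fun k => F k ω) ∧ Integrable (fun ω => ∑' k, F k ω) P := by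
  have hmeas : ∀ k, AEMeasurable (fun ω => ENNReal.ofReal (F k ω)) P := fun k =>
    (hF k).aemeasurable.ennreal_ofReal
  have hfin : ∫⁻ ω, ∑' k, ENNReal.ofReal (F k ω) ∂P ≠ ∞ := by
    rw [lintegral_tsum hmeas]
    simp_rw [← fun k => ofReal_integral_eq_lintegral_ofReal (hF k) (ae_of_all _ (hF0 k))]
    exact hsum.tsum_ofReal_ne_top
  have hs : ∀ᵐ ω ∂P, Summable fun k => F k ω := by
    filter_upwards [ae_lt_top' (AEMeasurable.tsum hmeas) hfin] with ω hω
    have h1 := ENNReal.summable_toReal hω.ne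
    simpa only [ENNReal.toReal_ofReal (hF0 _ _)] using h1
  refine ⟨hs, (integrable_toReal_of_lintegral_ne_top
    (AEMeasurable.tsum hmeas) hfin).congr ?_⟩
  filter_upwards [hs] with ω hω
  rw [← ENNReal.ofReal_tsum_of_nonneg (fun k => hF0 k ω) hω,
    ENNReal.toReal_ofReal (tsum_nonneg fun k => hF0 k ω)]

/-- The random power series with a Gaussian coefficient sequence of Gram type: existence of the
Gaussian analytic function when the covariance and the pseudo-covariance are multiples of the same
kernel. -/
theorem exists_gaf {α : ℝ} (hα : -1 / 2 < α) (s₁ s₂ : ℝ) :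
    ∃ (Ω : Type) (_ : MeasurableSpace Ω) (P : Measure Ω) (_ : IsProbabilityMeasure P)
      (G : Ω → EntireFunction), Measurable G ∧
      IsGaussianProcess (fun (u : ℂ) ω => (G ω).1 u) P ∧
      (∀ u, ∫ ω, (G ω).1 u ∂P = 0) ∧
      (∀ u w, ∫ ω, (G ω).1 u * conj ((G ω).1 w) ∂P =
        ((s₁ ^ 2 + s₂ ^ 2 : ℝ) : ℂ) * expMoment (2 * α) (u + conj w)) ∧
      ∀ u w, ∫ ω, (G ω).1 u * (G ω).1 w ∂P =
        ((s₁ ^ 2 - s₂ ^ 2 : ℝ) : ℂ) * expMoment (2 * α) (u + w) := by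
  have hβ : -1 < 2 * α := by linarith
  obtain ⟨f, hf⟩ := exists_inner_eq_expMomentCoeff hβ
  obtain ⟨Ω, mΩ, P, hP, g, hg, hmean, hpc, hc⟩ := exists_gaussian_sequence_of_gram f s₁ s₂
  simp only [hf] at hpc hc
  have hgk : ∀ k, HasGaussianLaw (g k) P := fun k => (hg (k + 1)).eval (Fin.last k)
  have hg2 : ∀ k, MemLp (g k) 2 P := fun k => (hgk k).memLp_two
  -- The weight `k!` makes the series of squares integrable and all power series convergent.
  have hsq : ∀ k, Integrable (fun ω => (k.factorial : ℝ) * ‖g k ω‖ ^ 2) P := fun k =>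
    ((hg2 k).norm.integrable_sq).const_mul _
  have hsqE : ∀ k, ∫ ω, (k.factorial : ℝ) * ‖g k ω‖ ^ 2 ∂P ≤
      (s₁ ^ 2 + s₂ ^ 2) * (2 * α + 1)⁻¹ * (1 / k.factorial) := by
    intro k
    have h1 : ∫ ω, ‖g k ω‖ ^ 2 ∂P = (s₁ ^ 2 + s₂ ^ 2) * expMomentCoeff (2 * α) k k := by
      have h2 := hc k k
      have e : ∀ ω, g k ω * conj (g k ω) = ((‖g k ω‖ ^ 2 : ℝ) : ℂ) := fun ω => by
        rw [Complex.mul_conj, Complex.normSq_eq_norm_sq]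
      simp_rw [e] at h2
      rw [integral_complex_ofReal] at h2
      exact_mod_cast h2
    have hk : (0 : ℝ) < k.factorial := by exact_mod_cast k.factorial_pos
    rw [integral_const_mul, h1]
    calc _ ≤ (k.factorial : ℝ) *
          ((s₁ ^ 2 + s₂ ^ 2) * ((2 * α + 1)⁻¹ / (k.factorial : ℝ) ^ 2)) := by
          gcongr
          exact expMomentCoeff_self_le hβ k
      _ = _ := by field_simp
  have hsumE : Summable fun k => ∫ ω, (k.factorial : ℝ) * ‖g k ω‖ ^ 2 ∂P := by
    have h1 : Summable fun k : ℕ =>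
        (s₁ ^ 2 + s₂ ^ 2) * (2 * α + 1)⁻¹ * (1 / (k.factorial : ℝ)) := by
      have := Real.summable_pow_div_factorial 1
      simp only [one_pow] at this
      exact this.mul_left _
    exact Summable.of_nonneg_of_le (fun k => integral_nonneg fun _ => by positivity) hsqE h1
  obtain ⟨hTsum, hTint⟩ := ae_summable_and_integrable_tsum hsq (fun _ _ => by positivity) hsumE
  set T : Ω → ℝ := fun ω => ∑' k, (k.factorial : ℝ) * ‖g k ω‖ ^ 2 with hT
  -- Partial sums are dominated on every disc.
  have hdom : ∀ᵐ ω ∂P, ∀ N (R : ℝ) u, ‖u‖ ≤ R →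
      ‖∑ k ∈ Finset.range N, g k ω * u ^ k‖ ^ 2 ≤ T ω * Real.exp (R ^ 2) := by
    filter_upwards [hTsum] with ω hω N R u hu
    have hR : 0 ≤ R := (norm_nonneg u).trans hu
    have h1 : ‖∑ k ∈ Finset.range N, g k ω * u ^ k‖ ≤ ∑ k ∈ Finset.range N,
        (√(k.factorial : ℝ) * ‖g k ω‖) * (R ^ k / √(k.factorial : ℝ)) := by
      refine (norm_sum_le _ _).trans (Finset.sum_le_sum fun k _ => ?_)
      have hk : 0 < √(k.factorial : ℝ) := Real.sqrt_pos.mpr (by exact_mod_cast k.factorial_pos)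
      rw [norm_mul, norm_pow]
      calc _ ≤ ‖g k ω‖ * R ^ k := by gcongr
        _ = _ := by field_simp
    calc _ ≤ (∑ k ∈ Finset.range N,
          (√(k.factorial : ℝ) * ‖g k ω‖) * (R ^ k / √(k.factorial : ℝ))) ^ 2 := by gcongr
      _ ≤ (∑ k ∈ Finset.range N, (√(k.factorial : ℝ) * ‖g k ω‖) ^ 2) *
          ∑ k ∈ Finset.range N, (R ^ k / √(k.factorial : ℝ)) ^ 2 :=
        Finset.sum_mul_sq_le_sq_mul_sq _ _ _
      _ ≤ T ω * Real.exp (R ^ 2) := by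
        have e1 : ∀ k : ℕ, (√(k.factorial : ℝ) * ‖g k ω‖) ^ 2 = k.factorial * ‖g k ω‖ ^ 2 := by
          intro k
          rw [mul_pow, Real.sq_sqrt (by positivity)]
        have e2 : ∀ k : ℕ, (R ^ k / √(k.factorial : ℝ)) ^ 2 = (R ^ 2) ^ k / k.factorial := by
          intro k
          rw [div_pow, Real.sq_sqrt (by positivity), ← pow_mul, ← pow_mul, mul_comm k]
        simp_rw [e1, e2]
        gcongr
        · exact hω.sum_le_tsum _ fun k _ => by positivity
        · exact Real.sum_le_exp_of_nonneg (sq_nonneg R) N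
  have hconv : ∀ᵐ ω ∂P, ∃ F : EntireFunction, Tendsto (fun N =>
      ∑ k ∈ Finset.range N, EntireFunction.monomial k (g k ω)) atTop (𝓝 F) := by
    filter_upwards [hTsum] with ω hω
    refine EntireFunction.exists_tendsto_sum_monomial fun R => ?_
    have h1 := (hω.add (Real.summable_pow_div_factorial (R ^ 2))).of_norm_bounded
      (f := fun k => ‖g k ω‖ * R ^ k) fun k => ?_
    · exact h1
    have hk : (0 : ℝ) < k.factorial := by exact_mod_cast k.factorial_pos
    rw [Real.norm_eq_abs, abs_mul, abs_norm, ← pow_mul, mul_comm 2 k, pow_mul, ← sq_abs (R ^ k)]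
    set p := ‖g k ω‖
    set q := |R ^ k|
    have h2 : 0 ≤ k.factorial * (p - q / k.factorial) ^ 2 := by positivity
    have h3 : (k.factorial : ℝ) * (p - q / k.factorial) ^ 2 =
        k.factorial * p ^ 2 + q ^ 2 / k.factorial - 2 * (p * q) := by
      field_simp
      ring
    have h4 : 0 ≤ p * q := by positivity
    linarith
  obtain ⟨G, hGm, hG⟩ := measurable_limit_of_tendsto_metrizable_ae (fun N =>
    Finset.aemeasurable_fun_sum (Finset.range N) fun k _ =>
      (EntireFunction.continuous_monomial k).measurable.comp_aemeasurable
        (hgk k).aemeasurable) hconv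
  have hlim : ∀ᵐ ω ∂P, ∀ u, Tendsto (fun N => ∑ k ∈ Finset.range N, g k ω * u ^ k) atTop
      (𝓝 ((G ω).1 u)) := by
    filter_upwards [hG] with ω hω u
    have := ((EntireFunction.continuous_eval u).tendsto _).comp hω
    simpa only [Function.comp_def, EntireFunction.sum_apply,
      EntireFunction.monomial_apply] using this
  have hmeasN : ∀ N u, AEStronglyMeasurable (fun ω => ∑ k ∈ Finset.range N, g k ω * u ^ k) P :=
    fun N u => (Finset.aemeasurable_fun_sum _ fun k _ =>
      (hgk k).aemeasurable.mul_const _).aestronglyMeasurable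
  have hbase : ∀ (Φ : ℂ → ℂ → ℂ), Continuous (Function.uncurry Φ) →
      (∀ x y, ‖Φ x y‖ ≤ ‖x‖ * ‖y‖) → ∀ u w, Tendsto (fun N => ∫ ω, Φ
        (∑ k ∈ Finset.range N, g k ω * u ^ k) (∑ k ∈ Finset.range N, g k ω * w ^ k) ∂P) atTop
        (𝓝 (∫ ω, Φ ((G ω).1 u) ((G ω).1 w) ∂P)) := by
    intro Φ hΦ hΦb u w
    refine tendsto_integral_of_dominated_convergence
      (fun ω => T ω * Real.exp ((max ‖u‖ ‖w‖) ^ 2)) (fun N => ?_) (hTint.mul_const _)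
      (fun N => ?_) ?_
    · exact hΦ.comp_aestronglyMeasurable₂ (hmeasN N u) (hmeasN N w)
    · filter_upwards [hdom] with ω hω
      have h1 := hω N _ u (le_max_left ‖u‖ ‖w‖)
      have h2 := hω N _ w (le_max_right ‖u‖ ‖w‖)
      refine (hΦb _ _).trans ?_
      nlinarith [sq_nonneg (‖∑ k ∈ Finset.range N, g k ω * u ^ k‖ -
        ‖∑ k ∈ Finset.range N, g k ω * w ^ k‖)]
    · filter_upwards [hlim] with ω hω
      exact (hΦ.tendsto ((G ω).1 u, (G ω).1 w)).comp ((hω u).prodMk_nhds (hω w))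
  refine ⟨Ω, mΩ, P, hP, G, hGm, ⟨fun I => ⟨?_⟩⟩, fun u => ?_, fun u w => ?_, fun u w => ?_⟩
  · have hGu : ∀ u, Measurable fun ω => (G ω).1 u := fun u =>
      (EntireFunction.measurable_eval u).comp hGm
    have hGI : Measurable fun ω => I.restrict fun u => (G ω).1 u :=
      measurable_pi_lambda _ fun u => hGu u
    refine isGaussian_of_isGaussian_map fun L => ?_
    rw [Measure.map_map (by fun_prop) hGI]
    refine HasGaussianLaw.isGaussian_map (X := L ∘ fun ω => I.restrict fun u => (G ω).1 u) ?_
    have hL : ∀ N, HasGaussianLaw (fun ω => L fun u : I =>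
        ∑ k ∈ Finset.range N, g k ω * (u : ℂ) ^ k) P := by
      intro N
      let A : (Fin N → ℂ) →L[ℝ] (I → ℂ) := ContinuousLinearMap.pi fun u =>
        ∑ k : Fin N, (ContinuousLinearMap.mul ℝ ℂ ((u : ℂ) ^ (k : ℕ))).comp
          (ContinuousLinearMap.proj k)
      have e : (fun ω => L fun u : I => ∑ k ∈ Finset.range N, g k ω * (u : ℂ) ^ k) =
          fun ω => (L.comp A) fun k : Fin N => g k ω := by
        funext ω
        rw [ContinuousLinearMap.comp_apply]
        congr 1
        funext u
        rw [Finset.sum_range]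
        simp [A, mul_comm]
      rw [e]
      exact (hg N).map_fun (L.comp A)
    obtain ⟨R, hR⟩ : ∃ R : ℝ, ∀ u : I, ‖(u : ℂ)‖ ≤ R :=
      ⟨∑ u ∈ I, ‖u‖, fun u => Finset.single_le_sum (f := fun u : ℂ => ‖u‖)
        (fun _ _ => norm_nonneg _) u.2⟩
    refine hasGaussianLaw_of_tendsto_ae hL (fun N => ?_)
      (hTint.const_mul (‖L‖ ^ 2 * Real.exp (R ^ 2))) (fun N => ?_) ?_
    · have hi : Integrable (fun ω (u : I) => ∑ k ∈ Finset.range N, g k ω * (u : ℂ) ^ k) P :=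
        Integrable.of_eval fun u => integrable_finsetSum _ fun k _ =>
          ((hgk k).integrable).mul_const _
      rw [L.integral_comp_comm hi]
      have : ∫ ω, (fun u : I => ∑ k ∈ Finset.range N, g k ω * (u : ℂ) ^ k) ∂P = 0 := by
        funext u
        rw [eval_integral fun u => hi.eval u, integral_finsetSum _ fun k _ =>
          ((hgk k).integrable).mul_const _]
        simp [integral_mul_const, hmean]
      rw [this, map_zero]
    · filter_upwards [hdom] with ω hω
      have hT0 : 0 ≤ T ω := tsum_nonneg fun k =>
        (by positivity : 0 ≤ (k.factorial : ℝ) * ‖g k ω‖ ^ 2)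
      have h1 := L.le_opNorm fun u : I => ∑ k ∈ Finset.range N, g k ω * (u : ℂ) ^ k
      have h2 : ‖fun u : I => ∑ k ∈ Finset.range N, g k ω * (u : ℂ) ^ k‖ ≤
          √(T ω * Real.exp (R ^ 2)) :=
        (pi_norm_le_iff_of_nonneg (Real.sqrt_nonneg _)).mpr fun u =>
          Real.le_sqrt_of_sq_le (hω N R u (hR u))
      rw [← sq_abs, ← Real.norm_eq_abs]
      calc _ ≤ (‖L‖ * √(T ω * Real.exp (R ^ 2))) ^ 2 := by
            gcongr
            exact h1.trans (by gcongr)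
        _ = _ := by
            rw [mul_pow, Real.sq_sqrt (by positivity)]
            ring
    · filter_upwards [hlim] with ω hω
      exact (L.continuous.tendsto _).comp (tendsto_pi_nhds.mpr fun u => hω u)
  · refine tendsto_nhds_unique (f := fun N => ∫ ω, ∑ k ∈ Finset.range N, g k ω * u ^ k ∂P)
      (l := atTop) ?_ ?_
    · refine tendsto_integral_of_dominated_convergence
        (fun ω => 1 + T ω * Real.exp (‖u‖ ^ 2)) (fun N => hmeasN N u)
        ((integrable_const 1).add (hTint.mul_const _)) (fun N => ?_) ?_
      · filter_upwards [hdom] with ω hω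
        have h1 := hω N _ u le_rfl
        nlinarith [sq_nonneg (‖∑ k ∈ Finset.range N, g k ω * u ^ k‖ - 1)]
      · filter_upwards [hlim] with ω hω
        exact hω u
    · refine tendsto_const_nhds.congr fun N => ?_
      rw [integral_finsetSum _ fun k _ => ((hgk k).integrable).mul_const _]
      simp [integral_mul_const, hmean]
  · refine tendsto_nhds_unique (hbase (fun x y => x * conj y) (by fun_prop) (by simp) u w) ?_
    refine ((tendsto_sum_expMomentCoeff hβ u (conj w)).const_mul _).congr fun N => ?_
    have hi : ∀ k l, Integrable (fun ω => g k ω * u ^ k * (conj (g l ω) * conj w ^ l)) P :=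
      fun k l => ((hg2 k).mul_const _).integrable_mul ((hg2 l).star.mul_const _)
    simp_rw [map_sum, map_mul, map_pow, Finset.sum_mul_sum]
    rw [integral_finsetSum _ fun k _ => integrable_finsetSum _ fun l _ => hi k l, Finset.mul_sum]
    refine Finset.sum_congr rfl fun k _ => ?_
    rw [integral_finsetSum _ fun l _ => hi k l, Finset.mul_sum]
    refine Finset.sum_congr rfl fun l _ => ?_
    have e : ∀ ω, g k ω * u ^ k * (conj (g l ω) * conj w ^ l) =
        u ^ k * conj w ^ l * (g k ω * conj (g l ω)) := fun ω => by ring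
    simp_rw [e]
    rw [integral_const_mul, hc]
    ring
  · refine tendsto_nhds_unique (hbase (fun x y => x * y) (by fun_prop) (by simp) u w) ?_
    refine ((tendsto_sum_expMomentCoeff hβ u w).const_mul _).congr fun N => ?_
    have hi : ∀ k l, Integrable (fun ω => g k ω * u ^ k * (g l ω * w ^ l)) P :=
      fun k l => ((hg2 k).mul_const _).integrable_mul ((hg2 l).mul_const _)
    simp_rw [Finset.sum_mul_sum]
    rw [integral_finsetSum _ fun k _ => integrable_finsetSum _ fun l _ => hi k l, Finset.mul_sum]
    refine Finset.sum_congr rfl fun k _ => ?_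
    rw [integral_finsetSum _ fun l _ => hi k l, Finset.mul_sum]
    refine Finset.sum_congr rfl fun l _ => ?_
    have e : ∀ ω, g k ω * u ^ k * (g l ω * w ^ l) =
        u ^ k * w ^ l * (g k ω * g l ω) := fun ω => by ring
    simp_rw [e]
    rw [integral_const_mul, hpc]
    ring

/-- Existence of the Gaussian analytic function. -/
theorem exists_isLiquidGAF {α : ℝ} (hα : -1 / 2 < α) (ψ σ₁ σ₂ : ℝ) :
    ∃ (ν : Measure EntireFunction) (_ : IsProbabilityMeasure ν),
      IsLiquidGAF α ψ σ₁ σ₂ (fun f : EntireFunction => f) ν := by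
  -- Away from the real directions both components get the average variance, which makes the
  -- coefficients circularly symmetric.
  obtain ⟨s₁, s₂, hs, hs'⟩ : ∃ s₁ s₂ : ℝ, s₁ ^ 2 + s₂ ^ 2 = σ₁ ^ 2 + σ₂ ^ 2 ∧
      s₁ ^ 2 - s₂ ^ 2 = if ψ = 0 ∨ ψ = Real.pi then σ₁ ^ 2 - σ₂ ^ 2 else 0 := by
    split_ifs
    · exact ⟨σ₁, σ₂, rfl, rfl⟩
    · refine ⟨√((σ₁ ^ 2 + σ₂ ^ 2) / 2), √((σ₁ ^ 2 + σ₂ ^ 2) / 2), ?_, by ring⟩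
      rw [Real.sq_sqrt (by positivity)]
      ring
  obtain ⟨Ω, mΩ, P, hP, G, hGm, hgauss, hmean, hc, hpc⟩ := exists_gaf hα s₁ s₂
  have heval : ∀ u : ℂ, Continuous fun f : EntireFunction => f.1 u :=
    EntireFunction.continuous_eval
  refine ⟨P.map G, Measure.isProbabilityMeasure_map hGm.aemeasurable, ⟨measurable_id.aemeasurable,
    ⟨fun I => ⟨?_⟩⟩, fun u => ?_⟩, fun u w => ?_, fun u w => ?_⟩
  · have hI : Measurable fun f : EntireFunction => I.restrict fun u => f.1 u :=
      measurable_pi_lambda _ fun u => (heval u).measurable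
    rw [Measure.map_map hI hGm]
    exact (hgauss.hasGaussianLaw I).isGaussian_map
  · rw [integral_map hGm.aemeasurable (heval u).aestronglyMeasurable]
    exact hmean u
  · have hm : Continuous fun f : EntireFunction => f.1 u * conj (f.1 w) :=
      (heval u).mul (Complex.continuous_conj.comp (heval w))
    rw [integral_map hGm.aemeasurable hm.aestronglyMeasurable, hc, hs]
  · have hm : Continuous fun f : EntireFunction => f.1 u * f.1 w := (heval u).mul (heval w)
    rw [integral_map hGm.aemeasurable hm.aestronglyMeasurable, hpc, hs']
    split_ifs <;> simp

end Existence

/-! ### Continuity of the zero set -/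

namespace EntireFunction

theorem analyticOnNhd (f : EntireFunction) (s : Set ℂ) : AnalyticOnNhd ℂ f.1 s := fun z _ =>
  Differentiable.analyticAt (f := (f.1 : ℂ → ℂ)) f.2 z

theorem analyticOrderNatAt_eq_zero {f : EntireFunction} {z : ℂ} (hz : f.1 z ≠ 0) :
    analyticOrderNatAt f.1 z = 0 := by
  by_contra h
  exact hz (apply_eq_zero_of_analyticOrderNatAt_ne_zero h)

theorem apply_ne_zero {f : EntireFunction} (hf : f ≠ 0) {z : ℂ}
    (hz : analyticOrderNatAt f.1 z = 0) : f.1 z ≠ 0 := by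
  intro h0
  have h1 : analyticOrderAt f.1 z ≠ 0 :=
    (f.analyticOnNhd univ z (mem_univ z)).analyticOrderAt_ne_zero.mpr h0
  have h2 : analyticOrderAt f.1 z = ⊤ := by
    rcases ENat.toNat_eq_zero.mp hz with h | h
    · exact absurd h h1
    · exact h
  refine hf (ext_apply fun w => ?_)
  have := (f.analyticOnNhd univ).eq_of_eventuallyEq (g := fun _ => 0) (fun _ _ => analyticAt_const)
    (analyticOrderAt_eq_top.mp h2)
  exact congrFun this w

/-- The zero counting measure of a set is the number of zeros in it, with multiplicities. -/
theorem zeroMeasure_apply (f : EntireFunction) {B : Set ℂ} (hB : MeasurableSet B) {s : Finset ℂ}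
    (hs : ∀ u, u ∈ s ↔ u ∈ B ∧ analyticOrderNatAt f.1 u ≠ 0) :
    zeroMeasure f B = ∑ u ∈ s, (analyticOrderNatAt f.1 u : ℝ≥0∞) := by
  rw [zeroMeasure, Measure.sum_apply _ hB, tsum_eq_sum (s := s)]
  · refine Finset.sum_congr rfl fun u hu => ?_
    simp [Measure.dirac_apply' u hB, ((hs u).mp hu).1]
  · intro u hu
    by_cases huB : u ∈ B
    · have : analyticOrderNatAt f.1 u = 0 := by
        by_contra hne
        exact hu ((hs u).mpr ⟨huB, hne⟩)
      simp [this]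
    · simp [Measure.dirac_apply' u hB, huB]

theorem zeroMeasure_eq_zero {f : EntireFunction} {B : Set ℂ} (hB : MeasurableSet B)
    (h : ∀ u ∈ B, f.1 u ≠ 0) : zeroMeasure f B = 0 := by
  rw [zeroMeasure_apply f hB (s := ∅)]
  · simp
  · intro u
    simp only [Finset.notMem_empty, false_iff, not_and, not_not]
    exact fun hu => analyticOrderNatAt_eq_zero (h u hu)

/-- Jensen's formula for an entire function. -/
theorem circleAverage_log_norm (f : EntireFunction) {c : ℂ} {r : ℝ} (hr : 0 < r) {s : Finset ℂ}
    (hs : ∀ u, u ∈ s ↔ u ∈ Metric.closedBall c r ∧ analyticOrderNatAt f.1 u ≠ 0) :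
    Real.circleAverage (fun z => Real.log ‖f.1 z‖) c r =
      ∑ u ∈ s, (analyticOrderNatAt f.1 u : ℝ) * (Real.log r - Real.log ‖c - u‖) +
        Real.log ‖meromorphicTrailingCoeffAt f.1 c‖ := by
  have habs : |r| = r := abs_of_pos hr
  have hD : ∀ u, MeromorphicOn.divisor f.1 (Metric.closedBall c |r|) u =
      if u ∈ s then (analyticOrderNatAt f.1 u : ℤ) else 0 := by
    intro u
    by_cases hu : u ∈ Metric.closedBall c |r|
    · rw [MeromorphicOn.AnalyticOnNhd.divisor_apply (f.analyticOnNhd _) hu]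
      have h1 : ((analyticOrderAt f.1 u).map (Nat.cast : ℕ → ℤ)).untop₀ =
          analyticOrderNatAt f.1 u := by
        unfold analyticOrderNatAt
        cases h : analyticOrderAt f.1 u <;> simp
      rw [h1]
      split_ifs with hus
      · rfl
      · rw [habs] at hu
        by_contra hne
        exact hus ((hs u).mpr ⟨hu, by exact_mod_cast hne⟩)
    · rw [Function.locallyFinsuppWithin.apply_eq_zero_of_notMem _ hu, if_neg]
      intro hus
      exact hu (habs.symm ▸ ((hs u).mp hus).1)
  rw [MeromorphicOn.circleAverage_log_norm hr.ne' (f.analyticOnNhd _).meromorphicOn]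
  congr 1
  have hfin : (fun u => MeromorphicOn.divisor f.1 (Metric.closedBall c |r|) u).HasFiniteSupport :=
    (MeromorphicOn.divisor f.1 _).finiteSupport (isCompact_closedBall c |r|)
  rw [← countingFunction_finsum_eq_finsum_add hr.ne' hfin, finsum_eq_sum_of_support_subset (s := s)]
  · refine Finset.sum_congr rfl fun u hu => ?_
    rw [hD, if_pos hu]
    simp
  · intro u hu
    by_contra hus
    refine hu ?_
    simp only [Finset.mem_coe] at hus
    simp [hD, hus]

/-- The number of zeros in a disc is the increment of the circle averages of `log ‖f‖` over an
annulus without zeros. -/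
theorem zeroMeasure_closedBall_mul_log (f : EntireFunction) {c : ℂ} {r : ℝ} (hr : 0 < r)
    (hf : ∀ u, r ≤ ‖u - c‖ → ‖u - c‖ ≤ 2 * r → f.1 u ≠ 0) :
    (zeroMeasure f (Metric.closedBall c r)).toReal * Real.log 2 =
      Real.circleAverage (fun z => Real.log ‖f.1 z‖) c (2 * r) -
        Real.circleAverage (fun z => Real.log ‖f.1 z‖) c r := by
  have hfin := analyticOrderNatAt_support_finite f (Metric.isBounded_closedBall (x := c) (r := r))
  set s := hfin.toFinset with hs
  have hs1 : ∀ u, u ∈ s ↔ u ∈ Metric.closedBall c r ∧ analyticOrderNatAt f.1 u ≠ 0 := fun u => by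
    rw [hs, Set.Finite.mem_toFinset]
    rfl
  have hs2 : ∀ u, u ∈ s ↔ u ∈ Metric.closedBall c (2 * r) ∧ analyticOrderNatAt f.1 u ≠ 0 := by
    intro u
    rw [hs1, mem_closedBall_iff_norm, mem_closedBall_iff_norm]
    refine ⟨fun h => ⟨by linarith [h.1], h.2⟩, fun h => ⟨?_, h.2⟩⟩
    by_contra hcon
    exact h.2 (analyticOrderNatAt_eq_zero (hf u (not_le.mp hcon).le h.1))
  rw [circleAverage_log_norm f (by linarith) hs2, circleAverage_log_norm f hr hs1,
    zeroMeasure_apply f measurableSet_closedBall hs1, ENNReal.toReal_sum (by simp),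
    Finset.sum_mul, add_sub_add_right_eq_sub, ← Finset.sum_sub_distrib]
  refine Finset.sum_congr rfl fun u _ => ?_
  rw [ENNReal.toReal_natCast, Real.log_mul two_ne_zero hr.ne']
  ring

theorem eventually_apply_ne_zero {f : EntireFunction} {K : Set ℂ} (hK : IsCompact K)
    (hf : ∀ z ∈ K, f.1 z ≠ 0) :
    ∃ m > 0, ∃ M, ∀ᶠ g : EntireFunction in 𝓝 f, ∀ z ∈ K, m ≤ ‖g.1 z‖ ∧ ‖g.1 z‖ ≤ M := by
  obtain ⟨R, hR⟩ := hK.isBounded.subset_closedBall 0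
  have hlim := (tendsto_iff_closedBall.mp (tendsto_id (x := 𝓝 f))) R
  rw [Metric.tendstoUniformlyOn_iff] at hlim
  rcases K.eq_empty_or_nonempty with rfl | hne
  · exact ⟨1, one_pos, 0, Eventually.of_forall fun g z hz => absurd hz (notMem_empty z)⟩
  have hc : ContinuousOn (fun z => ‖f.1 z‖) K := f.1.continuous.norm.continuousOn
  obtain ⟨z₀, hz₀, hmin⟩ := hK.exists_isMinOn hne hc
  obtain ⟨z₁, hz₁, hmax⟩ := hK.exists_isMaxOn hne hc
  have hpos : 0 < ‖f.1 z₀‖ := norm_pos_iff.mpr (hf z₀ hz₀)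
  refine ⟨‖f.1 z₀‖ / 2, by positivity, ‖f.1 z₁‖ + ‖f.1 z₀‖ / 2, ?_⟩
  filter_upwards [hlim (‖f.1 z₀‖ / 2) (by positivity)] with g hg z hz
  have h1 := hg z (hR hz)
  rw [dist_eq_norm] at h1
  have h2 : ‖f.1 z₀‖ ≤ ‖f.1 z‖ := hmin hz
  have h3 : ‖f.1 z‖ ≤ ‖f.1 z₁‖ := hmax hz
  have h4 := norm_sub_norm_le (f.1 z) (g.1 z)
  have h5 := norm_sub_norm_le (g.1 z) (f.1 z)
  rw [norm_sub_rev] at h5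
  simp only [id] at h1
  constructor <;> linarith

theorem tendsto_circleAverage_log_norm {f : EntireFunction} {c : ℂ} {r : ℝ}
    (hf : ∀ z ∈ Metric.sphere c |r|, f.1 z ≠ 0) :
    Tendsto (fun g : EntireFunction => Real.circleAverage (fun z => Real.log ‖g.1 z‖) c r) (𝓝 f)
      (𝓝 (Real.circleAverage (fun z => Real.log ‖f.1 z‖) c r)) := by
  obtain ⟨m, hm, M, hM⟩ := eventually_apply_ne_zero (isCompact_sphere c |r|) hf
  simp only [Real.circleAverage_def]
  refine Tendsto.const_smul ?_ _
  have hmem : ∀ θ, circleMap c r θ ∈ Metric.sphere c |r| := circleMap_mem_sphere' c r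
  refine intervalIntegral.tendsto_integral_filter_of_dominated_convergence
    (fun _ => max |Real.log m| |Real.log M|) ?_ ?_ intervalIntegrable_const ?_
  · refine Eventually.of_forall fun g => Measurable.aestronglyMeasurable ?_
    exact Real.measurable_log.comp
      ((g.1.continuous.comp (continuous_circleMap c r)).norm.measurable)
  · filter_upwards [hM] with g hg
    refine ae_of_all _ fun θ _ => ?_
    obtain ⟨h1, h2⟩ := hg _ (hmem θ)
    have h3 : 0 < ‖g.1 (circleMap c r θ)‖ := hm.trans_le h1
    rw [Real.norm_eq_abs, abs_le]
    have h4 := Real.log_le_log hm h1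
    have h5 := Real.log_le_log h3 h2
    constructor
    · linarith [neg_abs_le (Real.log m), le_max_left |Real.log m| |Real.log M|]
    · linarith [le_abs_self (Real.log M), le_max_right |Real.log m| |Real.log M|]
  · refine ae_of_all _ fun θ _ => ?_
    have h1 := ((continuous_eval (circleMap c r θ)).tendsto f).norm
    exact (Real.continuousAt_log (norm_ne_zero_iff.mpr (hf _ (hmem θ)))).tendsto.comp h1

/-- Hurwitz's theorem for a disc: the number of zeros is continuous where no zero is on or slightly
outside the boundary. -/
theorem tendsto_zeroMeasure_closedBall {f : EntireFunction} {c : ℂ} {r : ℝ} (hr : 0 < r)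
    (hf : ∀ u, r ≤ ‖u - c‖ → ‖u - c‖ ≤ 2 * r → f.1 u ≠ 0) :
    Tendsto (fun g : EntireFunction => (zeroMeasure g (Metric.closedBall c r)).toReal) (𝓝 f)
      (𝓝 (zeroMeasure f (Metric.closedBall c r)).toReal) := by
  have hlog : Real.log 2 ≠ 0 := (Real.log_pos one_lt_two).ne'
  have hK : IsCompact (Metric.closedBall c (2 * r) ∩ {u : ℂ | r ≤ ‖u - c‖}) :=
    (isCompact_closedBall c (2 * r)).inter_right (isClosed_le continuous_const (by fun_prop))
  obtain ⟨m, hm, M, hM⟩ := eventually_apply_ne_zero hK fun u hu =>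
    hf u hu.2 (mem_closedBall_iff_norm.mp hu.1)
  have h1 : Tendsto (fun g : EntireFunction =>
      (Real.circleAverage (fun z => Real.log ‖g.1 z‖) c (2 * r) -
        Real.circleAverage (fun z => Real.log ‖g.1 z‖) c r) / Real.log 2) (𝓝 f)
      (𝓝 ((Real.circleAverage (fun z => Real.log ‖f.1 z‖) c (2 * r) -
        Real.circleAverage (fun z => Real.log ‖f.1 z‖) c r) / Real.log 2)) := by
    refine ((tendsto_circleAverage_log_norm fun z hz => ?_).sub
      (tendsto_circleAverage_log_norm fun z hz => ?_)).div_const _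
    · rw [mem_sphere_iff_norm, abs_of_pos (by linarith)] at hz
      exact hf z (by linarith) hz.le
    · rw [mem_sphere_iff_norm, abs_of_pos hr] at hz
      exact hf z hz.ge (by linarith)
  rw [← zeroMeasure_closedBall_mul_log f hr hf, mul_div_cancel_right₀ _ hlog] at h1
  refine h1.congr' ?_
  filter_upwards [hM] with g hg
  rw [← zeroMeasure_closedBall_mul_log g hr fun u h1 h2 =>
    norm_pos_iff.mp (hm.trans_le (hg u ⟨mem_closedBall_iff_norm.mpr h2, h1⟩).1),
    mul_div_cancel_right₀ _ hlog]

instance (f : EntireFunction) : IsLocallyFiniteMeasure (zeroMeasure f) := (zeros f).2.1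

/-- If all zeros in the support of `φ` lie in disjoint discs on which `φ` is almost constant, then
`∫ φ` is determined by the numbers of zeros in the discs, up to a small error. -/
theorem abs_integral_zeroMeasure_sub_le (f : EntireFunction) (φ : C_c(ℂ, ℝ)) {Z : Finset ℂ}
    {r ε : ℝ} (hdisj : (Z : Set ℂ).Pairwise
      (Function.onFun Disjoint fun z => Metric.closedBall z r))
    (hφ : ∀ z ∈ Z, ∀ u ∈ Metric.closedBall z r, ‖φ u - φ z‖ ≤ ε)
    (hf : ∀ u ∈ tsupport φ, (∀ z ∈ Z, u ∉ Metric.closedBall z r) → f.1 u ≠ 0) :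
    |∫ u, φ u ∂zeroMeasure f -
      ∑ z ∈ Z, φ z * (zeroMeasure f (Metric.closedBall z r)).toReal| ≤
      ε * ∑ z ∈ Z, (zeroMeasure f (Metric.closedBall z r)).toReal := by
  set μ := zeroMeasure f with hμ
  have hint : Integrable φ μ := φ.continuous.integrable_of_hasCompactSupport φ.hasCompactSupport
  set U : Set ℂ := ⋃ z ∈ Z, Metric.closedBall z r with hU
  have hUm : MeasurableSet U := Z.measurableSet_biUnion fun z _ => measurableSet_closedBall
  have hnull : μ (tsupport φ \ U) = 0 := by
    refine zeroMeasure_eq_zero ((isClosed_tsupport φ).measurableSet.diff hUm) fun u hu => ?_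
    refine hf u hu.1 fun z hz hzu => hu.2 ?_
    exact mem_biUnion (Finset.mem_coe.mpr hz) hzu
  have h1 : ∫ u, φ u ∂μ = ∫ u in U, φ u ∂μ := by
    refine (setIntegral_eq_integral_of_ae_compl_eq_zero ?_).symm
    filter_upwards [measure_eq_zero_iff_ae_notMem.mp hnull] with u hu huU
    by_contra hne
    exact hu ⟨subset_tsupport φ hne, huU⟩
  rw [h1, integral_biUnion_finset Z (fun z _ => measurableSet_closedBall) hdisj
    fun z _ => hint.integrableOn, ← Finset.sum_sub_distrib, Finset.mul_sum]
  refine (Finset.abs_sum_le_sum_abs _ _).trans (Finset.sum_le_sum fun z hz => ?_)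
  have hfin : μ (Metric.closedBall z r) < ∞ := (isCompact_closedBall z r).measure_lt_top
  have h2 : φ z * (μ (Metric.closedBall z r)).toReal = ∫ _ in Metric.closedBall z r, φ z ∂μ := by
    rw [setIntegral_const, smul_eq_mul, mul_comm, Measure.real]
  rw [h2, ← integral_sub hint.integrableOn (integrableOn_const hfin.ne), ← Real.norm_eq_abs]
  exact norm_setIntegral_le_of_norm_le_const hfin (hφ z hz)

/-- Hurwitz's theorem: the point measure of zeros depends continuously on the function, except at
the null function. -/
theorem continuousAt_zeros {f : EntireFunction} (hf : f ≠ 0) : ContinuousAt zeros f := by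
  have hind : IsInducing fun (μ : PointMeasure) (φ : C_c(ℂ, ℝ)) => ∫ z, φ z ∂μ.1 := ⟨rfl⟩
  rw [ContinuousAt, hind.tendsto_nhds_iff, tendsto_pi_nhds]
  intro φ
  change Tendsto (fun g : EntireFunction => ∫ z, φ z ∂zeroMeasure g) (𝓝 f)
    (𝓝 (∫ z, φ z ∂zeroMeasure f))
  obtain ⟨R, hR⟩ := φ.hasCompactSupport.isCompact.isBounded.subset_closedBall 0
  -- `W` contains all zeros that can come close to the support of `φ`.
  set W := (analyticOrderNatAt_support_finite f
    (Metric.isBounded_closedBall (x := (0 : ℂ)) (r := R + 2))).toFinset with hW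
  have hWmem : ∀ u, u ∈ W ↔ u ∈ Metric.closedBall (0 : ℂ) (R + 2) ∧
      analyticOrderNatAt f.1 u ≠ 0 := fun u => by
    rw [hW, Set.Finite.mem_toFinset]
    rfl
  set Z := W.filter fun u => ‖u‖ ≤ R with hZ
  have hZW : ∀ z ∈ Z, z ∈ W ∧ ‖z‖ ≤ R := fun z hz => Finset.mem_filter.mp hz
  set M := (zeroMeasure f (Metric.closedBall 0 (R + 2))).toReal with hM
  have hM0 : 0 ≤ M := ENNReal.toReal_nonneg
  rw [Metric.tendsto_nhds]
  intro ε hε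
  set δ := ε / (2 * M + 3) with hδ
  have hδ0 : 0 < δ := by positivity
  obtain ⟨η, hη, hφη⟩ := Metric.uniformContinuous_iff.mp
    (φ.continuous.uniformContinuous_of_tendsto_cocompact φ.hasCompactSupport.is_zero_at_infty) δ hδ0
  -- A radius for which the discs around the points of `Z` are disjoint and isolate the zeros.
  obtain ⟨r, ⟨hr0, hr1, hrη⟩, hrW⟩ : ∃ r : ℝ, (0 < r ∧ r ≤ 1 ∧ r < η) ∧
      ∀ z ∈ W, ∀ w ∈ W, z ≠ w → 2 * r < dist z w := by
    have h1 : ∀ᶠ r : ℝ in 𝓝[>] 0, 0 < r ∧ r ≤ 1 ∧ r < η := by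
      filter_upwards [Ioo_mem_nhdsGT (lt_min one_pos hη)] with r hr
      exact ⟨hr.1, (hr.2.trans_le (min_le_left _ _)).le, hr.2.trans_le (min_le_right _ _)⟩
    have h2 : ∀ᶠ r : ℝ in 𝓝[>] 0, ∀ z ∈ W, ∀ w ∈ W, z ≠ w → 2 * r < dist z w := by
      rw [Finset.eventually_all]
      intro z _
      rw [Finset.eventually_all]
      intro w _
      by_cases hzw : z = w
      · simp [hzw]
      have hd : 0 < dist z w / 2 := half_pos (dist_pos.mpr hzw)
      filter_upwards [Ioo_mem_nhdsGT hd] with r hr _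
      linarith [hr.2]
    exact (h1.and h2).exists
  have hdisj : (Z : Set ℂ).Pairwise (Function.onFun Disjoint fun z => Metric.closedBall z r) := by
    intro z hz w hw hzw
    refine Metric.closedBall_disjoint_closedBall ?_
    have := hrW z (hZW z hz).1 w (hZW w hw).1 hzw
    linarith
  have hφ : ∀ z ∈ Z, ∀ u ∈ Metric.closedBall z r, ‖φ u - φ z‖ ≤ δ := by
    intro z _ u hu
    rw [← dist_eq_norm]
    exact (hφη ((Metric.mem_closedBall.mp hu).trans_lt hrη)).le
  have hiso : ∀ z ∈ Z, ∀ u, r ≤ ‖u - z‖ → ‖u - z‖ ≤ 2 * r → f.1 u ≠ 0 := by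
    intro z hz u h1 h2
    refine apply_ne_zero hf ?_
    by_contra hne
    have huW : u ∈ W := by
      refine (hWmem u).mpr ⟨?_, hne⟩
      rw [mem_closedBall_zero_iff]
      have := norm_add_le (u - z) z
      rw [sub_add_cancel] at this
      linarith [(hZW z hz).2]
    have hne' : z ≠ u := by
      rintro rfl
      rw [sub_self, norm_zero] at h1
      linarith
    have := hrW z (hZW z hz).1 u huW hne'
    rw [dist_comm, dist_eq_norm] at this
    linarith
  set K := tsupport φ \ ⋃ z ∈ Z, Metric.ball z r with hK
  have hKc : IsCompact K := φ.hasCompactSupport.isCompact.diff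
    (isOpen_biUnion fun z _ => Metric.isOpen_ball)
  have hfK : ∀ u ∈ K, f.1 u ≠ 0 := by
    intro u hu
    refine apply_ne_zero hf ?_
    by_contra hne
    have huR : ‖u‖ ≤ R := mem_closedBall_zero_iff.mp (hR hu.1)
    have huZ : u ∈ Z := by
      refine Finset.mem_filter.mpr ⟨(hWmem u).mpr ⟨?_, hne⟩, huR⟩
      rw [mem_closedBall_zero_iff]
      linarith
    exact hu.2 (mem_biUnion (Finset.mem_coe.mpr huZ) (Metric.mem_ball_self hr0))
  have happly : ∀ g : EntireFunction, (∀ u ∈ K, g.1 u ≠ 0) →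
      ∀ u ∈ tsupport φ, (∀ z ∈ Z, u ∉ Metric.closedBall z r) → g.1 u ≠ 0 := by
    intro g hg u hu huZ
    refine hg u ⟨hu, fun hmem => ?_⟩
    obtain ⟨z, hz, hzu⟩ := mem_iUnion₂.mp hmem
    exact huZ z hz (Metric.ball_subset_closedBall hzu)
  set N : EntireFunction → ℂ → ℝ := fun g z =>
    (zeroMeasure g (Metric.closedBall z r)).toReal with hN
  have hNM : ∑ z ∈ Z, N f z ≤ M := by
    have hsub : (⋃ z ∈ Z, Metric.closedBall z r) ⊆ Metric.closedBall 0 (R + 2) := by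
      refine iUnion₂_subset fun z hz u hu => ?_
      rw [mem_closedBall_iff_norm] at hu
      rw [mem_closedBall_zero_iff]
      have := norm_add_le (u - z) z
      rw [sub_add_cancel] at this
      linarith [(hZW z hz).2]
    have hfin : ∀ z ∈ Z, zeroMeasure f (Metric.closedBall z r) ≠ ∞ := fun z _ =>
      (isCompact_closedBall z r).measure_lt_top.ne
    rw [hN, ← ENNReal.toReal_sum hfin,
      ← measure_biUnion_finset hdisj fun z _ => measurableSet_closedBall]
    exact ENNReal.toReal_mono (isCompact_closedBall _ _).measure_lt_top.ne (measure_mono hsub)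
  have hlim1 : Tendsto (fun g => ∑ z ∈ Z, N g z) (𝓝 f) (𝓝 (∑ z ∈ Z, N f z)) :=
    tendsto_finsetSum _ fun z hz => tendsto_zeroMeasure_closedBall hr0 (hiso z hz)
  have hlim2 : Tendsto (fun g => ∑ z ∈ Z, φ z * N g z) (𝓝 f) (𝓝 (∑ z ∈ Z, φ z * N f z)) :=
    tendsto_finsetSum _ fun z hz =>
      (tendsto_zeroMeasure_closedBall hr0 (hiso z hz)).const_mul _
  obtain ⟨m, hm, m', hm'⟩ := eventually_apply_ne_zero hKc hfK
  have hf' := abs_integral_zeroMeasure_sub_le f φ hdisj hφ (happly f hfK)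
  filter_upwards [hm', (Metric.tendsto_nhds.mp hlim1) 1 one_pos,
    (Metric.tendsto_nhds.mp hlim2) δ hδ0] with g hg h1 h2
  have hg' := abs_integral_zeroMeasure_sub_le g φ hdisj hφ
    (happly g fun u hu => norm_pos_iff.mp (hm.trans_le (hg u hu).1))
  rw [Real.dist_eq] at h1 h2 ⊢
  have h3 : ∑ z ∈ Z, N g z ≤ M + 1 := by
    have := le_abs_self (∑ z ∈ Z, N g z - ∑ z ∈ Z, N f z)
    linarith
  have h4 : δ * ∑ z ∈ Z, N g z ≤ δ * (M + 1) := by gcongr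
  have h5 : δ * ∑ z ∈ Z, N f z ≤ δ * M := by gcongr
  have h6 : δ * (2 * M + 3) = ε := by
    rw [hδ]
    field_simp
  have h7 := abs_add_three (∫ z, φ z ∂zeroMeasure g - ∑ z ∈ Z, φ z * N g z)
    (∑ z ∈ Z, φ z * N g z - ∑ z ∈ Z, φ z * N f z)
    (∑ z ∈ Z, φ z * N f z - ∫ z, φ z ∂zeroMeasure f)
  rw [abs_sub_comm (∑ z ∈ Z, φ z * N f z)] at h7
  have h8 : (∫ z, φ z ∂zeroMeasure g - ∑ z ∈ Z, φ z * N g z) +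
      (∑ z ∈ Z, φ z * N g z - ∑ z ∈ Z, φ z * N f z) +
      (∑ z ∈ Z, φ z * N f z - ∫ z, φ z ∂zeroMeasure f) =
      ∫ z, φ z ∂zeroMeasure g - ∫ z, φ z ∂zeroMeasure f := by ring
  rw [h8] at h7
  nlinarith

instance : T1Space EntireFunction := Subtype.t1Space

theorem measurable_zeros : Measurable zeros :=
  measurable_of_continuousOn_compl_singleton 0 fun _ hf =>
    (continuousAt_zeros hf).continuousWithinAt

theorem zeros_smul {c : ℂ} (hc : c ≠ 0) (f : EntireFunction) : zeros (c • f) = zeros f := by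
  refine Subtype.ext ?_
  change zeroMeasure (c • f) = zeroMeasure f
  unfold zeroMeasure
  congr 1
  funext z
  have h1 : analyticOrderAt ((c • f : EntireFunction).1 : ℂ → ℂ) z = analyticOrderAt f.1 z := by
    have h2 : ((c • f : EntireFunction).1 : ℂ → ℂ) = (fun _ => c) * (f.1 : ℂ → ℂ) := by
      funext w
      simp
    rw [h2, analyticOrderAt_mul analyticAt_const (f.analyticOnNhd univ z (mem_univ z)),
      (analyticAt_const (v := c)).analyticOrderAt_eq_zero.mpr hc, zero_add]
  rw [analyticOrderNatAt, h1, ← analyticOrderNatAt]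

end EntireFunction

/-! ### The local scaling limit -/

theorem theorem3p1 {Ω : Type*} [MeasurableSpace Ω] (P : Measure Ω) [IsProbabilityMeasure P]
    -- the i.i.d. coefficients
    (ξ : ℕ → Ω → ℂ) (hindep : iIndepFun ξ P) (hident : ∀ k, IdentDistrib (ξ k) (ξ 0) P P)
    -- centred, with finite second moments, non-degenerate, uncorrelated real and imaginary parts
    (hmem : MemLp (ξ 0) 2 P) (hmean : ∫ ω, ξ 0 ω ∂P = 0)
    (σ₁ σ₂ : ℝ) (hσ₁ : σ₁ ^ 2 = ∫ ω, (ξ 0 ω).re ^ 2 ∂P)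
    (hσ₂ : σ₂ ^ 2 = ∫ ω, (ξ 0 ω).im ^ 2 ∂P) (hσ : 0 < σ₁ ^ 2 + σ₂ ^ 2)
    (hcov : cov[fun ω => (ξ 0 ω).re, fun ω => (ξ 0 ω).im; P] = 0)
    -- regularly varying amplitudes of index `α > -1/2`
    (b : ℝ → ℝ) (α : ℝ) (hb : RegularlyVarying b α) (hα : -1 / 2 < α)
    (ψ : ℝ) (hψ : ψ ∈ Ico 0 (2 * Real.pi)) :
    -- the Gaussian analytic function `G_ψ` exists
    (∃ (ν : Measure EntireFunction) (_ : IsProbabilityMeasure ν),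
      IsLiquidGAF α ψ σ₁ σ₂ (fun f : EntireFunction => f) ν) ∧
    -- and any version of it is almost surely not the null function and is the limit
    ∀ (Ω' : Type*) [MeasurableSpace Ω'] (P' : Measure Ω') [IsProbabilityMeasure P']
      (G : Ω' → EntireFunction), IsLiquidGAF α ψ σ₁ σ₂ G P' →
      (∀ᵐ ω ∂P', G ω ≠ 0) ∧
      TendstoInDistribution (fun (n : ℕ) ω => normalizedLocalPoly b (fun k => ξ k ω) ψ n)
        atTop G (fun _ => P) P' ∧
      TendstoInDistribution (fun (n : ℕ) ω => zeros (localPoly b (fun k => ξ k ω) ψ n))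
        atTop (fun ω => zeros (G ω)) (fun _ => P) P' := by
  have hre : MemLp (fun ω => (ξ 0 ω).re) 2 P := hmem.re
  have him : MemLp (fun ω => (ξ 0 ω).im) 2 P := hmem.im
  have hint : Integrable (ξ 0) P := hmem.integrable (by norm_num)
  have hre0 : ∫ ω, (ξ 0 ω).re ∂P = 0 := by
    have h := integral_re hint
    simp only [RCLike.re_eq_complex_re] at h
    rw [h, hmean, Complex.zero_re]
  have hreim : ∫ ω, (ξ 0 ω).re * (ξ 0 ω).im ∂P = 0 := by
    rw [covariance_eq_sub hre him, hre0, zero_mul, sub_zero] at hcov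
    exact hcov
  have hξ : IsCoefficientSequence P ξ σ₁ σ₂ :=
    ⟨hindep, hident, hmem, hmean, hσ₁.symm, hσ₂.symm, hreim⟩
  have hw := hb.isRegularWeight hα
  refine ⟨exists_isLiquidGAF hα ψ σ₁ σ₂, fun Ω' _ P' _ G hG => ?_⟩
  have hG0 := hG.ae_ne_zero hα hσ
  have hlim := hξ.tendstoInDistribution_normalizedLocalPoly hw hα hψ hG
  refine ⟨hG0, hlim, ?_⟩
  have hzeros := hlim.comp_of_ae_continuousAt EntireFunction.measurable_zeros (N := {0})
    (fun _ hf => EntireFunction.continuousAt_zeros hf) hG0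
  -- The normalization is an invertible constant as soon as `n > 0` and `b n ≠ 0`.
  refine hzeros.congr_of_eventually_eq (fun n => ?_) ?_
  · exact (EntireFunction.measurable_zeros.comp (measurable_localPoly b ψ n)).comp_aemeasurable
      (aemeasurable_pi_lambda _ fun k => hξ.aemeasurable k)
  · filter_upwards [hw.eventually_pos, eventually_gt_atTop 0] with n hn hn0
    funext ω
    have hn0' : (0 : ℝ) < n := by exact_mod_cast hn0
    refine EntireFunction.zeros_smul (inv_ne_zero ?_) _
    have hbn : b n ≠ 0 := fun h => by simp [h] at hn
    exact_mod_cast mul_ne_zero hbn (Real.sqrt_pos.mpr hn0').ne'
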